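/- Let $(M,g)$ be a (possibly incomplete) smooth Riemannian manifold without boundary, of dimension $m$, with Riemannian measure $\mathrm{dvol}_g$. For a real or complex vector bundle $E\to M$ of finite rank with a smooth metric $h$ (Riemannian if $E$ is real, Hermitian if $E$ is complex) let $L^2(M,E)$ be the space of measurable sections $s$ with $\int_M |s|_h^2\,\mathrm{dvol}_g<\infty$, and let $\tilde h$ be the metric on $T^*M\otimes E$ induced by $g$ and $h$. For a metric connection $\nabla:C^\infty(M,E)\to C^\infty(M,T^*M\otimes E)$ let $\nabla^t:C_c^\infty(M,T^*M\otimes E)\to C_c^\infty(M,E)$ be its formal adjoint, i.e. $\int_M h(u,\nabla^t\varphi)\,\mathrm{dvol}_g=\int_M\tilde h(\nabla u,\varphi)\,\mathrm{dvol}_g$ for all $u\in C_c^\infty(M,E)$. Define - $W^{1,2}(M,E)$ as the set of $s\in L^2(M,E)$ for which there is $v\in L^2(M,T^*M\otimes E)$ with $\int_M h(s,\nabla^t\varphi)\,\mathrm{dvol}_g=\int_M\tilde h(v,\varphi)\,\mathrm{dvol}_g$ for all $\varphi\in C_c^\infty(M,T^*M\otimes E)$; - $W^{1,2}_0(M,E)$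 as the set of $s\in L^2(M,E)$ for which there are $s_i\in C_c^\infty(M,E)$ and $w\in L^2(M,T^*M\otimes E)$ with $s_i\to s$ in $L^2(M,E)$ and $\nabla s_i\to w$ in $L^2(M,T^*M\otimes E)$. For functions, write $d_{0,\min}f=\eta$ if $f\in L^2(M)$, $\eta\in L^2(M,T^*M)$ and there are $f_i\in C_c^\infty(M)$ with $f_i\to f$ in $L^2$ and $df_i\to\eta$ in $L^2$; every Lipschitz function with compact support has such an $\eta$, unique up to null sets. Assume that there is a sequence $(\phi_j)_{j\in\mathbb N}$ of functions $M\to\mathbb R$ with compact support, Lipschitz with respect to the Riemannian distance, such that - $0\le\phi_j\le 1$ for each $j$; - $\phi_j\to 1$ pointwise on $M$; - $\lim_{j\to\infty}\|d_{0,\min}\phi_j\|_{L^2(M,T^*M)}=0$. Then for every real or complex vector bundle $E$ over $M$ with a (Riemannian, respectively Hermitian) metric $h$ and every metric connection $\nabla$ on $E$, $$W^{1,2}_0(M,E)=W^{1,2}(M,E).$$ -/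

import Mathlib

open Bundle Manifold MeasureTheory Filter Topology
open scoped ContDiff ENNReal NNReal

noncomputable section

namespace MetricSobolev

/-! ### Riemannian distance and Riemannian measure -/

section Manifold

variable (m : ℕ) {M : Type*} [TopologicalSpace M] [ChartedSpace (EuclideanSpace ℝ (Fin m)) M]
  [RiemannianBundle (fun x : M ↦ TangentSpace (𝓡 m) x)]

instance (x : M) : FiniteDimensional ℝ (TangentSpace (𝓡 m) x) :=
  inferInstanceAs (FiniteDimensional ℝ (EuclideanSpace ℝ (Fin m)))

/-- Real functions that are Lipschitz with respect to the Riemannian distance (the infimum of the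
lengths of curves; it is `∞` between different connected components). -/
def IsLipschitz (f : M → ℝ) : Prop :=
  ∃ K : ℝ≥0, ∀ x y, edist (f x) (f y) ≤ K * riemannianEDist (𝓡 m) x y

/-- The Gram matrix `g_ij = g(∂_i, ∂_j)` of the Riemannian metric in the chart around `x₀`, at the
point with coordinates `y`. The `i`-th coordinate vector `∂_i` is the image of the `i`-th standard
basis vector under the differential of the inverse of the chart. -/
def chartGram (x₀ : M) (y : EuclideanSpace ℝ (Fin m)) : Matrix (Fin m) (Fin m) ℝ :=
  let e := chartAt (EuclideanSpace ℝ (Fin m)) x₀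
  let D : EuclideanSpace ℝ (Fin m) →L[ℝ] TangentSpace (𝓡 m) (e.symm y) :=
    mfderiv (𝓡 m) (𝓡 m) e.symm y
  Matrix.of fun i j ↦
    inner ℝ (D (EuclideanSpace.single i (1 : ℝ))) (D (EuclideanSpace.single j (1 : ℝ)))

/-- The measure `√(det g_ij) dy¹ ⋯ dyᵐ` of the chart around `x₀`, as a measure on `M` concentrated
on the domain of the chart. -/
def chartMeasure [MeasurableSpace M] (x₀ : M) : Measure M :=
  let e := chartAt (EuclideanSpace ℝ (Fin m)) x₀
  Measure.map e.symm
    ((volume.restrict e.target).withDensity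
      fun y ↦ ENNReal.ofReal (Real.sqrt (chartGram m x₀ y).det))

variable (M) in
/-- The Riemannian measure `dvol_g` of `M`: the least measure that dominates all chart measures.
The chart measures agree on overlaps, so on the domain of each chart this is
`√(det g_ij) dy¹ ⋯ dyᵐ`. -/
def riemannianMeasure [MeasurableSpace M] : Measure M := ⨆ x₀ : M, chartMeasure m x₀

end Manifold

/-! ### Measurable sections, smooth sections, test sections -/

section Sections

variable {B : Type*} [TopologicalSpace B] (F : Type*) [NormedAddCommGroup F] [NormedSpace ℝ F]
  {V : B → Type*} [TopologicalSpace (TotalSpace F V)] [∀ x, TopologicalSpace (V x)]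
  [FiberBundle F V]

/-- Measurable sections: in every trivialization the section is a measurable `F`-valued function.
(As usual, up to null sets of the measure `μ`.) -/
def IsMeasurableSection [MeasurableSpace B] (μ : Measure B) (s : ∀ x, V x) : Prop :=
  ∀ (e : Trivialization F (TotalSpace.proj : TotalSpace F V → B)) [MemTrivializationAtlas e],
    AEStronglyMeasurable (fun x ↦ (e ⟨x, s x⟩).2) (μ.restrict e.baseSet)

variable (m : ℕ) [ChartedSpace (EuclideanSpace ℝ (Fin m)) B]

/-- Smooth sections, `C^∞(M, V)`. -/
def IsSmoothSection (s : ∀ x, V x) : Prop :=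
  ContMDiff (𝓡 m) ((𝓡 m).prod 𝓘(ℝ, F)) ∞ (fun x ↦ TotalSpace.mk' F x (s x))

/-- Smooth sections with compact support, `C_c^∞(M, V)`. -/
def IsTestSection [∀ x, Zero (V x)] (s : ∀ x, V x) : Prop :=
  IsSmoothSection F m s ∧ IsCompact (closure {x | s x ≠ 0})

end Sections

/-! ### The metric on `T*M ⊗ V`

Elements of `T*M ⊗ V` are the real linear maps `A : T_x M → V_x`, and the metric induced by `g` and
`h` is `h̃(A, B) = ∑ i, h(A e_i, B e_i)`, for any `g`-orthonormal basis `e_i` of `T_x M`. -/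

section HilbertSchmidt

variable {T : Type*} [NormedAddCommGroup T] [InnerProductSpace ℝ T] [FiniteDimensional ℝ T]
  {W : Type*} [NormedAddCommGroup W] [NormedSpace ℝ W]

/-- `|A|²`, for the metric on `T* ⊗ W`. -/
def homNormSq (A : T →L[ℝ] W) : ℝ := ∑ i, ‖A (stdOrthonormalBasis ℝ T i)‖ ^ 2

/-- `h̃(A, B)`, for the metric on `T* ⊗ W`. -/
def homInner (𝕂 : Type*) [RCLike 𝕂] [InnerProductSpace 𝕂 W] (A B : T →L[ℝ] W) : 𝕂 :=
  ∑ i, inner 𝕂 (A (stdOrthonormalBasis ℝ T i)) (B (stdOrthonormalBasis ℝ T i))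

end HilbertSchmidt

section Operators

variable (𝕂 : Type*) [RCLike 𝕂] (m : ℕ)
  {M : Type*} [TopologicalSpace M] [ChartedSpace (EuclideanSpace ℝ (Fin m)) M]
  [IsManifold (𝓡 m) ∞ M] [RiemannianBundle (fun x : M ↦ TangentSpace (𝓡 m) x)]
  [MeasurableSpace M]
  (F : Type*) [NormedAddCommGroup F] [NormedSpace ℝ F]
  {V : M → Type*} [TopologicalSpace (TotalSpace F V)]
  [∀ x, NormedAddCommGroup (V x)] [∀ x, NormedSpace ℝ (V x)]
  [FiberBundle F V] [VectorBundle ℝ F V]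

/-! ### `L²` sections of `V` and of `T*M ⊗ V` -/

/-- `‖s‖²` in `L²(M, V)`. -/
def normSqL2 (s : ∀ x, V x) : ℝ≥0∞ := ∫⁻ x, ‖s x‖ₑ ^ 2 ∂(riemannianMeasure m M)

/-- `‖A‖²` in `L²(M, T*M ⊗ V)`. -/
def formNormSqL2 (A : ∀ x : M, TangentSpace (𝓡 m) x →L[ℝ] V x) : ℝ≥0∞ :=
  ∫⁻ x, ENNReal.ofReal (homNormSq (A x)) ∂(riemannianMeasure m M)

/-- `s ∈ L²(M, V)`. -/
def IsL2Section (s : ∀ x, V x) : Prop :=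
  IsMeasurableSection F (riemannianMeasure m M) s ∧ normSqL2 m s < ⊤

/-- `A ∈ L²(M, T*M ⊗ V)`. -/
def IsL2Form (A : ∀ x : M, TangentSpace (𝓡 m) x →L[ℝ] V x) : Prop :=
  IsMeasurableSection (EuclideanSpace ℝ (Fin m) →L[ℝ] F) (riemannianMeasure m M) A ∧
    formNormSqL2 m A < ⊤

/-- `φ ∈ C_c^∞(M, T*M ⊗ V)`. -/
def IsTestForm (φ : ∀ x : M, TangentSpace (𝓡 m) x →L[ℝ] V x) : Prop :=
  IsTestSection (EuclideanSpace ℝ (Fin m) →L[ℝ] F) m φ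

/-! ### Minimal and maximal extension of an operator `P` from sections of `V` to `T*M ⊗ V` -/

/-- `s ∈ 𝓓(P_min)` and `P_min s = w`: the pair `(s, w)` is a limit in `L²` of pairs `(u_i, P u_i)`
with `u_i` smooth and compactly supported. -/
def IsMinExtension (P : (∀ x, V x) → ∀ x : M, TangentSpace (𝓡 m) x →L[ℝ] V x)
    (s : ∀ x, V x) (w : ∀ x : M, TangentSpace (𝓡 m) x →L[ℝ] V x) : Prop :=
  IsL2Section m F s ∧ IsL2Form m F w ∧
    ∃ u : ℕ → ∀ x, V x, (∀ i, IsTestSection F m (u i)) ∧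
      Tendsto (fun i ↦ normSqL2 m (fun x ↦ u i x - s x)) atTop (𝓝 0) ∧
      Tendsto (fun i ↦ formNormSqL2 m (fun x ↦ P (u i) x - w x)) atTop (𝓝 0)

variable [∀ x, InnerProductSpace 𝕂 (V x)]

/-- `ψ = Pᵗ φ` for the formal adjoint `Pᵗ` of `P`, where `φ ∈ C_c^∞(M, T*M ⊗ V)`: the section
`ψ ∈ C_c^∞(M, V)` is characterized by `∫ h(u, ψ) = ∫ h̃(P u, φ)` for all `u ∈ C_c^∞(M, V)`. -/
def IsFormalAdjoint (P : (∀ x, V x) → ∀ x : M, TangentSpace (𝓡 m) x →L[ℝ] V x)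
    (φ : ∀ x : M, TangentSpace (𝓡 m) x →L[ℝ] V x) (ψ : ∀ x, V x) : Prop :=
  IsTestForm m F φ ∧ IsTestSection F m ψ ∧
    ∀ u : ∀ x, V x, IsTestSection F m u →
      ∫ x, (inner 𝕂 (u x) (ψ x) : 𝕂) ∂(riemannianMeasure m M) =
        ∫ x, homInner 𝕂 (P u x) (φ x) ∂(riemannianMeasure m M)

/-- `s ∈ 𝓓(P_max)` and `P_max s = v`: the equation `P s = v` holds in the distributional sense,
`∫ h(s, Pᵗ φ) = ∫ h̃(v, φ)` for all `φ ∈ C_c^∞(M, T*M ⊗ V)`. -/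
def IsMaxExtension (P : (∀ x, V x) → ∀ x : M, TangentSpace (𝓡 m) x →L[ℝ] V x)
    (s : ∀ x, V x) (v : ∀ x : M, TangentSpace (𝓡 m) x →L[ℝ] V x) : Prop :=
  IsL2Section m F s ∧ IsL2Form m F v ∧
    ∀ φ ψ, IsFormalAdjoint 𝕂 m F P φ ψ →
      ∫ x, (inner 𝕂 (s x) (ψ x) : 𝕂) ∂(riemannianMeasure m M) =
        ∫ x, homInner 𝕂 (v x) (φ x) ∂(riemannianMeasure m M)

/-! ### Metrics and metric connections -/

/-- The metric `h` (the inner product of the fibers, Riemannian for `𝕂 = ℝ` and Hermitian for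
`𝕂 = ℂ`) is smooth: its coefficients in every trivialization are smooth functions. -/
def IsSmoothMetric : Prop :=
  ∀ (e : Trivialization F (TotalSpace.proj : TotalSpace F V → M)) [MemTrivializationAtlas e]
    (a b : F),
    ContMDiffOn (𝓡 m) 𝓘(ℝ, 𝕂) ∞ (fun x ↦ (inner 𝕂 (e.symm x a : V x) (e.symm x b) : 𝕂)) e.baseSet

/-- `∇` is a (smooth, `𝕂`-linear) metric connection: `d(h(s, t)) = h(∇s, t) + h(s, ∇t)` for all
smooth sections `s`, `t`. Additivity and the Leibniz rule are part of `CovariantDerivative`. -/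
structure IsMetricConnection (cov : CovariantDerivative (𝓡 m) F V) : Prop where
  smooth : CovariantDerivative.ContMDiffCovariantDerivative cov ∞
  smul (c : 𝕂) (s : ∀ x, V x) (hs : IsSmoothSection F m s) (x : M) (X : TangentSpace (𝓡 m) x) :
    cov (fun y ↦ c • s y) x X = c • cov s x X
  metric (s t : ∀ x, V x) (hs : IsSmoothSection F m s) (ht : IsSmoothSection F m t) (x : M)
    (X : TangentSpace (𝓡 m) x) :
    mvfderiv (𝓡 m) (fun y ↦ (inner 𝕂 (s y) (t y) : 𝕂)) x X =
      inner 𝕂 (cov s x X) (t x) + inner 𝕂 (s x) (cov t x X)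

/-! ### Sobolev spaces

Both spaces are given as sets of measurable sections; both are invariant under modification of a
section on a null set. -/

/-- `W^{1,2}(M, V) = 𝓓(∇_max)`. -/
def W12 (cov : CovariantDerivative (𝓡 m) F V) : Set (∀ x, V x) :=
  {s | ∃ v, IsMaxExtension 𝕂 m F cov s v}

end Operators

section Min

variable (m : ℕ)
  {M : Type*} [TopologicalSpace M] [ChartedSpace (EuclideanSpace ℝ (Fin m)) M]
  [IsManifold (𝓡 m) ∞ M] [RiemannianBundle (fun x : M ↦ TangentSpace (𝓡 m) x)]
  [MeasurableSpace M]

/-- `W_0^{1,2}(M, V) = 𝓓(∇_min)`. -/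
def W12Zero (F : Type*) [NormedAddCommGroup F] [NormedSpace ℝ F]
    {V : M → Type*} [TopologicalSpace (TotalSpace F V)]
    [∀ x, NormedAddCommGroup (V x)] [∀ x, NormedSpace ℝ (V x)]
    [FiberBundle F V] [VectorBundle ℝ F V]
    (cov : CovariantDerivative (𝓡 m) F V) : Set (∀ x, V x) :=
  {s | ∃ w, IsMinExtension m F cov s w}

/-- `f ∈ 𝓓(d_{0,min})` and `d_{0,min} f = η`, for the exterior derivative `d_0` on functions, which
are the sections of the trivial bundle `M × ℝ`. -/
def IsMinExteriorDerivative (f : M → ℝ) (η : ∀ x : M, TangentSpace (𝓡 m) x →L[ℝ] ℝ) : Prop :=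
  IsMinExtension m ℝ (V := Bundle.Trivial M ℝ) (fun u x ↦ mvfderiv (𝓡 m) (fun y ↦ (u y : ℝ)) x) f η

end Min

end MetricSobolev

end

open MetricSobolev

/-! The inclusion `W12Zero ⊆ W12` needs no cut-offs: the identity `∫ h(u, ψ) = ∫ h̃(∇u, φ)` defining
the formal adjoint passes to `L²` limits in `u` (`IsApproximable.hasWeakCovariantDerivative`).

For the converse let `∇s = v` weakly. Cutting off by functions `θ_j` produces the term `dθ_j ⊗ s`,
which is out of control since `dθ_j` is small only in `L²` and `s` is merely in `L²`. It would tend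
to zero if `s` were bounded, so sections are truncated smoothly. For a smooth `u` put `f = (1 +
λ|u|²)⁻¹`. Then `|f u|² ≤ 1/(4λ)`, hence `|dθ ⊗ f u|² ≤ |dθ|²/(4λ)`. Since `∇` is metric, `df = -2λ
f² ⟨∇u, u⟩`, so the other new term is bounded by `2 (λ|u|² f²) |∇u|`, where `λ|u|² f² ≤ 1/4`. If
`λ_j → 0` so slowly that `‖dθ_j‖²/λ_j → 0`, the test sections `θ_j u_j / (1 + λ_j|u_j|²)` converge
to `s` and their covariant derivatives to `v`, by dominated convergence
(`homNormSq_cov_truncation_sub_le`, `HasWeakCovariantDerivative.isApproximable`).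

Here `u_j` has to approximate `(s, v)` only on the compact support of `θ_j`. This is a local theorem
of Meyers–Serrin type: in an orthonormal frame over a chart the components of `ρ s` have weak
partial derivatives in `L²` (`IsAdaptedFrame.integral_toChart_mul_fderiv`), their mollifications
converge (`exists_seq_mollification`), and a partition of unity glues the pieces. The `θ_j` are
smoothings of the given cut-offs (`exists_smooth_cutoffs`).

All of this is done for real inner products. The Hermitian case reduces to the real part of `h`,
because multiplication by `I` commutes with `∇` (`hasWeakCovariantDerivative_iff_isMaxExtension`).
-/

open MetricSobolev

/-! ### Smoothness of sections of homomorphism bundles. -/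

section HomCriterion

variable {EB : Type*} [NormedAddCommGroup EB] [NormedSpace ℝ EB]
  {HB : Type*} [TopologicalSpace HB] {I : ModelWithCorners ℝ EB HB} {n : ℕ∞ω}
  {B : Type*} [TopologicalSpace B] [ChartedSpace HB B]
  {F₁ : Type*} [NormedAddCommGroup F₁] [NormedSpace ℝ F₁]
  {E₁ : B → Type*} [TopologicalSpace (TotalSpace F₁ E₁)] [∀ x, AddCommGroup (E₁ x)]
  [∀ x, Module ℝ (E₁ x)] [∀ x, TopologicalSpace (E₁ x)]
  [FiberBundle F₁ E₁] [VectorBundle ℝ F₁ E₁]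
  {F₂ : Type*} [NormedAddCommGroup F₂] [NormedSpace ℝ F₂]
  {E₂ : B → Type*} [TopologicalSpace (TotalSpace F₂ E₂)] [∀ x, AddCommGroup (E₂ x)]
  [∀ x, Module ℝ (E₂ x)] [∀ x, TopologicalSpace (E₂ x)]
  [∀ x, IsTopologicalAddGroup (E₂ x)] [∀ x, ContinuousSMul ℝ (E₂ x)]
  [FiberBundle F₂ E₂] [VectorBundle ℝ F₂ E₂]

/-- A section of a bundle of homomorphisms is smooth if it maps the sections that are constant in
a trivialization to smooth sections. -/
theorem contMDiffAt_hom_of_apply_symm [FiniteDimensional ℝ F₁] (φ : ∀ x, E₁ x →L[ℝ] E₂ x) (x₀ : B)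
    (h : ∀ v : F₁, ContMDiffAt I (I.prod 𝓘(ℝ, F₂)) n
      (fun x ↦ TotalSpace.mk' F₂ x (φ x ((trivializationAt F₁ E₁ x₀).symm x v))) x₀) :
    ContMDiffAt I (I.prod 𝓘(ℝ, F₁ →L[ℝ] F₂)) n
      (fun x ↦ TotalSpace.mk' (F₁ →L[ℝ] F₂) (E := fun x ↦ E₁ x →L[ℝ] E₂ x) x (φ x)) x₀ := by
  rw [contMDiffAt_hom_bundle]
  refine ⟨contMDiffAt_id, ?_⟩
  let b := Module.finBasis ℝ F₁
  -- In finite dimension an operator is `∑ i, bᵢ* ⊗ A bᵢ`, so an operator-valued map is smooth once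
  -- its values on finitely many basis vectors are.
  have key : ∀ A : F₁ →L[ℝ] F₂,
      A = ∑ i, (LinearMap.toContinuousLinearMap (b.coord i)).smulRight (A (b i)) := by
    intro A
    ext v
    conv_lhs => rw [← b.sum_repr v, map_sum]
    simp
  have h2 : ContMDiffAt I 𝓘(ℝ, F₁ →L[ℝ] F₂) n (fun x ↦
      ∑ i, (LinearMap.toContinuousLinearMap (b.coord i)).smulRight
        (ContinuousLinearMap.inCoordinates F₁ E₁ F₂ E₂ x₀ x x₀ x (φ x) (b i))) x₀ := by
    apply ContMDiffAt.sum
    intro i _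
    have h3 : ContMDiffAt I 𝓘(ℝ, F₂) n (fun x ↦
        ContinuousLinearMap.inCoordinates F₁ E₁ F₂ E₂ x₀ x x₀ x (φ x) (b i)) x₀ := by
      have h4 := (contMDiffAt_totalSpace.1 (h (b i))).2
      refine h4.congr_of_eventuallyEq ?_
      filter_upwards [(trivializationAt F₁ E₁ x₀).open_baseSet.mem_nhds
        (mem_baseSet_trivializationAt F₁ E₁ x₀), (trivializationAt F₂ E₂ x₀).open_baseSet.mem_nhds
        (mem_baseSet_trivializationAt F₂ E₂ x₀)] with x hx1 hx2
      rw [ContinuousLinearMap.inCoordinates_eq hx1 hx2]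
      simp
    exact ((ContinuousLinearMap.smulRightL ℝ F₁ F₂
      (LinearMap.toContinuousLinearMap (b.coord i))).contMDiff.contMDiffAt).comp x₀ h3
  exact h2.congr_of_eventuallyEq (Eventually.of_forall fun x ↦ key _)

theorem contMDiffAt_trivializationAt_symm [ContMDiffVectorBundle n F₁ E₁ I] (x₀ : B) (v : F₁) :
    ContMDiffAt I (I.prod 𝓘(ℝ, F₁)) n
      (fun x ↦ TotalSpace.mk' F₁ x ((trivializationAt F₁ E₁ x₀).symm x v)) x₀ := by
  have hx := mem_baseSet_trivializationAt F₁ E₁ x₀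
  rw [Bundle.contMDiffAt_section]
  refine (contMDiffAt_const (c := v)).congr_of_eventuallyEq ?_
  filter_upwards [(trivializationAt F₁ E₁ x₀).open_baseSet.mem_nhds hx] with y hy
  simp [hy]

end HomCriterion

/-! ### Smooth Gram–Schmidt and local orthonormal frames of test sections. -/

section GramSchmidt

variable {EB : Type*} [NormedAddCommGroup EB] [NormedSpace ℝ EB]
  {HB : Type*} [TopologicalSpace HB] {I : ModelWithCorners ℝ EB HB}
  {B : Type*} [TopologicalSpace B] [ChartedSpace HB B]
  {F : Type*} [NormedAddCommGroup F] [NormedSpace ℝ F]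
  {E : B → Type*} [TopologicalSpace (TotalSpace F E)] [∀ x, NormedAddCommGroup (E x)]
  [∀ x, InnerProductSpace ℝ (E x)]
  [FiberBundle F E] [VectorBundle ℝ F E]
  [IsContMDiffRiemannianBundle I ∞ F E]

/-- By induction along the recursion: each coefficient is a quotient of smooth inner products.
Independence at `x₀` alone suffices, since the denominators need only be nonzero there. -/
theorem contMDiffAt_gramSchmidt {k : ℕ} {s : Fin k → ∀ x, E x} {x₀ : B}
    (hs : ∀ i, ContMDiffAt I (I.prod 𝓘(ℝ, F)) ∞ (fun x ↦ TotalSpace.mk' F x (s i x)) x₀)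
    (hlin : LinearIndependent ℝ (fun i ↦ s i x₀)) (i : Fin k) :
    ContMDiffAt I (I.prod 𝓘(ℝ, F)) ∞
      (fun x ↦ TotalSpace.mk' F x (InnerProductSpace.gramSchmidt ℝ (fun j ↦ s j x) i)) x₀ := by
  induction i using WellFoundedLT.induction with
  | ind i ih =>
    have h1 : ∀ x, InnerProductSpace.gramSchmidt ℝ (fun j ↦ s j x) i = s i x -
        ∑ j ∈ Finset.Iio i, (inner ℝ (InnerProductSpace.gramSchmidt ℝ (fun j ↦ s j x) j) (s i x) /
          inner ℝ (InnerProductSpace.gramSchmidt ℝ (fun j ↦ s j x) j)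
            (InnerProductSpace.gramSchmidt ℝ (fun j ↦ s j x) j)) •
          InnerProductSpace.gramSchmidt ℝ (fun j ↦ s j x) j := by
      intro x
      rw [InnerProductSpace.gramSchmidt_def]
      congr 1
      refine Finset.sum_congr rfl fun j _ ↦ ?_
      rw [Submodule.starProjection_singleton]
      simp
    simp_rw [h1]
    refine ContMDiffAt.sub_section (hs i) (ContMDiffAt.sum_section fun j hj ↦ ?_)
    have hj' := ih j (Finset.mem_Iio.1 hj)
    refine ContMDiffAt.smul_section ?_ hj'
    refine ContMDiffAt.div₀ (hj'.inner_bundle (hs i)) (hj'.inner_bundle hj') ?_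
    rw [real_inner_self_eq_norm_sq]
    have := InnerProductSpace.gramSchmidt_ne_zero (𝕜 := ℝ) j hlin
    positivity

theorem contMDiffAt_gramSchmidtNormed {k : ℕ} {s : Fin k → ∀ x, E x} {x₀ : B}
    (hs : ∀ i, ContMDiffAt I (I.prod 𝓘(ℝ, F)) ∞ (fun x ↦ TotalSpace.mk' F x (s i x)) x₀)
    (hlin : LinearIndependent ℝ (fun i ↦ s i x₀)) (i : Fin k) :
    ContMDiffAt I (I.prod 𝓘(ℝ, F)) ∞
      (fun x ↦ TotalSpace.mk' F x (InnerProductSpace.gramSchmidtNormed ℝ (fun j ↦ s j x) i)) x₀ := by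
  have h := contMDiffAt_gramSchmidt hs hlin i
  have hne := InnerProductSpace.gramSchmidt_ne_zero (𝕜 := ℝ) i hlin
  -- The norm is written as the root of an inner product, because the square root is smooth away
  -- from zero and inner products of smooth sections are smooth.
  have h1 : ∀ x, InnerProductSpace.gramSchmidtNormed ℝ (fun j ↦ s j x) i =
      (√(inner ℝ (InnerProductSpace.gramSchmidt ℝ (fun j ↦ s j x) i)
        (InnerProductSpace.gramSchmidt ℝ (fun j ↦ s j x) i)))⁻¹ •
      InnerProductSpace.gramSchmidt ℝ (fun j ↦ s j x) i := by
    intro x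
    rw [real_inner_self_eq_norm_sq, Real.sqrt_sq (norm_nonneg _)]
    rfl
  simp_rw [h1]
  refine ContMDiffAt.smul_section ?_ h
  have h2 := h.inner_bundle h
  have hpos : inner ℝ (InnerProductSpace.gramSchmidt ℝ (fun j ↦ s j x₀) i)
        (InnerProductSpace.gramSchmidt ℝ (fun j ↦ s j x₀) i) ≠ 0 := by
    rw [real_inner_self_eq_norm_sq]; positivity
  have h3 := (Real.contDiffAt_sqrt (n := ∞) hpos).contMDiffAt.comp x₀ h2
  refine ContMDiffAt.inv₀ h3 ?_
  rw [real_inner_self_eq_norm_sq, Real.sqrt_sq (norm_nonneg _)]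
  simpa using hne

end GramSchmidt

section Frames

variable {m : ℕ} {M : Type*} [TopologicalSpace M] [T2Space M]
  [ChartedSpace (EuclideanSpace ℝ (Fin m)) M] [IsManifold (𝓡 m) ∞ M]
  {F : Type*} [NormedAddCommGroup F] [NormedSpace ℝ F]
  {V : M → Type*} [TopologicalSpace (TotalSpace F V)]
  [∀ x, NormedAddCommGroup (V x)] [∀ x, NormedSpace ℝ (V x)]
  [FiberBundle F V] [VectorBundle ℝ F V]

/-- A section that is smooth near a point agrees near that point with a test section. -/
theorem exists_isTestSection_eventuallyEq {s : ∀ x, V x} {W : Set M} (hW : IsOpen W) {x₀ : M}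
    (hx₀ : x₀ ∈ W)
    (hs : ContMDiffOn (𝓡 m) ((𝓡 m).prod 𝓘(ℝ, F)) ∞ (fun x ↦ TotalSpace.mk' F x (s x)) W) :
    ∃ s' : ∀ x, V x, IsTestSection F m s' ∧ ∀ᶠ x in 𝓝 x₀, s' x = s x := by
  obtain ⟨f, -, hf⟩ := (SmoothBumpFunction.nhds_basis_tsupport (I := 𝓡 m) x₀).mem_iff.1
    (hW.mem_nhds hx₀)
  refine ⟨fun x ↦ f x • s x, ⟨?_, ?_⟩, ?_⟩
  · exact ContMDiffOn.smul_section_of_tsupport f.contMDiff.contMDiffOn hW hf hs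
  · refine f.hasCompactSupport.isCompact.of_isClosed_subset isClosed_closure (closure_mono ?_)
    intro x hx h
    exact hx (by simp [h])
  · filter_upwards [f.eventuallyEq_one] with x hx
    simp [hx]

end Frames

section OrthonormalFrames

variable {m : ℕ} {M : Type*} [TopologicalSpace M] [T2Space M]
  [ChartedSpace (EuclideanSpace ℝ (Fin m)) M] [IsManifold (𝓡 m) ∞ M]
  {F : Type*} [NormedAddCommGroup F] [NormedSpace ℝ F] [FiniteDimensional ℝ F]
  {V : M → Type*} [TopologicalSpace (TotalSpace F V)]
  [∀ x, NormedAddCommGroup (V x)] [∀ x, InnerProductSpace ℝ (V x)]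
  [FiberBundle F V] [VectorBundle ℝ F V] [ContMDiffVectorBundle ∞ F V (𝓡 m)]
  [IsContMDiffRiemannianBundle (𝓡 m) ∞ F V]

/-- Near every point there is an orthonormal frame of test sections. -/
theorem exists_orthonormal_frame (x₀ : M) :
    ∃ E : Fin (Module.finrank ℝ F) → ∀ x, V x, (∀ a, IsTestSection F m (E a)) ∧
      ∀ᶠ x in 𝓝 x₀, ∃ b : OrthonormalBasis (Fin (Module.finrank ℝ F)) ℝ (V x), ∀ a, b a = E a x := by
  set e := trivializationAt F V x₀
  have hx₀ : x₀ ∈ e.baseSet := mem_baseSet_trivializationAt F V x₀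
  let b := Module.finBasis ℝ F
  have hfr := e.isLocalFrameOn_localFrame_baseSet (𝓡 m) ∞ b
  have h1 : ∀ a, ∃ s' : ∀ x, V x, IsTestSection F m s' ∧ ∀ᶠ x in 𝓝 x₀, s' x =
      InnerProductSpace.gramSchmidtNormed ℝ (fun j ↦ e.localFrame b j x) a := by
    intro a
    refine exists_isTestSection_eventuallyEq e.open_baseSet hx₀ fun x hx ↦ ?_
    exact (contMDiffAt_gramSchmidtNormed (fun i ↦ hfr.contMDiffAt e.open_baseSet hx i)
      (hfr.linearIndependent hx) a).contMDiffWithinAt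
  choose E hE hE' using h1
  refine ⟨E, hE, ?_⟩
  filter_upwards [eventually_all.2 hE', e.open_baseSet.mem_nhds hx₀] with x hx hxe
  have hli := hfr.linearIndependent hxe
  let bx := e.basisAt b hxe
  have : FiniteDimensional ℝ (V x) := bx.finiteDimensional_of_finite
  have hon : Orthonormal ℝ (fun a ↦ E a x) := by
    have := InnerProductSpace.gramSchmidtNormed_orthonormal (𝕜 := ℝ) hli
    convert this using 1
    funext a
    exact hx a
  have hcard : Fintype.card (Fin (Module.finrank ℝ F)) = Module.finrank ℝ (V x) :=
    (Module.finrank_eq_card_basis bx).symm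
  refine ⟨OrthonormalBasis.mk hon ?_, fun a ↦ by rw [OrthonormalBasis.coe_mk]⟩
  exact (hon.linearIndependent.span_eq_top_of_card_eq_finrank' hcard).ge

end OrthonormalFrames

/-! ### Mollification in `L²` of a Euclidean space. -/

section Mollifier

variable {G : Type*} [NormedAddCommGroup G] [InnerProductSpace ℝ G] [FiniteDimensional ℝ G]
  [MeasurableSpace G] [BorelSpace G]

/-- Continuity of translations in `L²`. Composition with measure-preserving maps is continuous in
the map for the compact-open topology, and currying shows that translations depend continuously on
the vector in that topology. -/
theorem tendsto_eLpNorm_sub_translate {f : G → ℝ} (hf : MemLp f 2 volume) :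
    Tendsto (fun t ↦ eLpNorm (fun x ↦ f (x - t) - f x) 2 volume) (𝓝 0) (𝓝 0) := by
  have : Fact ((1 : ℝ≥0∞) ≤ 2) := ⟨by norm_num⟩
  let g : G → C(G, G) := (ContinuousMap.mk (fun a : G × G ↦ a.2 - a.1) (by fun_prop)).curry
  have hg : Continuous g := ContinuousMap.continuous _
  have hgm : ∀ t, MeasurePreserving (g t) volume volume := fun t ↦ measurePreserving_sub_right _ t
  have h1 : Tendsto (fun t ↦ Lp.compMeasurePreserving (g t) (hgm t) (hf.toLp f)) (𝓝 0)
      (𝓝 (Lp.compMeasurePreserving (g 0) (hgm 0) (hf.toLp f))) :=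
    Tendsto.compMeasurePreservingLp tendsto_const_nhds (hg.tendsto 0) hgm (hgm 0) (by norm_num)
  have h2 : Lp.compMeasurePreserving (g 0) (hgm 0) (hf.toLp f) = hf.toLp f := by
    rw [Lp.toLp_compMeasurePreserving]
    congr 1
    funext x
    simp [g]
  rw [h2] at h1
  have h3 := (Lp.tendsto_Lp_iff_tendsto_eLpNorm' _ _).1 h1
  refine h3.congr fun t ↦ eLpNorm_congr_ae ?_
  rw [Lp.toLp_compMeasurePreserving]
  filter_upwards [MemLp.coeFn_toLp hf, MemLp.coeFn_toLp (hf.comp_measurePreserving (hgm t))]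
    with x hx hx'
  simp only [Pi.sub_apply, hx, hx']
  rfl

-- The normalized bump is the density of a probability measure `P`, and `(ψ ⋆ f - f)(x)` is the
-- `P`-mean of `f(x - t) - f(x)`. Its square is at most the mean of the squares, and Tonelli reduces
-- the claim to the translates by `t` in the support of `ψ`.
open scoped Convolution in
theorem eLpNorm_convolution_sub_le {f : G → ℝ} (hf : MemLp f 2 volume) (φ : ContDiffBump (0 : G))
    {ε : ℝ≥0∞} (hε : ∀ t ∈ Metric.ball (0 : G) φ.rOut,
      eLpNorm (fun x ↦ f (x - t) - f x) 2 volume ≤ ε) :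
    eLpNorm (fun x ↦ (φ.normed volume ⋆[ContinuousLinearMap.lsmul ℝ ℝ] f) x - f x) 2 volume
      ≤ ε := by
  set ψ := φ.normed (volume : Measure G) with hψ
  have hψm : Measurable ψ := φ.continuous_normed.measurable
  have hψ1 : ∫⁻ t, ENNReal.ofReal (ψ t) = 1 := by
    rw [← ofReal_integral_eq_lintegral_ofReal φ.integrable_normed
      (Eventually.of_forall φ.nonneg_normed), φ.integral_normed, ENNReal.ofReal_one]
  set P : Measure G := volume.withDensity (fun t ↦ ENNReal.ofReal (ψ t)) with hP
  have hPp : IsProbabilityMeasure P := ⟨by simp [hP, hψ1]⟩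
  have hPac : P ≪ volume := withDensity_absolutelyContinuous _ _
  have hfl : LocallyIntegrable f volume := hf.locallyIntegrable (by norm_num)
  have hsq : ∀ g : G → ℝ, ∀ ν : Measure G,
      eLpNorm g 2 ν ^ 2 = ∫⁻ x, ‖g x‖ₑ ^ 2 ∂ν := by
    intro g ν
    have := eLpNorm_nnreal_pow_eq_lintegral (f := g) (μ := ν) (p := 2) (by norm_num)
    simpa using this
  have hpt : ∀ x, ‖(ψ ⋆[ContinuousLinearMap.lsmul ℝ ℝ] f) x - f x‖ₑ ^ 2 ≤
      ∫⁻ t, ENNReal.ofReal (ψ t) * ‖f (x - t) - f x‖ₑ ^ 2 := by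
    intro x
    have hm : AEStronglyMeasurable (fun t ↦ f (x - t)) volume :=
      hf.1.comp_measurePreserving (Measure.measurePreserving_sub_left volume x)
    have hm1 : AEMeasurable (fun t ↦ ‖f (x - t) - f x‖ₑ) volume :=
      (hm.sub aestronglyMeasurable_const).enorm
    have hm2 : AEStronglyMeasurable (fun t ↦ f (x - t) - f x) P :=
      (hm.sub aestronglyMeasurable_const).mono_ac hPac
    have hci : Integrable (fun t ↦ ψ t * f (x - t)) volume := by
      have := (φ.hasCompactSupport_normed (μ := volume)).convolutionExists_left
        (ContinuousLinearMap.lsmul ℝ ℝ) φ.continuous_normed hfl x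
      simpa [ConvolutionExistsAt] using this
    have h1 : (ψ ⋆[ContinuousLinearMap.lsmul ℝ ℝ] f) x - f x =
        ∫ t, ψ t * (f (x - t) - f x) := by
      simp_rw [mul_sub]
      rw [integral_sub hci (φ.integrable_normed.mul_const _), integral_mul_const,
        φ.integral_normed, one_mul]
      rfl
    have h2 : ‖(ψ ⋆[ContinuousLinearMap.lsmul ℝ ℝ] f) x - f x‖ₑ ≤
        eLpNorm (fun t ↦ f (x - t) - f x) 1 P := by
      rw [h1, eLpNorm_one_eq_lintegral_enorm, hP, lintegral_withDensity_eq_lintegral_mul₀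
        (by fun_prop) hm1]
      refine (enorm_integral_le_lintegral_enorm _).trans (lintegral_mono fun t ↦ ?_)
      simp only [Pi.mul_apply, enorm_mul]
      rw [Real.enorm_of_nonneg (φ.nonneg_normed t)]
    have h3 := h2.trans (eLpNorm_le_eLpNorm_of_exponent_le (p := 1) (q := 2) (by norm_num) hm2)
    calc _ ≤ (eLpNorm (fun t ↦ f (x - t) - f x) 2 P) ^ 2 := by gcongr
      _ = _ := by
        rw [hsq, hP, lintegral_withDensity_eq_lintegral_mul₀ (by fun_prop)
          (hm1.pow_const 2)]
        rfl
  have hmeas : AEMeasurable (Function.uncurry fun x t ↦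
      ENNReal.ofReal (ψ t) * ‖f (x - t) - f x‖ₑ ^ 2) (volume.prod volume) := by
    have h1 : AEStronglyMeasurable (fun p : G × G ↦ f (p.1 - p.2)) (volume.prod volume) :=
      hf.1.comp_quasiMeasurePreserving (quasiMeasurePreserving_sub_of_right_invariant volume volume)
    have h2 : AEStronglyMeasurable (fun p : G × G ↦ f p.1) (volume.prod volume) := hf.1.comp_fst
    exact ((hψm.comp measurable_snd).ennreal_ofReal.aemeasurable).mul
      ((h1.sub h2).enorm.pow_const 2)
  have hmain : eLpNorm (fun x ↦ (ψ ⋆[ContinuousLinearMap.lsmul ℝ ℝ] f) x - f x) 2 volume ^ 2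
      ≤ ε ^ 2 := by
    rw [hsq]
    calc _ ≤ ∫⁻ x, ∫⁻ t, ENNReal.ofReal (ψ t) * ‖f (x - t) - f x‖ₑ ^ 2 := lintegral_mono hpt
      _ = ∫⁻ t, ∫⁻ x, ENNReal.ofReal (ψ t) * ‖f (x - t) - f x‖ₑ ^ 2 :=
        lintegral_lintegral_swap hmeas
      _ ≤ ∫⁻ t, ENNReal.ofReal (ψ t) * ε ^ 2 := by
        refine lintegral_mono fun t ↦ ?_
        rw [lintegral_const_mul' _ _ ENNReal.ofReal_ne_top]
        by_cases ht : t ∈ Metric.ball (0 : G) φ.rOut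
        · have := hε t ht
          rw [← hsq]
          gcongr
        · have : ψ t = 0 := by
            rw [← Function.notMem_support, hψ, φ.support_normed_eq]
            exact ht
          simp [this]
      _ = ε ^ 2 := by
        rw [lintegral_mul_const _ (by fun_prop), hψ1, one_mul]
  exact (ENNReal.pow_right_strictMono two_ne_zero).le_iff_le.1 hmain


open scoped Convolution in
/-- Functions with weak derivatives in `L²` are approximated by their mollifications. -/
theorem exists_seq_mollification {ι : Type*} {f : G → ℝ} {g : ι → G → ℝ} (v : ι → G) {K O : Set G}
    (hf : MemLp f 2 volume) (hg : ∀ i, MemLp (g i) 2 volume) (hK : IsCompact K) (hO : IsOpen O)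
    (hKO : K ⊆ O) (hfK : Function.support f ⊆ K)
    (hw : ∀ i (κ : G → ℝ), ContDiff ℝ ∞ κ → HasCompactSupport κ →
      ∫ x, f x * fderiv ℝ κ x (v i) = - ∫ x, g i x * κ x) :
    ∃ μ : ℕ → G → ℝ, (∀ n, ContDiff ℝ ∞ (μ n)) ∧ (∀ n, HasCompactSupport (μ n)) ∧
      (∀ n, tsupport (μ n) ⊆ O) ∧
      Tendsto (fun n ↦ eLpNorm (fun x ↦ μ n x - f x) 2 volume) atTop (𝓝 0) ∧
      ∀ i, Tendsto (fun n ↦ eLpNorm (fun x ↦ fderiv ℝ (μ n) x (v i) - g i x) 2 volume)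
        atTop (𝓝 0) := by
  obtain ⟨r, hr, hrO⟩ := hK.exists_cthickening_subset_open hO hKO
  -- Outer radii at most `r` keep the mollifications supported in the `r`-thickening of `K`, which
  -- lies in `O`.
  let φ : ℕ → ContDiffBump (0 : G) := fun n ↦
    { rIn := r / (2 * (n + 1))
      rOut := r / (n + 1)
      rIn_pos := by positivity
      rIn_lt_rOut := by
        apply div_lt_div_of_pos_left hr (by positivity)
        have : (0 : ℝ) < n + 1 := by positivity
        linarith }
  have hrOut : ∀ n, (φ n).rOut = r / (n + 1) := fun n ↦ rfl
  have hrOut_le : ∀ n, (φ n).rOut ≤ r := by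
    intro n
    rw [hrOut]
    apply div_le_self hr.le
    have : (0 : ℝ) ≤ n := by positivity
    linarith
  have hrOut_lim : Tendsto (fun n ↦ (φ n).rOut) atTop (𝓝 0) := by
    simp_rw [hrOut]
    have := (tendsto_one_div_add_atTop_nhds_zero_nat (𝕜 := ℝ)).const_mul r
    simpa [div_eq_mul_inv] using this
  have hlim : ∀ q : G → ℝ, MemLp q 2 volume → Tendsto (fun n ↦ eLpNorm (fun x ↦
      ((φ n).normed volume ⋆[ContinuousLinearMap.lsmul ℝ ℝ] q) x - q x) 2 volume)
      atTop (𝓝 0) := by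
    intro q hq
    rw [ENNReal.tendsto_nhds_zero]
    intro ε hε
    have h1 := ENNReal.tendsto_nhds_zero.1 (tendsto_eLpNorm_sub_translate hq) ε hε
    obtain ⟨δ, hδ, hδ'⟩ := Metric.eventually_nhds_iff_ball.1 h1
    filter_upwards [hrOut_lim.eventually (gt_mem_nhds hδ)] with n hn
    exact eLpNorm_convolution_sub_le hq (φ n) fun t ht ↦
      hδ' t (Metric.ball_subset_ball hn.le ht)
  have hfl : LocallyIntegrable f volume := hf.locallyIntegrable (by norm_num)
  have hsupp : ∀ n, Function.support ((φ n).normed volume ⋆[ContinuousLinearMap.lsmul ℝ ℝ] f) ⊆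
      Metric.cthickening r K := by
    intro n
    refine (support_convolution_subset _).trans ?_
    rintro x ⟨a, ha, b, hb, rfl⟩
    rw [(φ n).support_normed_eq] at ha
    refine Metric.mem_cthickening_of_dist_le _ b _ _ (hfK hb) ?_
    simp only [dist_eq_norm, add_sub_cancel_right]
    exact (mem_ball_zero_iff.1 ha).le.trans (hrOut_le n)
  have htsupp : ∀ n, tsupport ((φ n).normed volume ⋆[ContinuousLinearMap.lsmul ℝ ℝ] f) ⊆
      Metric.cthickening r K := fun n ↦
    closure_minimal (hsupp n) Metric.isClosed_cthickening
  refine ⟨fun n ↦ (φ n).normed volume ⋆[ContinuousLinearMap.lsmul ℝ ℝ] f, fun n ↦ ?_, fun n ↦ ?_,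
    fun n ↦ (htsupp n).trans hrO, hlim f hf, fun i ↦ ?_⟩
  · exact (φ n).hasCompactSupport_normed.contDiff_convolution_left _ (φ n).contDiff_normed hfl
  · exact (hK.cthickening).of_isClosed_subset (isClosed_tsupport _) (htsupp n)
  · refine (hlim (g i) (hg i)).congr fun n ↦ ?_
    congr 1
    funext x
    congr 1
    have hd : ContDiff ℝ ∞ ((φ n).normed (volume : Measure G)) := (φ n).contDiff_normed
    have hex : ConvolutionExistsAt (fderiv ℝ ((φ n).normed (volume : Measure G))) f x
        ((ContinuousLinearMap.lsmul ℝ ℝ).precompL G) volume :=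
      ((φ n).hasCompactSupport_normed.fderiv ℝ).convolutionExists_left _
        (hd.continuous_fderiv (by simp)) hfl x
    rw [((φ n).hasCompactSupport_normed.hasFDerivAt_convolution_left
      (ContinuousLinearMap.lsmul ℝ ℝ) (hd.of_le (by simp)) hfl x).fderiv]
    rw [convolution_eq_swap, convolution_eq_swap, ContinuousLinearMap.integral_apply]
    -- The weak equation is tested with the reflected kernel centred at `x`. The reflection
    -- contributes a sign that cancels the one of the integration by parts, so the derivative of the
    -- mollification of `f` is the mollification of `g i`.
    · have h1 := hw i (fun y ↦ (φ n).normed volume (x - y))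
        (hd.comp (contDiff_const.sub contDiff_id)) ?_
      · have h2 : ∀ y, fderiv ℝ (fun y ↦ (φ n).normed volume (x - y)) y (v i) =
            - fderiv ℝ ((φ n).normed volume) (x - y) (v i) := by
          intro y
          have h3 : HasFDerivAt (fun z : G ↦ x - z) (-(ContinuousLinearMap.id ℝ G)) y :=
            (hasFDerivAt_id y).const_sub x
          have h4 := HasFDerivAt.comp y ((hd.differentiable (by simp)) (x - y)).hasFDerivAt h3
          change fderiv ℝ ((φ n).normed volume ∘ fun z ↦ x - z) y (v i) = _
          rw [h4.fderiv]
          simp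
        simp_rw [h2, mul_neg, integral_neg, neg_inj] at h1
        simp only [ContinuousLinearMap.precompL_apply, ContinuousLinearMap.lsmul_apply, smul_eq_mul]
        simp_rw [mul_comm _ (f _), mul_comm _ (g i _)]
        exact h1.symm
      · have := ((φ n).hasCompactSupport_normed (μ := (volume : Measure G))).comp_homeomorph
          (Homeomorph.subLeft x)
        exact this
    · exact hex.integrable_swap

end Mollifier

/-! ### Coordinate vector fields, and the Riemannian measure in a chart. -/

theorem det_of_inner_pos {n : ℕ} {E : Type*} [NormedAddCommGroup E] [InnerProductSpace ℝ E]
    {v : Fin n → E} (hv : LinearIndependent ℝ v) :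
    0 < Matrix.det (Matrix.of fun i j ↦ inner ℝ (v i) (v j)) :=
  (Matrix.posDef_gram_of_linearIndependent (𝕜 := ℝ) hv).det_pos

noncomputable section CoordinateFields

variable {m : ℕ} {M : Type*} [TopologicalSpace M]
  [ChartedSpace (EuclideanSpace ℝ (Fin m)) M] [IsManifold (𝓡 m) ∞ M]

/-- The vector field with constant components `v` in the chart around `x₀`. -/
def coordVec (x₀ : M) (v : EuclideanSpace ℝ (Fin m)) (x : M) : TangentSpace (𝓡 m) x :=
  (trivializationAt (EuclideanSpace ℝ (Fin m)) (TangentSpace (𝓡 m)) x₀).symmL ℝ x v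

theorem coordVec_eq_tangentCoordChange {x₀ x : M}
    (hx : x ∈ (chartAt (EuclideanSpace ℝ (Fin m)) x₀).source) (v : EuclideanSpace ℝ (Fin m)) :
    coordVec x₀ v x = tangentCoordChange (𝓡 m) x₀ x x v := by
  rw [coordVec, TangentBundle.symmL_trivializationAt_eq_core (𝕜 := ℝ) (I := 𝓡 m) hx]
  rfl

theorem coordVec_coordChange {x₀ x₁ x : M}
    (hx₀ : x ∈ (chartAt (EuclideanSpace ℝ (Fin m)) x₀).source)
    (hx₁ : x ∈ (chartAt (EuclideanSpace ℝ (Fin m)) x₁).source) (v : EuclideanSpace ℝ (Fin m)) :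
    coordVec x₁ v x = coordVec x₀ (tangentCoordChange (𝓡 m) x₁ x₀ x v) x := by
  rw [coordVec_eq_tangentCoordChange hx₀, coordVec_eq_tangentCoordChange hx₁,
    tangentCoordChange_comp]
  simp [hx₀, hx₁]

/-- Connects `chartGram`, defined by the differential of the inverse chart, with frames coming from
the tangent bundle trivialization, which are smooth sections. -/
theorem mfderiv_chart_symm_apply {x₀ : M} {y : EuclideanSpace ℝ (Fin m)}
    (hy : y ∈ (chartAt (EuclideanSpace ℝ (Fin m)) x₀).target) (v : EuclideanSpace ℝ (Fin m)) :
    mfderiv (𝓡 m) (𝓡 m) (chartAt (EuclideanSpace ℝ (Fin m)) x₀).symm y v =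
      coordVec x₀ v ((chartAt (EuclideanSpace ℝ (Fin m)) x₀).symm y) := by
  set e := chartAt (EuclideanSpace ℝ (Fin m)) x₀
  have hx := e.map_target hy
  have h := TangentBundle.symmL_trivializationAt (𝕜 := ℝ) (I := 𝓡 m) hx
  have h1 : extChartAt (𝓡 m) x₀ (e.symm y) = y := e.right_inv hy
  rw [h1] at h
  simp only [modelWithCornersSelf_coe, Set.range_id, mfderivWithin_univ] at h
  rw [coordVec, h]
  rfl

variable [RiemannianBundle (fun x : M ↦ TangentSpace (𝓡 m) x)]

variable (m) in
/-- The Riemannian density in the chart around `x₀`, as a function on the manifold. -/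
def chartDensity (x₀ x : M) : ℝ :=
  √(Matrix.det (Matrix.of fun i j : Fin m ↦ inner ℝ (coordVec x₀ (EuclideanSpace.single i 1) x)
    (coordVec x₀ (EuclideanSpace.single j 1) x)))

theorem sqrt_det_chartGram {x₀ : M} {y : EuclideanSpace ℝ (Fin m)}
    (hy : y ∈ (chartAt (EuclideanSpace ℝ (Fin m)) x₀).target) :
    √(chartGram m x₀ y).det =
      chartDensity m x₀ ((chartAt (EuclideanSpace ℝ (Fin m)) x₀).symm y) := by
  congr 2
  ext i j
  exact congrArg₂ (fun a b ↦ inner ℝ a b) (mfderiv_chart_symm_apply hy _)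
    (mfderiv_chart_symm_apply hy _)

/-- With `A` the Jacobian matrix of the coordinate change, the Gram matrices are related by `Aᵀ G
A`, so the root of the determinant picks up `|det A|`. -/
theorem chartDensity_coordChange {x₀ x₁ x : M}
    (hx₀ : x ∈ (chartAt (EuclideanSpace ℝ (Fin m)) x₀).source)
    (hx₁ : x ∈ (chartAt (EuclideanSpace ℝ (Fin m)) x₁).source) :
    chartDensity m x₁ x = |(tangentCoordChange (𝓡 m) x₁ x₀ x).det| * chartDensity m x₀ x := by
  set J := tangentCoordChange (𝓡 m) x₁ x₀ x
  set b := (EuclideanSpace.basisFun (Fin m) ℝ).toBasis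
  set A : Matrix (Fin m) (Fin m) ℝ := LinearMap.toMatrix b b (J : _ →ₗ[ℝ] _)
  have hdet : A.det = J.det := LinearMap.det_toMatrix b _
  have h1 : ∀ j, coordVec x₁ (EuclideanSpace.single j (1 : ℝ)) x =
      ∑ k, A k j • coordVec x₀ (EuclideanSpace.single k (1 : ℝ)) x := by
    intro j
    have hlin : ∀ v, coordVec x₀ v x = (trivializationAt (EuclideanSpace ℝ (Fin m))
      (TangentSpace (𝓡 m)) x₀).symmL ℝ x v := fun v ↦ rfl
    rw [coordVec_coordChange hx₀ hx₁]
    have : J (EuclideanSpace.single j (1 : ℝ)) = ∑ k, A k j • EuclideanSpace.single k (1 : ℝ) := by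
      ext i
      simp [A, b, LinearMap.toMatrix_apply, Pi.single_apply]
    change coordVec x₀ (J _) x = _
    rw [this, hlin, map_sum]
    simp_rw [map_smul, hlin]
  have h2 : (Matrix.of fun i j : Fin m ↦ inner ℝ (coordVec x₁ (EuclideanSpace.single i (1 : ℝ)) x)
      (coordVec x₁ (EuclideanSpace.single j (1 : ℝ)) x)) = A.transpose *
      (Matrix.of fun i j : Fin m ↦ inner ℝ (coordVec x₀ (EuclideanSpace.single i (1 : ℝ)) x)
      (coordVec x₀ (EuclideanSpace.single j (1 : ℝ)) x)) * A := by
    ext i j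
    simp only [Matrix.of_apply, h1, Matrix.mul_apply, Matrix.transpose_apply, sum_inner, inner_sum,
      real_inner_smul_left, real_inner_smul_right, Finset.sum_mul]
    refine Finset.sum_congr rfl fun k _ ↦ Finset.sum_congr rfl fun l _ ↦ ?_
    ring
  rw [chartDensity, h2, Matrix.det_mul, Matrix.det_mul, Matrix.det_transpose, hdet,
    mul_right_comm, ← sq, Real.sqrt_mul (sq_nonneg _), Real.sqrt_sq_eq_abs]
  rfl


omit [RiemannianBundle (fun x : M ↦ TangentSpace (𝓡 m) x)] in
theorem contMDiffOn_coordVec (x₀ : M) (v : EuclideanSpace ℝ (Fin m)) :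
    ContMDiffOn (𝓡 m) ((𝓡 m).prod 𝓘(ℝ, EuclideanSpace ℝ (Fin m))) ∞
      (fun x ↦ TotalSpace.mk' (EuclideanSpace ℝ (Fin m)) x (coordVec x₀ v x))
      (chartAt (EuclideanSpace ℝ (Fin m)) x₀).source := by
  set e := trivializationAt (EuclideanSpace ℝ (Fin m)) (TangentSpace (𝓡 m) (M := M)) x₀
  have he : e.baseSet = (chartAt (EuclideanSpace ℝ (Fin m)) x₀).source := rfl
  rw [← he, e.contMDiffOn_section_baseSet_iff]
  refine (contMDiffOn_const (c := v)).congr fun y hy ↦ ?_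
  have := e.continuousLinearMapAt_symmL (R := ℝ) hy v
  rwa [Trivialization.continuousLinearMapAt_apply, e.coe_linearMapAt_of_mem hy] at this

omit [RiemannianBundle (fun x : M ↦ TangentSpace (𝓡 m) x)] in
theorem linearIndependent_coordVec {x₀ x : M}
    (hx : x ∈ (chartAt (EuclideanSpace ℝ (Fin m)) x₀).source) :
    LinearIndependent ℝ
      (fun i : Fin m ↦ coordVec x₀ (EuclideanSpace.single i (1 : ℝ)) x) := by
  set e := trivializationAt (EuclideanSpace ℝ (Fin m)) (TangentSpace (𝓡 m) (M := M)) x₀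
  have hinj : Function.Injective (e.symmL ℝ x) :=
    Function.LeftInverse.injective (g := e.continuousLinearMapAt ℝ x)
      fun v ↦ e.continuousLinearMapAt_symmL hx v
  have h := (EuclideanSpace.basisFun (Fin m) ℝ).toBasis.linearIndependent.map'
    (e.symmL ℝ x : EuclideanSpace ℝ (Fin m) →ₗ[ℝ] TangentSpace (𝓡 m) x)
    (LinearMap.ker_eq_bot.2 hinj)
  convert! h using 1
  funext i
  simp only [OrthonormalBasis.coe_toBasis, Function.comp, EuclideanSpace.basisFun_apply]
  rfl

section

variable [MeasurableSpace M]

variable (m) in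
/-- Lebesgue measure in the chart around `x₀`, as a measure on the manifold. -/
def coordMeasure (x₀ : M) : Measure M :=
  Measure.map (chartAt (EuclideanSpace ℝ (Fin m)) x₀).symm
    (volume.restrict (chartAt (EuclideanSpace ℝ (Fin m)) x₀).target)

variable [BorelSpace M]

omit [IsManifold (𝓡 m) ∞ M] [RiemannianBundle (fun x : M ↦ TangentSpace (𝓡 m) x)] in
theorem aemeasurable_chartAt_symm (x₀ : M) :
    AEMeasurable (chartAt (EuclideanSpace ℝ (Fin m)) x₀).symm
      (volume.restrict (chartAt (EuclideanSpace ℝ (Fin m)) x₀).target) :=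
  (chartAt (EuclideanSpace ℝ (Fin m)) x₀).symm.continuousOn.aemeasurable
    (chartAt (EuclideanSpace ℝ (Fin m)) x₀).open_target.measurableSet

omit [IsManifold (𝓡 m) ∞ M] [RiemannianBundle (fun x : M ↦ TangentSpace (𝓡 m) x)] in
theorem measurableSet_chartAt_target_inter_preimage (x₀ : M) {A : Set M} (hA : MeasurableSet A) :
    MeasurableSet ((chartAt (EuclideanSpace ℝ (Fin m)) x₀).target ∩
      (chartAt (EuclideanSpace ℝ (Fin m)) x₀).symm ⁻¹' A) := by
  have hm := (chartAt (EuclideanSpace ℝ (Fin m)) x₀).open_target.measurableSet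
  have h1 := (continuousOn_iff_continuous_domRestrict.1
    (chartAt (EuclideanSpace ℝ (Fin m)) x₀).symm.continuousOn).measurable hA
  have h2 := hm.subtype_image h1
  convert h2 using 1
  ext y
  constructor
  · rintro ⟨hy, hy'⟩
    exact ⟨⟨y, hy⟩, hy', rfl⟩
  · rintro ⟨⟨y, hy⟩, hy', rfl⟩
    exact ⟨hy, hy'⟩

theorem chartMeasure_apply (x₀ : M) {A : Set M} (hA : MeasurableSet A) :
    chartMeasure m x₀ A = ∫⁻ y in (chartAt (EuclideanSpace ℝ (Fin m)) x₀).target ∩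
      (chartAt (EuclideanSpace ℝ (Fin m)) x₀).symm ⁻¹' A,
      ENNReal.ofReal (chartDensity m x₀ ((chartAt (EuclideanSpace ℝ (Fin m)) x₀).symm y)) := by
  have hm := (chartAt (EuclideanSpace ℝ (Fin m)) x₀).open_target.measurableSet
  rw [chartMeasure, Measure.map_apply_of_aemeasurable
    ((aemeasurable_chartAt_symm x₀).mono_ac (withDensity_absolutelyContinuous _ _)) hA,
    withDensity_apply', Measure.restrict_restrict' hm, Set.inter_comm]
  refine setLIntegral_congr_fun (measurableSet_chartAt_target_inter_preimage x₀ hA) fun y hy ↦ ?_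
  exact congrArg ENNReal.ofReal (sqrt_det_chartGram hy.1)

/-- Change of variables along the transition map; its Jacobian is exactly the factor between the two
densities. An inequality is enough, because the Riemannian measure is the supremum of the chart
measures. -/
theorem restrict_chartMeasure_le (x₀ x₁ : M) :
    (chartMeasure m x₁).restrict (chartAt (EuclideanSpace ℝ (Fin m)) x₀).source ≤
      chartMeasure m x₀ := by
  set e₀ := chartAt (EuclideanSpace ℝ (Fin m)) x₀ with he₀
  set e₁ := chartAt (EuclideanSpace ℝ (Fin m)) x₁ with he₁
  rw [Measure.le_iff]
  intro A hA
  have hA' := hA.inter e₀.open_source.measurableSet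
  rw [Measure.restrict_apply hA, chartMeasure_apply x₁ hA', chartMeasure_apply x₀ hA]
  set S := e₁.target ∩ e₁.symm ⁻¹' (A ∩ e₀.source) with hS
  have hSm : MeasurableSet S := measurableSet_chartAt_target_inter_preimage x₁ hA'
  have hinj : Set.InjOn (fun y ↦ e₀ (e₁.symm y)) S := by
    intro y hy z hz h
    have h1 := e₀.injOn hy.2.2 hz.2.2 h
    exact e₁.symm.injOn hy.1 hz.1 h1
  have hder : ∀ y ∈ S, HasFDerivWithinAt (fun y ↦ e₀ (e₁.symm y))
      (tangentCoordChange (𝓡 m) x₁ x₀ (e₁.symm y)) S y := by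
    intro y hy
    have h1 := hasFDerivWithinAt_tangentCoordChange (I := 𝓡 m) (x := x₁) (y := x₀)
      (z := e₁.symm y) (by simpa using ⟨e₁.map_target hy.1, hy.2.2⟩)
    have h2 : extChartAt (𝓡 m) x₁ (e₁.symm y) = y := e₁.right_inv hy.1
    rw [h2] at h1
    exact h1.mono (by rw [modelWithCornersSelf_coe, Set.range_id]; exact Set.subset_univ _)
  calc ∫⁻ y in S, ENNReal.ofReal (chartDensity m x₁ (e₁.symm y))
      = ∫⁻ y in S, ENNReal.ofReal |(tangentCoordChange (𝓡 m) x₁ x₀ (e₁.symm y)).det| *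
          ENNReal.ofReal (chartDensity m x₀ (e₀.symm (e₀ (e₁.symm y)))) := by
        refine setLIntegral_congr_fun hSm fun y hy ↦ ?_
        rw [e₀.left_inv hy.2.2, ← ENNReal.ofReal_mul (abs_nonneg _),
          chartDensity_coordChange hy.2.2 (e₁.map_target hy.1)]
    _ = ∫⁻ z in (fun y ↦ e₀ (e₁.symm y)) '' S, ENNReal.ofReal (chartDensity m x₀ (e₀.symm z)) :=
        (lintegral_image_eq_lintegral_abs_det_fderiv_mul volume hSm hder hinj
          (fun z ↦ ENNReal.ofReal (chartDensity m x₀ (e₀.symm z)))).symm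
    _ ≤ _ := by
        refine lintegral_mono_set ?_
        rintro _ ⟨y, hy, rfl⟩
        exact ⟨e₀.map_source hy.2.2, by
          rw [Set.mem_preimage]
          change e₀.symm (e₀ (e₁.symm y)) ∈ A
          rw [e₀.left_inv hy.2.2]
          exact hy.2.1⟩

/-- Each chart measure is at most `chartMeasure m x₀` plus the Riemannian measure on the complement
of the chart domain. This sum therefore bounds the supremum, and restricting to the domain removes
its second summand. -/
theorem riemannianMeasure_restrict_source_eq_chartMeasure (x₀ : M) :
    (riemannianMeasure m M).restrict (chartAt (EuclideanSpace ℝ (Fin m)) x₀).source =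
      chartMeasure m x₀ := by
  set S := (chartAt (EuclideanSpace ℝ (Fin m)) x₀).source
  have hS : MeasurableSet S := (chartAt (EuclideanSpace ℝ (Fin m)) x₀).open_source.measurableSet
  apply le_antisymm
  · have h1 : riemannianMeasure m M ≤
        chartMeasure m x₀ + (riemannianMeasure m M).restrict Sᶜ := by
      refine iSup_le fun x₁ ↦ ?_
      rw [← Measure.restrict_add_restrict_compl (μ := chartMeasure m x₁) hS]
      exact add_le_add (restrict_chartMeasure_le x₀ x₁)
        (Measure.restrict_mono subset_rfl (le_iSup (fun x ↦ chartMeasure m x) x₁))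
    have h2 := Measure.restrict_mono (subset_refl S) h1
    rw [Measure.restrict_add, Measure.restrict_restrict hS, Set.inter_compl_self,
      Measure.restrict_empty, add_zero] at h2
    exact h2.trans Measure.restrict_le_self
  · have h1 : chartMeasure m x₀ = (chartMeasure m x₀).restrict S := by
      refine (Measure.restrict_eq_self_of_ae_mem ?_).symm
      rw [chartMeasure]
      have hae := ((aemeasurable_chartAt_symm x₀).mono_ac
        (withDensity_absolutelyContinuous (volume.restrict
          (chartAt (EuclideanSpace ℝ (Fin m)) x₀).target)
          fun y ↦ ENNReal.ofReal (Real.sqrt (chartGram m x₀ y).det)))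
      refine (ae_map_iff hae hS).2 ?_
      refine (withDensity_absolutelyContinuous _ _).ae_le ?_
      filter_upwards [ae_restrict_mem
        (chartAt (EuclideanSpace ℝ (Fin m)) x₀).open_target.measurableSet] with y hy
      exact (chartAt (EuclideanSpace ℝ (Fin m)) x₀).map_target hy
    rw [h1]
    exact Measure.restrict_mono subset_rfl (le_iSup (fun x ↦ chartMeasure m x) x₀)

variable [IsContMDiffRiemannianBundle (𝓡 m) ∞ (EuclideanSpace ℝ (Fin m))
      (fun x : M ↦ TangentSpace (𝓡 m) x)]

omit [MeasurableSpace M] [BorelSpace M] in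
theorem contMDiffOn_chartDensity_sq (x₀ : M) :
    ContMDiffOn (𝓡 m) 𝓘(ℝ) ∞ (fun x ↦ Matrix.det (Matrix.of fun i j : Fin m ↦
      inner ℝ (coordVec x₀ (EuclideanSpace.single i 1) x)
        (coordVec x₀ (EuclideanSpace.single j 1) x)))
      (chartAt (EuclideanSpace ℝ (Fin m)) x₀).source := by
  simp_rw [Matrix.det_apply']
  refine contMDiffOn_finsetSum fun σ _ ↦ ?_
  refine contMDiffOn_const.mul (contMDiffOn_finsetProd fun i _ ↦ ?_)
  exact ContMDiffOn.inner_bundle (F := EuclideanSpace ℝ (Fin m))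
    (E := fun x : M ↦ TangentSpace (𝓡 m) x) (b := fun x ↦ x)
    (contMDiffOn_coordVec x₀ _) (contMDiffOn_coordVec x₀ _)

omit [MeasurableSpace M] [BorelSpace M] [IsContMDiffRiemannianBundle (𝓡 m) ∞
  (EuclideanSpace ℝ (Fin m)) (fun x : M ↦ TangentSpace (𝓡 m) x)] in
theorem det_gram_coordVec_pos {x₀ x : M}
    (hx : x ∈ (chartAt (EuclideanSpace ℝ (Fin m)) x₀).source) :
    0 < Matrix.det (Matrix.of fun i j : Fin m ↦
      inner ℝ (coordVec x₀ (EuclideanSpace.single i 1) x)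
        (coordVec x₀ (EuclideanSpace.single j 1) x)) :=
  det_of_inner_pos (E := TangentSpace (𝓡 m) x) (linearIndependent_coordVec hx)

omit [MeasurableSpace M] [BorelSpace M] [IsContMDiffRiemannianBundle (𝓡 m) ∞
  (EuclideanSpace ℝ (Fin m)) (fun x : M ↦ TangentSpace (𝓡 m) x)] in
theorem chartDensity_pos {x₀ x : M}
    (hx : x ∈ (chartAt (EuclideanSpace ℝ (Fin m)) x₀).source) : 0 < chartDensity m x₀ x :=
  Real.sqrt_pos.2 (det_gram_coordVec_pos hx)

omit [MeasurableSpace M] [BorelSpace M] in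
theorem contMDiffOn_chartDensity (x₀ : M) :
    ContMDiffOn (𝓡 m) 𝓘(ℝ) ∞ (chartDensity m x₀)
      (chartAt (EuclideanSpace ℝ (Fin m)) x₀).source := fun x hx ↦
  (Real.contDiffAt_sqrt (n := ∞) (det_gram_coordVec_pos hx).ne').contMDiffAt.comp_contMDiffWithinAt
    x (contMDiffOn_chartDensity_sq x₀ x hx)

omit [IsManifold (𝓡 m) ∞ M] [RiemannianBundle (fun x : M ↦ TangentSpace (𝓡 m) x)]
  [IsContMDiffRiemannianBundle (𝓡 m) ∞
    (EuclideanSpace ℝ (Fin m)) (fun x : M ↦ TangentSpace (𝓡 m) x)] in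
theorem coordMeasure_restrict_source (x₀ : M) : (coordMeasure m x₀).restrict
    (chartAt (EuclideanSpace ℝ (Fin m)) x₀).source = coordMeasure m x₀ := by
  refine Measure.restrict_eq_self_of_ae_mem ?_
  refine (ae_map_iff (aemeasurable_chartAt_symm x₀)
    (chartAt (EuclideanSpace ℝ (Fin m)) x₀).open_source.measurableSet).2 ?_
  filter_upwards [ae_restrict_mem
    (chartAt (EuclideanSpace ℝ (Fin m)) x₀).open_target.measurableSet] with y hy
  exact (chartAt (EuclideanSpace ℝ (Fin m)) x₀).map_target hy

/-- Moves the density from the coordinates to `M`, so that local integrals become integrals against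
`coordMeasure` of functions on `M`. -/
theorem riemannianMeasure_restrict_source (x₀ : M) :
    (riemannianMeasure m M).restrict (chartAt (EuclideanSpace ℝ (Fin m)) x₀).source =
      (coordMeasure m x₀).withDensity fun x ↦ ENNReal.ofReal (chartDensity m x₀ x) := by
  rw [riemannianMeasure_restrict_source_eq_chartMeasure]
  ext A hA
  have hae := aemeasurable_chartAt_symm (m := m) x₀
  have hD : AEMeasurable (fun x ↦ ENNReal.ofReal (chartDensity m x₀ x)) (coordMeasure m x₀) := by
    rw [← coordMeasure_restrict_source]
    exact ((contMDiffOn_chartDensity x₀).continuousOn.aemeasurable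
      (chartAt (EuclideanSpace ℝ (Fin m)) x₀).open_source.measurableSet).ennreal_ofReal
  rw [chartMeasure_apply x₀ hA, withDensity_apply _ hA]
  have h1 : (coordMeasure m x₀).restrict A = Measure.map
      (chartAt (EuclideanSpace ℝ (Fin m)) x₀).symm
      (volume.restrict ((chartAt (EuclideanSpace ℝ (Fin m)) x₀).target ∩
        (chartAt (EuclideanSpace ℝ (Fin m)) x₀).symm ⁻¹' A)) := by
    rw [coordMeasure, Measure.restrict_map_of_aemeasurable hae hA, Measure.restrict_restrict'
      (chartAt (EuclideanSpace ℝ (Fin m)) x₀).open_target.measurableSet, Set.inter_comm]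
  have h2 := hD.restrict (s := A)
  rw [h1] at h2 ⊢
  rw [lintegral_map' h2 (hae.mono_measure
    (Measure.restrict_mono Set.inter_subset_left le_rfl))]

end

end CoordinateFields

/-! ### Algebra of the metric on `T* ⊗ W`. -/

section HilbertSchmidt

variable {T : Type*} [NormedAddCommGroup T] [InnerProductSpace ℝ T] [FiniteDimensional ℝ T]
  {W : Type*} [NormedAddCommGroup W] [InnerProductSpace ℝ W] {ι : Type*} [Fintype ι]

-- Parseval's identity. The standard orthonormal bases of the tangent spaces carry no regularity in
-- the base point; independence of the basis permits computing `homInner` in smooth frames instead.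
omit [FiniteDimensional ℝ T] in
theorem sum_inner_apply_orthonormalBasis_eq {κ : Type*} [Fintype κ] (b : OrthonormalBasis ι ℝ T)
    (c : OrthonormalBasis κ ℝ T) (A B : T →L[ℝ] W) :
    ∑ i, inner ℝ (A (b i)) (B (b i)) = ∑ i, inner ℝ (A (c i)) (B (c i)) := by
  classical
  have h1 : ∀ (L : T →L[ℝ] W) i, L (b i) = ∑ j, inner ℝ (c j) (b i) • L (c j) := by
    intro L i
    conv_lhs => rw [← c.sum_repr' (b i), map_sum]
    simp
  calc ∑ i, inner ℝ (A (b i)) (B (b i))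
      = ∑ i, ∑ k, ∑ j, (inner ℝ (c j) (b i) * inner ℝ (b i) (c k)) *
          inner ℝ (A (c j)) (B (c k)) := by
        refine Finset.sum_congr rfl fun i _ ↦ ?_
        rw [h1 A i, h1 B i, inner_sum]
        refine Finset.sum_congr rfl fun k _ ↦ ?_
        rw [sum_inner]
        refine Finset.sum_congr rfl fun j _ ↦ ?_
        rw [real_inner_smul_left, real_inner_smul_right, real_inner_comm (b i) (c k)]
        ring
    _ = ∑ k, ∑ j, (∑ i, inner ℝ (c j) (b i) * inner ℝ (b i) (c k)) *
          inner ℝ (A (c j)) (B (c k)) := by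
        rw [Finset.sum_comm]
        refine Finset.sum_congr rfl fun k _ ↦ ?_
        rw [Finset.sum_comm]
        simp_rw [Finset.sum_mul]
    _ = _ := by
        simp_rw [b.sum_inner_mul_inner, orthonormal_iff_ite.1 c.orthonormal]
        simp

theorem homInner_eq_sum (b : OrthonormalBasis ι ℝ T) (A B : T →L[ℝ] W) :
    homInner ℝ A B = ∑ i, inner ℝ (A (b i)) (B (b i)) :=
  sum_inner_apply_orthonormalBasis_eq _ _ A B

theorem homNormSq_eq_homInner (A : T →L[ℝ] W) : homNormSq A = homInner ℝ A A := by
  simp [homNormSq, homInner]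

theorem homNormSq_eq_sum (b : OrthonormalBasis ι ℝ T) (A : T →L[ℝ] W) :
    homNormSq A = ∑ i, ‖A (b i)‖ ^ 2 := by
  rw [homNormSq_eq_homInner, homInner_eq_sum b]
  simp

/-- Testing against `X♭ ⊗ w` extracts the derivative in direction `X`; this is how the weak equation
is read off direction by direction. -/
theorem homInner_smulRight (A : T →L[ℝ] W) (x : T) (w : W) :
    homInner ℝ A ((innerSL ℝ x).smulRight w) = inner ℝ (A x) w := by
  set b := stdOrthonormalBasis ℝ T
  have h1 : A x = ∑ i, inner ℝ (b i) x • A (b i) := by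
    conv_lhs => rw [← b.sum_repr' x, map_sum]
    simp
  rw [h1, sum_inner, homInner]
  refine Finset.sum_congr rfl fun i _ ↦ ?_
  simp only [ContinuousLinearMap.smulRight_apply, innerSL_apply_apply, real_inner_smul_left,
    real_inner_smul_right]
  rw [real_inner_comm]

end HilbertSchmidt

section HilbertSchmidtNorm

variable {T : Type*} [NormedAddCommGroup T] [InnerProductSpace ℝ T] [FiniteDimensional ℝ T]
  {W : Type*} [NormedAddCommGroup W] [NormedSpace ℝ W]

theorem homNormSq_nonneg (A : T →L[ℝ] W) : 0 ≤ homNormSq A :=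
  Finset.sum_nonneg fun _ _ ↦ by positivity

theorem norm_apply_sq_le_homNormSq (A : T →L[ℝ] W) (x : T) :
    ‖A x‖ ^ 2 ≤ homNormSq A * ‖x‖ ^ 2 := by
  set b := stdOrthonormalBasis ℝ T
  have h1 : A x = ∑ i, inner ℝ (b i) x • A (b i) := by
    conv_lhs => rw [← b.sum_repr' x, map_sum]
    simp
  have h2 : ‖A x‖ ≤ ∑ i, |inner ℝ (b i) x| * ‖A (b i)‖ := by
    rw [h1]
    refine (norm_sum_le _ _).trans (Finset.sum_le_sum fun i _ ↦ ?_)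
    rw [norm_smul, Real.norm_eq_abs]
  calc ‖A x‖ ^ 2 ≤ (∑ i, |inner ℝ (b i) x| * ‖A (b i)‖) ^ 2 := by gcongr
    _ ≤ (∑ i, |inner ℝ (b i) x| ^ 2) * ∑ i, ‖A (b i)‖ ^ 2 := Finset.sum_mul_sq_le_sq_mul_sq _ _ _
    _ = homNormSq A * ‖x‖ ^ 2 := by
      rw [mul_comm, ← b.sum_sq_norm_inner_right x]
      simp [homNormSq, b]

theorem homNormSq_add_le (A B : T →L[ℝ] W) :
    homNormSq (A + B) ≤ 2 * homNormSq A + 2 * homNormSq B := by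
  simp only [homNormSq, Finset.mul_sum, ← Finset.sum_add_distrib]
  refine Finset.sum_le_sum fun i _ ↦ ?_
  have h := norm_add_le (A (stdOrthonormalBasis ℝ T i)) (B (stdOrthonormalBasis ℝ T i))
  rw [add_apply]
  calc _ ≤ (‖A (stdOrthonormalBasis ℝ T i)‖ + ‖B (stdOrthonormalBasis ℝ T i)‖) ^ 2 := by gcongr
    _ ≤ _ := by
      nlinarith [sq_nonneg (‖A (stdOrthonormalBasis ℝ T i)‖ - ‖B (stdOrthonormalBasis ℝ T i)‖)]

theorem homNormSq_smul (c : ℝ) (A : T →L[ℝ] W) : homNormSq (c • A) = c ^ 2 * homNormSq A := by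
  simp [homNormSq, norm_smul, mul_pow, Finset.mul_sum]

theorem homNormSq_smulRight (l : T →L[ℝ] ℝ) (w : W) :
    homNormSq (l.smulRight w) = homNormSq l * ‖w‖ ^ 2 := by
  simp [homNormSq, norm_smul, mul_pow, Finset.sum_mul]

@[simp]
theorem homNormSq_zero : homNormSq (0 : T →L[ℝ] W) = 0 := by
  simp [homNormSq]

end HilbertSchmidtNorm

theorem norm_add_sq_le_two_mul {W : Type*} [NormedAddCommGroup W] (a b : W) :
    ‖a + b‖ ^ 2 ≤ 2 * ‖a‖ ^ 2 + 2 * ‖b‖ ^ 2 := by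
  calc _ ≤ (‖a‖ + ‖b‖) ^ 2 := by gcongr; exact norm_add_le a b
    _ ≤ _ := by nlinarith [sq_nonneg (‖a‖ - ‖b‖)]

theorem abs_homInner_le {T : Type*} [NormedAddCommGroup T] [InnerProductSpace ℝ T]
    [FiniteDimensional ℝ T] {W : Type*} [NormedAddCommGroup W] [InnerProductSpace ℝ W]
    (A B : T →L[ℝ] W) : |homInner ℝ A B| ≤ √(homNormSq A) * √(homNormSq B) := by
  rw [← Real.sqrt_mul (homNormSq_nonneg A)]
  apply Real.abs_le_sqrt
  rw [homInner, homNormSq, homNormSq]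
  calc _ ≤ (∑ i, ‖A (stdOrthonormalBasis ℝ T i)‖ * ‖B (stdOrthonormalBasis ℝ T i)‖) ^ 2 := by
        rw [sq_le_sq]
        refine (Finset.abs_sum_le_sum_abs _ _).trans ((Finset.sum_le_sum fun i _ ↦
          abs_real_inner_le_norm _ _).trans (le_abs_self _))
    _ ≤ _ := Finset.sum_mul_sq_le_sq_mul_sq _ _ _

/-! ### Measurability of sections, tested against smooth sections. -/

theorem aemeasurable_of_forall_exists_nhds {X β : Type*} [TopologicalSpace X]
    [SecondCountableTopology X] [MeasurableSpace X] [MeasurableSpace β] {μ : Measure X} {f : X → β}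
    (h : ∀ x, ∃ U ∈ 𝓝 x, AEMeasurable f (μ.restrict U)) : AEMeasurable f μ := by
  choose U hU hf using h
  -- Second countability leaves countably many neighbourhoods, so the exceptional null sets may be
  -- united.
  obtain ⟨s, hs, hsU⟩ := TopologicalSpace.countable_cover_nhds hU
  have := hs.to_subtype
  have h1 : AEMeasurable f (μ.restrict (⋃ x : s, U x)) :=
    (aemeasurable_iUnion_iff).2 fun x ↦ hf x
  rwa [Set.iUnion_subtype (fun x ↦ x ∈ s) (fun x ↦ U x), hsU, Measure.restrict_univ] at h1

section Measurability

variable {m : ℕ} {M : Type*} [TopologicalSpace M] [T2Space M] [SecondCountableTopology M]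
  [ChartedSpace (EuclideanSpace ℝ (Fin m)) M] [IsManifold (𝓡 m) ∞ M]
  [MeasurableSpace M] [BorelSpace M] {μ : Measure M}
  {F : Type*} [NormedAddCommGroup F] [NormedSpace ℝ F] [FiniteDimensional ℝ F]
  {V : M → Type*} [TopologicalSpace (TotalSpace F V)]
  [∀ x, NormedAddCommGroup (V x)] [∀ x, InnerProductSpace ℝ (V x)]
  [FiberBundle F V] [VectorBundle ℝ F V] [ContMDiffVectorBundle ∞ F V (𝓡 m)]
  [IsContMDiffRiemannianBundle (𝓡 m) ∞ F V]

omit [T2Space M] [IsManifold (𝓡 m) ∞ M] [FiniteDimensional ℝ F]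
  [ContMDiffVectorBundle ∞ F V (𝓡 m)] [SecondCountableTopology M]
  [MeasurableSpace M] [BorelSpace M] in
theorem MetricSobolev.IsSmoothSection.contMDiff_inner {s t : ∀ x, V x} (hs : IsSmoothSection F m s)
    (ht : IsSmoothSection F m t) : ContMDiff (𝓡 m) 𝓘(ℝ) ∞ (fun x ↦ inner ℝ (s x) (t x)) :=
  ContMDiff.inner_bundle (F := F) (E := V) (b := fun x ↦ x) hs ht

-- In the local frame `s` has measurable components, and the inner products of the frame with `t`
-- are continuous. The components `w` are an independent datum so that the lemma also applies to `x
-- ↦ A x (X x)`.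
omit [T2Space M] [IsManifold (𝓡 m) ∞ M] [SecondCountableTopology M] in
theorem aemeasurable_inner_of_eq_symm (e : Trivialization F (TotalSpace.proj : TotalSpace F V → M))
    [MemTrivializationAtlas e] {N : Set M} (hN : IsOpen N) (hNe : N ⊆ e.baseSet) {w : M → F}
    (hw : AEStronglyMeasurable w (μ.restrict N)) {s t : ∀ x, V x}
    (hs : ∀ x ∈ N, s x = e.symm x (w x)) (ht : IsSmoothSection F m t) :
    AEMeasurable (fun x ↦ inner ℝ (s x) (t x)) (μ.restrict N) := by
  let b := Module.finBasis ℝ F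
  have h1 : ∀ a, ContinuousOn (fun x ↦ inner ℝ (e.localFrame b a x) (t x)) N := fun a ↦
    (ContMDiffOn.inner_bundle (F := F) (E := V) (b := fun x ↦ x)
      ((e.contMDiffOn_localFrame_baseSet (I := 𝓡 m) ∞ b a).mono hNe)
      ht.contMDiffOn).continuousOn
  have h2 : AEMeasurable (fun x ↦ ∑ a, b.repr (w x) a * inner ℝ (e.localFrame b a x) (t x))
      (μ.restrict N) := by
    refine Finset.aemeasurable_fun_sum _ fun a _ ↦ ?_
    refine AEMeasurable.mul ?_ ((h1 a).aemeasurable hN.measurableSet)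
    exact ((LinearMap.toContinuousLinearMap (b.coord a)).continuous.comp_aestronglyMeasurable
      hw).aemeasurable
  refine h2.congr ?_
  filter_upwards [ae_restrict_mem hN.measurableSet] with x hx
  have h3 : s x = ∑ a, b.repr (w x) a • e.localFrame b a x := by
    rw [hs x hx, ← e.symmL_apply (R := ℝ) (hNe hx)]
    conv_lhs => rw [← b.sum_repr (w x), map_sum]
    refine Finset.sum_congr rfl fun a _ ↦ ?_
    rw [map_smul, e.localFrame_apply_of_mem_baseSet b (hNe hx), Trivialization.basisAt,
      Module.Basis.map_apply, Trivialization.linearEquivAt_symm_apply, e.symmL_apply (hNe hx)]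
  rw [h3, sum_inner]
  simp_rw [real_inner_smul_left]

omit [T2Space M] [IsManifold (𝓡 m) ∞ M] in
theorem MetricSobolev.IsMeasurableSection.aemeasurable_inner {s t : ∀ x, V x}
    (hs : IsMeasurableSection F μ s)
    (ht : IsSmoothSection F m t) : AEMeasurable (fun x ↦ inner ℝ (s x) (t x)) μ := by
  refine aemeasurable_of_forall_exists_nhds fun x₀ ↦ ?_
  set e := trivializationAt F V x₀
  refine ⟨e.baseSet, e.open_baseSet.mem_nhds (mem_baseSet_trivializationAt F V x₀), ?_⟩
  refine aemeasurable_inner_of_eq_symm e e.open_baseSet subset_rfl (hs e) (fun x hx ↦ ?_) ht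
  exact (e.symm_apply_apply_mk hx (s x)).symm

end Measurability

section FormMeasurability

variable {m : ℕ} {M : Type*} [TopologicalSpace M] [T2Space M] [SecondCountableTopology M]
  [ChartedSpace (EuclideanSpace ℝ (Fin m)) M] [IsManifold (𝓡 m) ∞ M]
  [MeasurableSpace M] [BorelSpace M] {μ : Measure M}
  {F : Type*} [NormedAddCommGroup F] [NormedSpace ℝ F] [FiniteDimensional ℝ F]
  {V : M → Type*} [TopologicalSpace (TotalSpace F V)]
  [∀ x, NormedAddCommGroup (V x)] [∀ x, InnerProductSpace ℝ (V x)]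
  [FiberBundle F V] [VectorBundle ℝ F V] [ContMDiffVectorBundle ∞ F V (𝓡 m)]
  [IsContMDiffRiemannianBundle (𝓡 m) ∞ F V]

theorem MetricSobolev.IsMeasurableSection.aemeasurable_inner_apply
    {A : ∀ x : M, TangentSpace (𝓡 m) x →L[ℝ] V x}
    {X : ∀ x : M, TangentSpace (𝓡 m) x} {t : ∀ x, V x}
    (hA : IsMeasurableSection (EuclideanSpace ℝ (Fin m) →L[ℝ] F) μ A)
    (hX : IsSmoothSection (EuclideanSpace ℝ (Fin m)) m X)
    (ht : IsSmoothSection F m t) : AEMeasurable (fun x ↦ inner ℝ (A x (X x)) (t x)) μ := by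
  refine aemeasurable_of_forall_exists_nhds fun x₀ ↦ ?_
  set e₁ := trivializationAt (EuclideanSpace ℝ (Fin m)) (TangentSpace (𝓡 m) (M := M)) x₀
  set e₂ := trivializationAt F V x₀
  set e := trivializationAt (EuclideanSpace ℝ (Fin m) →L[ℝ] F)
    (fun x : M ↦ TangentSpace (𝓡 m) x →L[ℝ] V x) x₀
  have hN : IsOpen (e₁.baseSet ∩ e₂.baseSet) := e₁.open_baseSet.inter e₂.open_baseSet
  refine ⟨e₁.baseSet ∩ e₂.baseSet, hN.mem_nhds ⟨mem_baseSet_trivializationAt _ _ x₀,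
    mem_baseSet_trivializationAt _ _ x₀⟩, ?_⟩
  have hbase : e.baseSet = e₁.baseSet ∩ e₂.baseSet := rfl
  have h1 := hA e
  rw [hbase] at h1
  have h2 : ContinuousOn (fun x ↦ (e₁ ⟨x, X x⟩).2) (e₁.baseSet ∩ e₂.baseSet) :=
    ((e₁.contMDiffOn_section_baseSet_iff (IB := 𝓡 m) (n := ∞)).1 hX.contMDiffOn).continuousOn.mono
      Set.inter_subset_left
  refine aemeasurable_inner_of_eq_symm (w := fun x ↦ (e ⟨x, A x⟩).2 (e₁ ⟨x, X x⟩).2) e₂ hN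
    Set.inter_subset_right ?_ (fun x hx ↦ ?_) ht
  · exact (ContinuousLinearMap.apply ℝ F).flip.aestronglyMeasurable_comp₂ h1
      (h2.aestronglyMeasurable hN.measurableSet)
  · rw [hom_trivializationAt_apply]
    rw [ContinuousLinearMap.inCoordinates_eq hx.1 hx.2]
    have h3 : e₁.symm x (e₁ ⟨x, X x⟩).2 = X x := e₁.symm_apply_apply_mk hx.1 (X x)
    exact ((e₂.symm_apply_apply_mk hx.2 _).trans (congrArg (A x) h3)).symm

end FormMeasurability

section Coefficients

variable (m : ℕ) {M : Type*} [TopologicalSpace M] [MeasurableSpace M]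
  [ChartedSpace (EuclideanSpace ℝ (Fin m)) M]
  (F : Type*) [NormedAddCommGroup F] [NormedSpace ℝ F]
  {V : M → Type*} [TopologicalSpace (TotalSpace F V)]
  [∀ x, NormedAddCommGroup (V x)] [∀ x, InnerProductSpace ℝ (V x)]
  [FiberBundle F V]

/-- The inner products with all smooth sections are measurable. -/
def HasMeasurableCoeffs (μ : Measure M) (s : ∀ x, V x) : Prop :=
  ∀ t : ∀ x, V x, IsSmoothSection F m t → AEMeasurable (fun x ↦ inner ℝ (s x) (t x)) μ

/-- The components with respect to all smooth vector fields and sections are measurable. -/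
def HasMeasurableFormCoeffs [IsManifold (𝓡 m) ∞ M] (μ : Measure M)
    (A : ∀ x : M, TangentSpace (𝓡 m) x →L[ℝ] V x) : Prop :=
  ∀ X : ∀ x : M, TangentSpace (𝓡 m) x, IsSmoothSection (EuclideanSpace ℝ (Fin m)) m X →
    HasMeasurableCoeffs m F μ (fun x ↦ A x (X x))

end Coefficients

section

variable {m : ℕ} {M : Type*} [TopologicalSpace M] [MeasurableSpace M]
  [ChartedSpace (EuclideanSpace ℝ (Fin m)) M]
  {F : Type*} [NormedAddCommGroup F] [NormedSpace ℝ F]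
  {V : M → Type*} [TopologicalSpace (TotalSpace F V)]
  [∀ x, NormedAddCommGroup (V x)] [∀ x, InnerProductSpace ℝ (V x)]
  [FiberBundle F V] {μ : Measure M} {s t : ∀ x, V x}

namespace HasMeasurableCoeffs

theorem add (hs : HasMeasurableCoeffs m F μ s) (ht : HasMeasurableCoeffs m F μ t) :
    HasMeasurableCoeffs m F μ (fun x ↦ s x + t x) := fun u hu ↦ by
  simp_rw [inner_add_left]
  exact (hs u hu).add (ht u hu)

theorem sub (hs : HasMeasurableCoeffs m F μ s) (ht : HasMeasurableCoeffs m F μ t) :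
    HasMeasurableCoeffs m F μ (fun x ↦ s x - t x) := fun u hu ↦ by
  simp_rw [inner_sub_left]
  exact (hs u hu).sub (ht u hu)

theorem smul {f : M → ℝ} (hf : AEMeasurable f μ) (hs : HasMeasurableCoeffs m F μ s) :
    HasMeasurableCoeffs m F μ (fun x ↦ f x • s x) := fun u hu ↦ by
  simp_rw [real_inner_smul_left]
  exact hf.mul (hs u hu)

end HasMeasurableCoeffs

namespace HasMeasurableFormCoeffs

variable [IsManifold (𝓡 m) ∞ M] {A B : ∀ x : M, TangentSpace (𝓡 m) x →L[ℝ] V x}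

theorem add (hA : HasMeasurableFormCoeffs m F μ A) (hB : HasMeasurableFormCoeffs m F μ B) :
    HasMeasurableFormCoeffs m F μ (fun x ↦ A x + B x) := fun X hX ↦ (hA X hX).add (hB X hX)

theorem sub (hA : HasMeasurableFormCoeffs m F μ A) (hB : HasMeasurableFormCoeffs m F μ B) :
    HasMeasurableFormCoeffs m F μ (fun x ↦ A x - B x) := fun X hX ↦ (hA X hX).sub (hB X hX)

theorem smul {f : M → ℝ} (hf : AEMeasurable f μ) (hA : HasMeasurableFormCoeffs m F μ A) :
    HasMeasurableFormCoeffs m F μ (fun x ↦ f x • A x) := fun X hX ↦ (hA X hX).smul hf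

end HasMeasurableFormCoeffs

end

section

variable {m : ℕ} {M : Type*} [TopologicalSpace M] [T2Space M] [SecondCountableTopology M]
  [ChartedSpace (EuclideanSpace ℝ (Fin m)) M] [IsManifold (𝓡 m) ∞ M]
  [MeasurableSpace M] [BorelSpace M] {μ : Measure M}
  {F : Type*} [NormedAddCommGroup F] [NormedSpace ℝ F] [FiniteDimensional ℝ F]
  {V : M → Type*} [TopologicalSpace (TotalSpace F V)]
  [∀ x, NormedAddCommGroup (V x)] [∀ x, InnerProductSpace ℝ (V x)]
  [FiberBundle F V] [VectorBundle ℝ F V] [ContMDiffVectorBundle ∞ F V (𝓡 m)]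
  [IsContMDiffRiemannianBundle (𝓡 m) ∞ F V]

omit [T2Space M] [IsManifold (𝓡 m) ∞ M] in
theorem MetricSobolev.IsMeasurableSection.hasMeasurableCoeffs {s : ∀ x, V x}
    (hs : IsMeasurableSection F μ s) :
    HasMeasurableCoeffs m F μ s := fun _ ht ↦ hs.aemeasurable_inner ht

theorem MetricSobolev.IsMeasurableSection.hasMeasurableFormCoeffs
    {A : ∀ x : M, TangentSpace (𝓡 m) x →L[ℝ] V x}
    (hA : IsMeasurableSection (EuclideanSpace ℝ (Fin m) →L[ℝ] F) μ A) :
    HasMeasurableFormCoeffs m F μ A := fun _ hX _ ht ↦ hA.aemeasurable_inner_apply hX ht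

omit [T2Space M] [SecondCountableTopology M] [IsManifold (𝓡 m) ∞ M] [FiniteDimensional ℝ F]
  [ContMDiffVectorBundle ∞ F V (𝓡 m)] in
theorem MetricSobolev.IsSmoothSection.hasMeasurableCoeffs {s : ∀ x, V x}
    (hs : IsSmoothSection F m s) :
    HasMeasurableCoeffs m F μ s := fun _ ht ↦
  (hs.contMDiff_inner ht).continuous.measurable.aemeasurable

omit [T2Space M] [SecondCountableTopology M] [FiniteDimensional ℝ F] [MeasurableSpace M]
  [BorelSpace M] [ContMDiffVectorBundle ∞ F V (𝓡 m)] [IsContMDiffRiemannianBundle (𝓡 m) ∞ F V] in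
theorem MetricSobolev.IsSmoothSection.apply {A : ∀ x : M, TangentSpace (𝓡 m) x →L[ℝ] V x}
    {X : ∀ x : M, TangentSpace (𝓡 m) x}
    (hA : IsSmoothSection (EuclideanSpace ℝ (Fin m) →L[ℝ] F) m A)
    (hX : IsSmoothSection (EuclideanSpace ℝ (Fin m)) m X) :
    IsSmoothSection F m (fun x ↦ A x (X x)) :=
  ContMDiff.clm_bundle_apply (F₁ := EuclideanSpace ℝ (Fin m)) (F₂ := F)
    (E₁ := fun x : M ↦ TangentSpace (𝓡 m) x) (E₂ := V) (b := fun x ↦ x) hA hX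

omit [T2Space M] [SecondCountableTopology M] [FiniteDimensional ℝ F] in
theorem MetricSobolev.IsSmoothSection.hasMeasurableFormCoeffs
    {A : ∀ x : M, TangentSpace (𝓡 m) x →L[ℝ] V x}
    (hA : IsSmoothSection (EuclideanSpace ℝ (Fin m) →L[ℝ] F) m A) :
    HasMeasurableFormCoeffs m F μ A := fun _ hX ↦ (hA.apply hX).hasMeasurableCoeffs

/-- Near each point `⟨s, t⟩ = ∑ a, ⟨s, E a⟩ ⟨t, E a⟩` for an orthonormal frame of test sections `E
a`, and both factors are measurable by assumption. -/
theorem HasMeasurableCoeffs.aemeasurable_inner {s t : ∀ x, V x} (hs : HasMeasurableCoeffs m F μ s)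
    (ht : HasMeasurableCoeffs m F μ t) : AEMeasurable (fun x ↦ inner ℝ (s x) (t x)) μ := by
  refine aemeasurable_of_forall_exists_nhds fun x₀ ↦ ?_
  obtain ⟨E, hE, hb⟩ := exists_orthonormal_frame (m := m) (F := F) (V := V) x₀
  obtain ⟨U, hU, hUo, hxU⟩ := eventually_nhds_iff.1 hb
  refine ⟨U, hUo.mem_nhds hxU, ?_⟩
  have h1 : AEMeasurable (fun x ↦ ∑ a, inner ℝ (s x) (E a x) * inner ℝ (t x) (E a x)) μ :=
    Finset.aemeasurable_fun_sum _ fun a _ ↦ (hs _ (hE a).1).mul (ht _ (hE a).1)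
  refine h1.restrict.congr ?_
  filter_upwards [ae_restrict_mem hUo.measurableSet] with x hx
  obtain ⟨b, hb⟩ := hU x hx
  rw [← b.sum_inner_mul_inner]
  refine Finset.sum_congr rfl fun a _ ↦ ?_
  rw [hb, real_inner_comm (E a x) (t x)]

theorem HasMeasurableCoeffs.aemeasurable_enorm_sq {s : ∀ x, V x}
    (hs : HasMeasurableCoeffs m F μ s) : AEMeasurable (fun x ↦ ‖s x‖ₑ ^ 2) μ := by
  refine (hs.aemeasurable_inner hs).ennreal_ofReal.congr (Eventually.of_forall fun x ↦ ?_)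
  simp only [real_inner_self_eq_norm_sq]
  rw [ENNReal.ofReal_pow (norm_nonneg _), ofReal_norm]

variable [RiemannianBundle (fun x : M ↦ TangentSpace (𝓡 m) x)]
  [IsContMDiffRiemannianBundle (𝓡 m) ∞ (EuclideanSpace ℝ (Fin m))
    (fun x : M ↦ TangentSpace (𝓡 m) x)]

theorem HasMeasurableFormCoeffs.aemeasurable_homInner
    {A B : ∀ x : M, TangentSpace (𝓡 m) x →L[ℝ] V x} (hA : HasMeasurableFormCoeffs m F μ A)
    (hB : HasMeasurableFormCoeffs m F μ B) : AEMeasurable (fun x ↦ homInner ℝ (A x) (B x)) μ := by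
  refine aemeasurable_of_forall_exists_nhds fun x₀ ↦ ?_
  obtain ⟨Y, hY, hb⟩ := exists_orthonormal_frame (m := m) (F := EuclideanSpace ℝ (Fin m))
    (V := fun x : M ↦ TangentSpace (𝓡 m) x) x₀
  obtain ⟨U, hU, hUo, hxU⟩ := eventually_nhds_iff.1 hb
  refine ⟨U, hUo.mem_nhds hxU, ?_⟩
  have h1 : AEMeasurable (fun x ↦ ∑ i, inner ℝ (A x (Y i x)) (B x (Y i x))) μ :=
    Finset.aemeasurable_fun_sum _ fun a _ ↦
      (hA _ (hY a).1).aemeasurable_inner (hB _ (hY a).1)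
  refine h1.restrict.congr ?_
  filter_upwards [ae_restrict_mem hUo.measurableSet] with x hx
  obtain ⟨b, hb⟩ := hU x hx
  rw [homInner_eq_sum b]
  refine Finset.sum_congr rfl fun a _ ↦ ?_
  rw [hb]

theorem HasMeasurableFormCoeffs.aemeasurable_homNormSq
    {A : ∀ x : M, TangentSpace (𝓡 m) x →L[ℝ] V x} (hA : HasMeasurableFormCoeffs m F μ A) :
    AEMeasurable (fun x ↦ homNormSq (A x)) μ := by
  simp_rw [homNormSq_eq_homInner]
  exact hA.aemeasurable_homInner hA

end

/-! ### Differentials of functions, and calculus with smooth sections. -/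

section Differential

variable {m : ℕ} {M : Type*} [TopologicalSpace M]
  [ChartedSpace (EuclideanSpace ℝ (Fin m)) M]

theorem mvfderiv_comp_of_hasDerivAt {g : M → ℝ} {H : ℝ → ℝ} {H' : ℝ} {x : M}
    (hg : MDifferentiableAt (𝓡 m) 𝓘(ℝ) g x) (hH : HasDerivAt H H' (g x)) :
    mvfderiv (𝓡 m) (fun y ↦ H (g y)) x = H' • mvfderiv (𝓡 m) g x := by
  ext v
  have h := mfderiv_comp_apply (I := 𝓡 m) (I' := 𝓘(ℝ)) (I'' := 𝓘(ℝ)) x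
    (show MDifferentiableAt 𝓘(ℝ) 𝓘(ℝ) H (g x) from hH.differentiableAt.mdifferentiableAt) hg v
  have h1 : mfderiv 𝓘(ℝ) 𝓘(ℝ) H (g x) = fderiv ℝ H (g x) := mfderiv_eq_fderiv
  have h2 : ∀ c : ℝ, mfderiv 𝓘(ℝ) 𝓘(ℝ) H (g x) c = H' * c := fun c ↦ by
    rw [h1, hH.hasFDerivAt.fderiv]
    exact mul_comm (G := ℝ) _ _
  exact h.trans (h2 _)

theorem mvfderiv_congr_of_eventuallyEq {f g : M → ℝ} {x : M} (h : f =ᶠ[𝓝 x] g) :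
    mvfderiv (𝓡 m) f x = mvfderiv (𝓡 m) g x := by
  ext v
  have := h.mfderiv_eq (I := 𝓡 m) (I' := 𝓘(ℝ))
  change mfderiv (𝓡 m) 𝓘(ℝ) f x v = mfderiv (𝓡 m) 𝓘(ℝ) g x v
  exact DFunLike.congr_fun this v

theorem mvfderiv_eq_zero_of_eventuallyEq_const {f : M → ℝ} {c : ℝ} {x : M}
    (h : f =ᶠ[𝓝 x] fun _ ↦ c) : mvfderiv (𝓡 m) f x = 0 := by
  rw [mvfderiv_congr_of_eventuallyEq h]
  exact mvfderiv_const c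

theorem mvfderiv_eq_zero_of_notMem_tsupport {f : M → ℝ} {x : M} (hx : x ∉ tsupport f) :
    mvfderiv (𝓡 m) f x = 0 :=
  mvfderiv_eq_zero_of_eventuallyEq_const (notMem_tsupport_iff_eventuallyEq.1 hx)

variable [IsManifold (𝓡 m) ∞ M]

theorem ContMDiff.contMDiff_mvfderiv_apply {ρ : M → ℝ} (hρ : ContMDiff (𝓡 m) 𝓘(ℝ) ∞ ρ)
    {X : ∀ x : M, TangentSpace (𝓡 m) x} (hX : IsSmoothSection (EuclideanSpace ℝ (Fin m)) m X) :
    ContMDiff (𝓡 m) 𝓘(ℝ) ∞ (fun x ↦ mvfderiv (𝓡 m) ρ x (X x)) := by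
  have h1 := (hρ.contMDiff_tangentMap (m := ∞) le_rfl).comp hX
  exact (contMDiff_snd_tangentBundle_modelSpace ℝ 𝓘(ℝ) (n := ∞)).comp h1

theorem mvfderiv_coordVec {f : M → ℝ} {x₀ x : M} (hf : MDifferentiableAt (𝓡 m) 𝓘(ℝ) f x)
    (hx : x ∈ (chartAt (EuclideanSpace ℝ (Fin m)) x₀).source) (v : EuclideanSpace ℝ (Fin m)) :
    mvfderiv (𝓡 m) f x (coordVec x₀ v x) =
      fderiv ℝ (f ∘ (chartAt (EuclideanSpace ℝ (Fin m)) x₀).symm)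
        (chartAt (EuclideanSpace ℝ (Fin m)) x₀ x) v := by
  set e := chartAt (EuclideanSpace ℝ (Fin m)) x₀
  obtain ⟨y, hy, rfl⟩ : ∃ y ∈ e.target, e.symm y = x := ⟨e x, e.map_source hx, e.left_inv hx⟩
  rw [e.right_inv hy]
  have he : MDifferentiableAt (𝓡 m) (𝓡 m) e.symm y :=
    ((contMDiffOn_chart_symm (n := ∞) (I := 𝓡 m)).contMDiffAt
      (e.open_target.mem_nhds hy)).mdifferentiableAt (by simp)
  have h := mfderiv_comp_apply (I := 𝓡 m) (I' := 𝓡 m) (I'' := 𝓘(ℝ)) y hf he v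
  have h1 := mfderiv_chart_symm_apply (x₀ := x₀) hy v
  have h2 : mfderiv (𝓡 m) 𝓘(ℝ) (f ∘ e.symm) y = fderiv ℝ (f ∘ e.symm) y := mfderiv_eq_fderiv
  have h3 : mfderiv (𝓡 m) 𝓘(ℝ) (f ∘ e.symm) y v = fderiv ℝ (f ∘ e.symm) y v :=
    DFunLike.congr_fun h2 v
  refine Eq.trans ?_ (h.symm.trans h3)
  exact congrArg (mfderiv (𝓡 m) 𝓘(ℝ) f (e.symm y)) h1.symm

end Differential

theorem MetricSobolev.IsSmoothSection.isTestSection {m : ℕ} {M : Type*} [TopologicalSpace M]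
    [T2Space M] [ChartedSpace (EuclideanSpace ℝ (Fin m)) M]
    {F : Type*} [NormedAddCommGroup F] [NormedSpace ℝ F]
    {V : M → Type*} [TopologicalSpace (TotalSpace F V)] [∀ x, TopologicalSpace (V x)]
    [∀ x, Zero (V x)] [FiberBundle F V] {s : ∀ x, V x}
    (hs : IsSmoothSection F m s) {K : Set M} (hK : IsCompact K) (h : ∀ x ∉ K, s x = 0) :
    IsTestSection F m s :=
  ⟨hs, hK.of_isClosed_subset isClosed_closure (closure_minimal
    (fun x hx ↦ by by_contra hxK; exact hx (h x hxK)) hK.isClosed)⟩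

section Sections

variable {m : ℕ} {M : Type*} [TopologicalSpace M]
  [ChartedSpace (EuclideanSpace ℝ (Fin m)) M]
  {F : Type*} [NormedAddCommGroup F] [NormedSpace ℝ F]
  {V : M → Type*} [TopologicalSpace (TotalSpace F V)]
  [∀ x, NormedAddCommGroup (V x)] [∀ x, NormedSpace ℝ (V x)]
  [FiberBundle F V]

theorem MetricSobolev.IsSmoothSection.mdifferentiableAt {s : ∀ x, V x} (hs : IsSmoothSection F m s)
    (x : M) : MDifferentiableAt (𝓡 m) ((𝓡 m).prod 𝓘(ℝ, F)) (fun x ↦ TotalSpace.mk' F x (s x)) x :=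
  (ContMDiff.contMDiffAt hs).mdifferentiableAt (by simp)

variable [VectorBundle ℝ F V]

theorem MetricSobolev.IsSmoothSection.add {s t : ∀ x, V x} (hs : IsSmoothSection F m s)
    (ht : IsSmoothSection F m t) : IsSmoothSection F m (fun x ↦ s x + t x) :=
  ContMDiff.add_section hs ht

theorem MetricSobolev.IsSmoothSection.smul {f : M → ℝ} {s : ∀ x, V x} (hs : IsSmoothSection F m s)
    (hf : ContMDiff (𝓡 m) 𝓘(ℝ) ∞ f) : IsSmoothSection F m (fun x ↦ f x • s x) :=
  ContMDiff.smul_section hf hs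

theorem MetricSobolev.IsSmoothSection.sum {ι : Type*} {t : Finset ι} {s : ι → ∀ x, V x}
    (hs : ∀ i ∈ t, IsSmoothSection F m (s i)) : IsSmoothSection F m (fun x ↦ ∑ i ∈ t, s i x) :=
  ContMDiff.sum_section hs

theorem MetricSobolev.IsTestSection.smul {f : M → ℝ} {s : ∀ x, V x} (hs : IsTestSection F m s)
    (hf : ContMDiff (𝓡 m) 𝓘(ℝ) ∞ f) : IsTestSection F m (fun x ↦ f x • s x) :=
  ⟨hs.1.smul hf, hs.2.of_isClosed_subset isClosed_closure (closure_mono fun x hx h ↦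
    hx (by simp [h]))⟩

theorem MetricSobolev.IsTestSection.add {s t : ∀ x, V x} (hs : IsTestSection F m s)
    (ht : IsTestSection F m t) : IsTestSection F m (fun x ↦ s x + t x) := by
  refine ⟨hs.1.add ht.1, (hs.2.union ht.2).of_isClosed_subset isClosed_closure ?_⟩
  rw [← closure_union]
  refine closure_mono fun x hx ↦ ?_
  by_contra h
  simp only [Set.mem_union, Set.mem_ofPred_eq, not_or, not_not] at h
  exact hx (by simp [h.1, h.2])

theorem MetricSobolev.isTestSection_zero : IsTestSection F m (fun x ↦ (0 : V x)) :=
  ⟨contMDiff_zeroSection ℝ V, by simp⟩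

variable [IsManifold (𝓡 m) ∞ M] [ContMDiffVectorBundle ∞ F V (𝓡 m)]
  {cov : CovariantDerivative (𝓡 m) F V}

theorem cov_add {s t : ∀ x, V x} (hs : IsSmoothSection F m s) (ht : IsSmoothSection F m t) (x : M) :
    cov (fun y ↦ s y + t y) x = cov s x + cov t x :=
  cov.isCovariantDerivativeOnUniv.add (hs.mdifferentiableAt x) (ht.mdifferentiableAt x)

theorem cov_smul {f : M → ℝ} {s : ∀ x, V x} (hs : IsSmoothSection F m s)
    (hf : ContMDiff (𝓡 m) 𝓘(ℝ) ∞ f) (x : M) :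
    cov (fun y ↦ f y • s y) x = f x • cov s x + (mvfderiv (𝓡 m) f x).smulRight (s x) :=
  cov.isCovariantDerivativeOnUniv.leibniz (hs.mdifferentiableAt x)
    (hf.contMDiffAt.mdifferentiableAt (by simp))

theorem cov_sum {ι : Type*} {t : Finset ι} {s : ι → ∀ x, V x}
    (hs : ∀ i, IsSmoothSection F m (s i)) (x : M) :
    cov (fun y ↦ ∑ i ∈ t, s i y) x = ∑ i ∈ t, cov (s i) x := by
  classical
  induction t using Finset.induction_on with
  | empty => simp only [Finset.sum_empty]; exact congrFun cov.zero x
  | insert a t ha ih =>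
    simp_rw [Finset.sum_insert ha]
    rw [cov_add (hs a) (.sum fun i _ ↦ hs i), ih]

theorem cov_congr {s t : ∀ x, V x} (hs : IsSmoothSection F m s) (ht : IsSmoothSection F m t) {x : M}
    (h : ∀ᶠ y in 𝓝 x, s y = t y) : cov s x = cov t x :=
  cov.isCovariantDerivativeOnUniv.congr_of_eventuallyEq (hs.mdifferentiableAt x)
    (ht.mdifferentiableAt x) univ_mem h

theorem cov_eq_zero {s : ∀ x, V x} (hs : IsSmoothSection F m s) {x : M}
    (hx : x ∉ closure {x | s x ≠ 0}) : cov s x = 0 := by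
  rw [cov_congr (t := fun x ↦ 0) hs isTestSection_zero.1]
  · exact congrFun cov.zero x
  · filter_upwards [isClosed_closure.isOpen_compl.mem_nhds hx] with y hy
    by_contra h
    exact hy (subset_closure h)

theorem isSmoothSection_cov (hcov : CovariantDerivative.ContMDiffCovariantDerivative cov ∞)
    {s : ∀ x, V x} (hs : IsSmoothSection F m s) :
    IsSmoothSection (EuclideanSpace ℝ (Fin m) →L[ℝ] F) m (cov s) := by
  have h := hcov.contMDiff.contMDiff (σ := s) (ContMDiff.contMDiffOn hs)
  exact contMDiffOn_univ.1 h

theorem isTestForm_cov [T2Space M] (hcov : CovariantDerivative.ContMDiffCovariantDerivative cov ∞)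
    {s : ∀ x, V x} (hs : IsTestSection F m s) : IsTestForm m F (cov s) :=
  (isSmoothSection_cov hcov hs.1).isTestSection hs.2 fun _ hx ↦ cov_eq_zero hs.1 hx

end Sections

/-! ### Passing functions between the manifold and a chart, extended by zero. -/

section Transport

variable {m : ℕ} {M : Type*} [TopologicalSpace M]
  [ChartedSpace (EuclideanSpace ℝ (Fin m)) M]

variable (m) in
/-- The function `f` in the chart around `x₀`, extended by zero. -/
noncomputable def toChart (x₀ : M) (f : M → ℝ) : EuclideanSpace ℝ (Fin m) → ℝ :=
  (chartAt (EuclideanSpace ℝ (Fin m)) x₀).target.indicator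
    (f ∘ (chartAt (EuclideanSpace ℝ (Fin m)) x₀).symm)

/-- A function of the coordinates around `x₀`, extended by zero. -/
noncomputable def ofChart (x₀ : M) (f : EuclideanSpace ℝ (Fin m) → ℝ) : M → ℝ :=
  (chartAt (EuclideanSpace ℝ (Fin m)) x₀).source.indicator
    (f ∘ (chartAt (EuclideanSpace ℝ (Fin m)) x₀))

theorem toChart_of_mem {x₀ : M} (f : M → ℝ) {y : EuclideanSpace ℝ (Fin m)}
    (hy : y ∈ (chartAt (EuclideanSpace ℝ (Fin m)) x₀).target) :
    toChart m x₀ f y = f ((chartAt (EuclideanSpace ℝ (Fin m)) x₀).symm y) :=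
  Set.indicator_of_mem hy _

theorem ofChart_of_mem {x₀ : M} (f : EuclideanSpace ℝ (Fin m) → ℝ) {x : M}
    (hx : x ∈ (chartAt (EuclideanSpace ℝ (Fin m)) x₀).source) :
    ofChart x₀ f x = f (chartAt (EuclideanSpace ℝ (Fin m)) x₀ x) :=
  Set.indicator_of_mem hx _

theorem isCompact_image_chartAt {x₀ : M} {K : Set M} (hK : IsCompact K)
    (hKS : K ⊆ (chartAt (EuclideanSpace ℝ (Fin m)) x₀).source) :
    IsCompact (chartAt (EuclideanSpace ℝ (Fin m)) x₀ '' K) :=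
  hK.image_of_continuousOn ((chartAt _ x₀).continuousOn.mono hKS)

theorem toChart_eq_zero {x₀ : M} {f : M → ℝ} {K : Set M} (hf : ∀ x ∉ K, f x = 0)
    {y : EuclideanSpace ℝ (Fin m)} (hy : y ∉ chartAt (EuclideanSpace ℝ (Fin m)) x₀ '' K) :
    toChart m x₀ f y = 0 := by
  by_cases h : y ∈ (chartAt (EuclideanSpace ℝ (Fin m)) x₀).target
  · rw [toChart_of_mem f h]
    exact hf _ fun h' ↦ hy ⟨_, h', (chartAt _ x₀).right_inv h⟩
  · exact Set.indicator_of_notMem h _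

theorem tsupport_toChart_subset {x₀ : M} {f : M → ℝ} {K : Set M} (hK : IsCompact K)
    (hKS : K ⊆ (chartAt (EuclideanSpace ℝ (Fin m)) x₀).source) (hf : ∀ x ∉ K, f x = 0) :
    tsupport (toChart m x₀ f) ⊆ chartAt (EuclideanSpace ℝ (Fin m)) x₀ '' K :=
  closure_minimal (fun y hy ↦ by by_contra h; exact hy (toChart_eq_zero hf h))
    (isCompact_image_chartAt hK hKS).isClosed

theorem hasCompactSupport_toChart {x₀ : M} {f : M → ℝ} {K : Set M} (hK : IsCompact K)
    (hKS : K ⊆ (chartAt (EuclideanSpace ℝ (Fin m)) x₀).source) (hf : ∀ x ∉ K, f x = 0) :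
    HasCompactSupport (toChart m x₀ f) :=
  (isCompact_image_chartAt hK hKS).of_isClosed_subset (isClosed_tsupport _)
    (tsupport_toChart_subset hK hKS hf)

theorem toChart_eventuallyEq {x₀ : M} (f : M → ℝ) {y : EuclideanSpace ℝ (Fin m)}
    (hy : y ∈ (chartAt (EuclideanSpace ℝ (Fin m)) x₀).target) :
    toChart m x₀ f =ᶠ[𝓝 y] f ∘ (chartAt (EuclideanSpace ℝ (Fin m)) x₀).symm := by
  filter_upwards [(chartAt _ x₀).open_target.mem_nhds hy] with z hz
  exact toChart_of_mem f hz

theorem ofChart_comp_symm_eventuallyEq {x₀ : M} (f : EuclideanSpace ℝ (Fin m) → ℝ)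
    {y : EuclideanSpace ℝ (Fin m)} (hy : y ∈ (chartAt (EuclideanSpace ℝ (Fin m)) x₀).target) :
    ofChart x₀ f ∘ (chartAt (EuclideanSpace ℝ (Fin m)) x₀).symm =ᶠ[𝓝 y] f := by
  filter_upwards [(chartAt _ x₀).open_target.mem_nhds hy] with z hz
  simp only [Function.comp_apply]
  rw [ofChart_of_mem f ((chartAt _ x₀).map_target hz), (chartAt _ x₀).right_inv hz]

theorem ofChart_eq_zero {x₀ : M} {f : EuclideanSpace ℝ (Fin m) → ℝ} {x : M}
    (hx : x ∉ (chartAt (EuclideanSpace ℝ (Fin m)) x₀).symm '' tsupport f) :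
    ofChart x₀ f x = 0 := by
  by_cases h : x ∈ (chartAt (EuclideanSpace ℝ (Fin m)) x₀).source
  · rw [ofChart_of_mem f h]
    exact image_eq_zero_of_notMem_tsupport fun h' ↦ hx ⟨_, h', (chartAt _ x₀).left_inv h⟩
  · exact Set.indicator_of_notMem h _

variable [IsManifold (𝓡 m) ∞ M]

theorem contDiff_toChart {x₀ : M} {f : M → ℝ} (hf : ContMDiff (𝓡 m) 𝓘(ℝ) ∞ f) {K : Set M}
    (hK : IsCompact K) (hKS : K ⊆ (chartAt (EuclideanSpace ℝ (Fin m)) x₀).source)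
    (hfK : ∀ x ∉ K, f x = 0) : ContDiff ℝ ∞ (toChart m x₀ f) := by
  rw [← contMDiff_iff_contDiff]
  refine contMDiff_of_tsupport fun y hy ↦ ?_
  have hy' : y ∈ (chartAt (EuclideanSpace ℝ (Fin m)) x₀).target := by
    obtain ⟨x, hx, rfl⟩ := tsupport_toChart_subset hK hKS hfK hy
    exact (chartAt _ x₀).map_source (hKS hx)
  have he : ContMDiffAt (𝓡 m) (𝓡 m) ∞ (chartAt (EuclideanSpace ℝ (Fin m)) x₀).symm y :=
    (contMDiffOn_chart_symm (n := ∞) (I := 𝓡 m)).contMDiffAt ((chartAt _ x₀).open_target.mem_nhds hy')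
  exact (hf.contMDiffAt.comp y he).congr_of_eventuallyEq (toChart_eventuallyEq f hy')

/-- Smoothness has to be checked only on the topological support. In a Hausdorff space the image of
the compact support of `f` is closed, so that support stays inside the chart domain. -/
theorem contMDiff_ofChart [T2Space M] {x₀ : M} {f : EuclideanSpace ℝ (Fin m) → ℝ}
    (hf : ContDiff ℝ ∞ f) (hfc : HasCompactSupport f)
    (hfT : tsupport f ⊆ (chartAt (EuclideanSpace ℝ (Fin m)) x₀).target) :
    ContMDiff (𝓡 m) 𝓘(ℝ) ∞ (ofChart x₀ f) := by
  refine contMDiff_of_tsupport fun x hx ↦ ?_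
  have hx' : x ∈ (chartAt (EuclideanSpace ℝ (Fin m)) x₀).source := by
    have h1 : tsupport (ofChart x₀ f) ⊆
        (chartAt (EuclideanSpace ℝ (Fin m)) x₀).symm '' tsupport f :=
      closure_minimal (fun y hy ↦ by by_contra h; exact hy (ofChart_eq_zero h))
        (hfc.isCompact.image_of_continuousOn ((chartAt _ x₀).continuousOn_symm.mono hfT)).isClosed
    obtain ⟨y, hy, rfl⟩ := h1 hx
    exact (chartAt _ x₀).map_target (hfT hy)
  have he : ContMDiffAt (𝓡 m) (𝓡 m) ∞ (chartAt (EuclideanSpace ℝ (Fin m)) x₀) x :=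
    (contMDiffOn_chart (n := ∞) (I := 𝓡 m)).contMDiffAt ((chartAt _ x₀).open_source.mem_nhds hx')
  refine (hf.contMDiff.contMDiffAt.comp x he).congr_of_eventuallyEq ?_
  filter_upwards [(chartAt _ x₀).open_source.mem_nhds hx'] with z hz
  exact ofChart_of_mem f hz

theorem mvfderiv_ofChart_coordVec [T2Space M] {x₀ x : M} {f : EuclideanSpace ℝ (Fin m) → ℝ}
    (hf : ContDiff ℝ ∞ f) (hfc : HasCompactSupport f)
    (hfT : tsupport f ⊆ (chartAt (EuclideanSpace ℝ (Fin m)) x₀).target)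
    (hx : x ∈ (chartAt (EuclideanSpace ℝ (Fin m)) x₀).source) (v : EuclideanSpace ℝ (Fin m)) :
    mvfderiv (𝓡 m) (ofChart x₀ f) x (coordVec x₀ v x) =
      fderiv ℝ f (chartAt (EuclideanSpace ℝ (Fin m)) x₀ x) v := by
  rw [mvfderiv_coordVec ((contMDiff_ofChart hf hfc hfT).contMDiffAt.mdifferentiableAt (by simp)) hx]
  exact congrArg (fun L : EuclideanSpace ℝ (Fin m) →L[ℝ] ℝ ↦ L v) (Filter.EventuallyEq.fderiv_eq
    (ofChart_comp_symm_eventuallyEq f ((chartAt _ x₀).map_source hx)))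

end Transport

/-! ### Integration against Lebesgue measure and Riemannian measure in a chart. -/

section Integration

variable {m : ℕ} {M : Type*} [TopologicalSpace M]
  [ChartedSpace (EuclideanSpace ℝ (Fin m)) M] [MeasurableSpace M] [BorelSpace M]

theorem lintegral_coordMeasure {x₀ : M} {g : M → ℝ≥0∞} (hg : AEMeasurable g (coordMeasure m x₀)) :
    ∫⁻ x, g x ∂(coordMeasure m x₀) = ∫⁻ y in (chartAt (EuclideanSpace ℝ (Fin m)) x₀).target,
      g ((chartAt (EuclideanSpace ℝ (Fin m)) x₀).symm y) :=
  lintegral_map' hg (aemeasurable_chartAt_symm x₀)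

theorem integral_coordMeasure {x₀ : M} {g : M → ℝ} (hg : AEMeasurable g (coordMeasure m x₀)) :
    ∫ x, g x ∂(coordMeasure m x₀) = ∫ y, toChart m x₀ g y := by
  rw [coordMeasure, integral_map (aemeasurable_chartAt_symm x₀) hg.aestronglyMeasurable]
  exact (integral_indicator (chartAt _ x₀).open_target.measurableSet).symm

theorem aemeasurable_toChart {x₀ : M} {g : M → ℝ} (hg : AEMeasurable g (coordMeasure m x₀)) :
    AEMeasurable (toChart m x₀ g) :=
  (aemeasurable_indicator_iff (chartAt _ x₀).open_target.measurableSet).2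
    (hg.comp_aemeasurable (aemeasurable_chartAt_symm x₀))

theorem ae_coordMeasure_mem_source (x₀ : M) : ∀ᵐ x ∂(coordMeasure m x₀),
    x ∈ (chartAt (EuclideanSpace ℝ (Fin m)) x₀).source := by
  rw [← coordMeasure_restrict_source]
  exact ae_restrict_mem (chartAt _ x₀).open_source.measurableSet

theorem lintegral_toChart_sq {x₀ : M} {g : M → ℝ} (hg : AEMeasurable g (coordMeasure m x₀)) :
    ∫⁻ y, ‖toChart m x₀ g y‖ₑ ^ 2 = ∫⁻ x, ‖g x‖ₑ ^ 2 ∂(coordMeasure m x₀) := by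
  rw [lintegral_coordMeasure (hg.enorm.pow_const 2),
    ← lintegral_indicator (chartAt _ x₀).open_target.measurableSet]
  refine lintegral_congr fun y ↦ ?_
  by_cases h : y ∈ (chartAt (EuclideanSpace ℝ (Fin m)) x₀).target <;> simp [toChart, h]

variable [IsManifold (𝓡 m) ∞ M]

/-- Integration by parts against the constant `1`: a partial derivative of a compactly supported
function has integral zero. The separate continuous function `h` supplies measurability on all of
`M`, where `coordVec` is controlled only over the chart domain. -/
theorem integral_mvfderiv_coordVec_eq_zero {x₀ : M} {f : M → ℝ} (hf : ContMDiff (𝓡 m) 𝓘(ℝ) ∞ f)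
    {K : Set M} (hK : IsCompact K) (hKS : K ⊆ (chartAt (EuclideanSpace ℝ (Fin m)) x₀).source)
    (hfK : ∀ x ∉ K, f x = 0) (v : EuclideanSpace ℝ (Fin m)) {h : M → ℝ} (hh : Continuous h)
    (hfh : ∀ x ∈ (chartAt (EuclideanSpace ℝ (Fin m)) x₀).source,
      h x = mvfderiv (𝓡 m) f x (coordVec x₀ v x)) :
    ∫ x, h x ∂(coordMeasure m x₀) = 0 := by
  rw [integral_coordMeasure hh.aemeasurable]
  have h1 : ∀ y, toChart m x₀ h y = fderiv ℝ (toChart m x₀ f) y v := by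
    intro y
    by_cases hy : y ∈ (chartAt (EuclideanSpace ℝ (Fin m)) x₀).target
    · rw [toChart_of_mem h hy, hfh _ ((chartAt _ x₀).map_target hy),
        mvfderiv_coordVec (hf.contMDiffAt.mdifferentiableAt (by simp))
          ((chartAt _ x₀).map_target hy), (chartAt _ x₀).right_inv hy]
      exact congrArg (fun L : EuclideanSpace ℝ (Fin m) →L[ℝ] ℝ ↦ L v) (toChart_eventuallyEq f hy).symm.fderiv_eq
    · have h2 : y ∉ tsupport (toChart m x₀ f) := fun h2 ↦ by
        obtain ⟨x, hx, rfl⟩ := tsupport_toChart_subset hK hKS hfK h2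
        exact hy ((chartAt _ x₀).map_source (hKS hx))
      rw [fderiv_of_notMem_tsupport ℝ h2]
      exact Set.indicator_of_notMem hy _
  simp_rw [h1]
  have hc := hasCompactSupport_toChart hK hKS hfK
  have hd := contDiff_toChart hf hK hKS hfK
  have h3 := integral_mul_fderiv_eq_neg_fderiv_mul_of_integrable (μ := volume)
    (f := fun _ : EuclideanSpace ℝ (Fin m) ↦ (1 : ℝ)) (g := toChart m x₀ f) (v := v) (by simp)
    (by
      simp only [one_mul]
      exact ((hd.continuous_fderiv (by simp)).clm_apply continuous_const).integrable_of_hasCompactSupport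
        (hc.fderiv_apply ℝ v))
    (by
      simp only [one_mul]
      exact hd.continuous.integrable_of_hasCompactSupport hc) (by simp)
    (fun _ _ ↦ hd.differentiable (by simp) _)
  simpa using h3

theorem integrable_coordMeasure [T2Space M] {x₀ : M} {h : M → ℝ} (hh : Continuous h) {K : Set M}
    (hK : IsCompact K) (hKS : K ⊆ (chartAt (EuclideanSpace ℝ (Fin m)) x₀).source)
    (hhK : ∀ x ∉ K, h x = 0) : Integrable h (coordMeasure m x₀) := by
  have h1 : ContinuousOn h K := hh.continuousOn
  obtain ⟨C, hC⟩ := hK.exists_bound_of_continuousOn h1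
  -- Off `K` the function vanishes, while `C` might be negative if `K` is empty.
  have h2 : ∀ y, ‖h y‖ ≤ max C 0 := fun y ↦ by
    by_cases hy : y ∈ K
    · exact (hC y hy).trans (le_max_left _ _)
    · simp [hhK y hy]
  have hKm := hK.measurableSet
  refine (integrableOn_iff_integrable_of_support_subset (s := K) fun x hx ↦ ?_).1 ?_
  · by_contra hxK
    exact hx (hhK x hxK)
  · refine Measure.integrableOn_of_bounded (M := max C 0) ?_ hh.aestronglyMeasurable
      (Eventually.of_forall h2)
    rw [coordMeasure, Measure.map_apply_of_aemeasurable (aemeasurable_chartAt_symm x₀) hKm,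
      Measure.restrict_apply' (chartAt _ x₀).open_target.measurableSet]
    refine ((isCompact_image_chartAt hK hKS).measure_lt_top.trans_le' (measure_mono ?_)).ne
    rintro y ⟨hy, hyT⟩
    exact ⟨_, hy, (chartAt _ x₀).right_inv hyT⟩

end Integration

section DensityIntegration

variable {m : ℕ} {M : Type*} [TopologicalSpace M] [T2Space M] [SecondCountableTopology M]
  [ChartedSpace (EuclideanSpace ℝ (Fin m)) M] [IsManifold (𝓡 m) ∞ M]
  [MeasurableSpace M] [BorelSpace M] [RiemannianBundle (fun x : M ↦ TangentSpace (𝓡 m) x)]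
  [IsContMDiffRiemannianBundle (𝓡 m) ∞ (EuclideanSpace ℝ (Fin m))
    (fun x : M ↦ TangentSpace (𝓡 m) x)]

theorem aemeasurable_chartDensity (x₀ : M) :
    AEMeasurable (chartDensity m x₀) (coordMeasure m x₀) := by
  rw [← coordMeasure_restrict_source]
  exact (contMDiffOn_chartDensity x₀).continuousOn.aemeasurable
    (chartAt (EuclideanSpace ℝ (Fin m)) x₀).open_source.measurableSet

/-- The density is positive on the chart domain, which carries `coordMeasure`. Null sets and a.e.
measurability thus pass from the Riemannian measure to the coordinates. -/
theorem coordMeasure_absolutelyContinuous (x₀ : M) :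
    coordMeasure m x₀ ≪ riemannianMeasure m M := by
  refine (withDensity_absolutelyContinuous' (aemeasurable_chartDensity x₀).ennreal_ofReal ?_).trans
    ((riemannianMeasure_restrict_source (m := m) x₀) ▸ Measure.restrict_le_self.absolutelyContinuous)
  filter_upwards [ae_coordMeasure_mem_source (m := m) x₀] with x hx
  simpa using chartDensity_pos hx

theorem lintegral_riemannianMeasure_eq {x₀ : M} {g : M → ℝ≥0∞}
    (hgS : ∀ x ∉ (chartAt (EuclideanSpace ℝ (Fin m)) x₀).source, g x = 0) :
    ∫⁻ x, g x ∂(riemannianMeasure m M) =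
      ∫⁻ x, ENNReal.ofReal (chartDensity m x₀ x) * g x ∂(coordMeasure m x₀) := by
  have h1 : ∫⁻ x in (chartAt (EuclideanSpace ℝ (Fin m)) x₀).source, g x ∂(riemannianMeasure m M) =
      ∫⁻ x, g x ∂(riemannianMeasure m M) :=
    setLIntegral_eq_of_support_subset fun x hx ↦ by by_contra h; exact hx (hgS x h)
  rw [← h1, riemannianMeasure_restrict_source]
  have hD := (aemeasurable_chartDensity (m := m) x₀).ennreal_ofReal
  rw [lintegral_withDensity_eq_lintegral_mul_non_measurable₀ _ hD (Eventually.of_forall (by simp))]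
  rfl

theorem integral_riemannianMeasure_eq {x₀ : M} {g : M → ℝ}
    (hgS : ∀ x ∉ (chartAt (EuclideanSpace ℝ (Fin m)) x₀).source, g x = 0) :
    ∫ x, g x ∂(riemannianMeasure m M) =
      ∫ x, chartDensity m x₀ x * g x ∂(coordMeasure m x₀) := by
  rw [← setIntegral_eq_integral_of_forall_compl_eq_zero hgS, riemannianMeasure_restrict_source]
  have hD := (aemeasurable_chartDensity (m := m) x₀).ennreal_ofReal
  rw [integral_withDensity_eq_integral_toReal_smul₀ hD (Eventually.of_forall (by simp))]
  refine integral_congr_ae (Eventually.of_forall fun x ↦ ?_)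
  simp [ENNReal.toReal_ofReal (Real.sqrt_nonneg _), chartDensity]

end DensityIntegration

/-! ### The weak equation along a coordinate vector field. -/

section WeakIdentity

variable {m : ℕ} {M : Type*} [TopologicalSpace M] [T2Space M] [SecondCountableTopology M]
  [ChartedSpace (EuclideanSpace ℝ (Fin m)) M] [IsManifold (𝓡 m) ∞ M]
  [RiemannianBundle (fun x : M ↦ TangentSpace (𝓡 m) x)]
  [IsContMDiffRiemannianBundle (𝓡 m) ∞ (EuclideanSpace ℝ (Fin m))
    (fun x : M ↦ TangentSpace (𝓡 m) x)]
  {F : Type*} [NormedAddCommGroup F] [NormedSpace ℝ F]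
  {V : M → Type*} [TopologicalSpace (TotalSpace F V)]
  [∀ x, NormedAddCommGroup (V x)] [∀ x, InnerProductSpace ℝ (V x)]
  [FiberBundle F V] [VectorBundle ℝ F V] [ContMDiffVectorBundle ∞ F V (𝓡 m)]
  [IsContMDiffRiemannianBundle (𝓡 m) ∞ F V]

theorem MetricSobolev.IsSmoothSection.innerSL_smulRight {X : ∀ x : M, TangentSpace (𝓡 m) x}
    (hX : IsSmoothSection (EuclideanSpace ℝ (Fin m)) m X) {t : ∀ x, V x}
    (ht : IsSmoothSection F m t) :
    IsSmoothSection (EuclideanSpace ℝ (Fin m) →L[ℝ] F) m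
      (fun x ↦ ((innerSL ℝ (X x)).smulRight (t x) : TangentSpace (𝓡 m) x →L[ℝ] V x)) := by
  intro x₁
  refine contMDiffAt_hom_of_apply_symm _ x₁ fun v ↦ ?_
  have h1 := contMDiffAt_trivializationAt_symm (I := 𝓡 m) (n := ∞) (F₁ := EuclideanSpace ℝ (Fin m))
    (E₁ := fun x : M ↦ TangentSpace (𝓡 m) x) x₁ v
  have h2 := ContMDiffAt.inner_bundle (F := EuclideanSpace ℝ (Fin m))
    (E := fun x : M ↦ TangentSpace (𝓡 m) x) (b := fun x ↦ x) (ContMDiff.contMDiffAt hX) h1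
  exact ContMDiffAt.smul_section h2 (ContMDiff.contMDiffAt ht)

variable [MeasurableSpace M] [BorelSpace M] {cov : CovariantDerivative (𝓡 m) F V}

/-- Metric compatibility makes the sum of the two integrands the derivative of `⟨u, t⟩` along a
coordinate field. With Lebesgue measure in place of the Riemannian one, no divergence of `X`
appears. -/
theorem integral_inner_cov_add_eq_zero (hcov : IsMetricConnection ℝ m F cov) {x₀ : M}
    {X : ∀ x : M, TangentSpace (𝓡 m) x} (hX : IsSmoothSection (EuclideanSpace ℝ (Fin m)) m X)
    {v : EuclideanSpace ℝ (Fin m)} {U K : Set M}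
    (hUS : U ⊆ (chartAt (EuclideanSpace ℝ (Fin m)) x₀).source)
    (hXU : ∀ x ∈ U, X x = coordVec x₀ v x) (hK : IsCompact K) (hKU : K ⊆ U)
    {u t : ∀ x, V x} (hu : IsSmoothSection F m u) (ht : IsSmoothSection F m t)
    (htK : ∀ x ∉ K, t x = 0) :
    ∫ x, inner ℝ (u x) (cov t x (X x)) ∂(coordMeasure m x₀) =
      - ∫ x, inner ℝ (cov u x (X x)) (t x) ∂(coordMeasure m x₀) := by
  have htK' : ∀ x ∉ K, cov t x = 0 := fun x hx ↦
    cov_eq_zero ht fun h ↦ hx (closure_minimal (fun y hy ↦ by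
      by_contra h; exact hy (htK y h)) hK.isClosed h)
  have hf1 := (hu.contMDiff_inner ((isSmoothSection_cov hcov.smooth ht).apply hX)).continuous
  have hf2 := (((isSmoothSection_cov hcov.smooth hu).apply hX).contMDiff_inner ht).continuous
  have hi1 := integrable_coordMeasure (x₀ := x₀) hf1 hK (hKU.trans hUS) fun x hx ↦ by
    simp [htK' x hx]
  have hi2 := integrable_coordMeasure (x₀ := x₀) hf2 hK (hKU.trans hUS) fun x hx ↦ by
    simp [htK x hx]
  rw [eq_neg_iff_add_eq_zero, ← integral_add hi1 hi2]
  refine integral_mvfderiv_coordVec_eq_zero (hu.contMDiff_inner ht) hK (hKU.trans hUS)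
    (fun x hx ↦ by simp [htK x hx]) v (hf1.add hf2) fun x hx ↦ ?_
  rw [hcov.metric u t hu ht, add_comm]
  by_cases hxK : x ∈ K
  · rw [hXU x (hKU hxK)]
  · simp [htK' x hxK, htK x hxK]

/-- The weak equation is tested with `φ = X♭ ⊗ δ t`. Since `δ` is the inverse density on `U`,
Riemannian integrals turn into Lebesgue integrals, and by the preceding integration by parts the
formal adjoint of `φ` is simply `-δ ∇_X t`. -/
theorem integral_coordMeasure_inner_eq_neg (hcov : IsMetricConnection ℝ m F cov)
    {s : ∀ x, V x} {w : ∀ x : M, TangentSpace (𝓡 m) x →L[ℝ] V x}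
    (hsw : ∀ φ ψ, IsFormalAdjoint ℝ m F cov φ ψ →
      ∫ x, (inner ℝ (s x) (ψ x) : ℝ) ∂(riemannianMeasure m M) =
        ∫ x, homInner ℝ (w x) (φ x) ∂(riemannianMeasure m M)) {x₀ : M}
    {X : ∀ x : M, TangentSpace (𝓡 m) x} (hX : IsSmoothSection (EuclideanSpace ℝ (Fin m)) m X)
    {δ : M → ℝ} (hδ : ContMDiff (𝓡 m) 𝓘(ℝ) ∞ δ)
    {v : EuclideanSpace ℝ (Fin m)} {U K : Set M}
    (hUS : U ⊆ (chartAt (EuclideanSpace ℝ (Fin m)) x₀).source)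
    (hXU : ∀ x ∈ U, X x = coordVec x₀ v x) (hδU : ∀ x ∈ U, chartDensity m x₀ x * δ x = 1)
    (hK : IsCompact K) (hKU : K ⊆ U) {t : ∀ x, V x} (ht : IsSmoothSection F m t)
    (htK : ∀ x ∉ K, t x = 0) :
    ∫ x, inner ℝ (s x) (cov t x (X x)) ∂(coordMeasure m x₀) =
      - ∫ x, inner ℝ (w x (X x)) (t x) ∂(coordMeasure m x₀) := by
  have htK' : ∀ x ∉ K, cov t x = 0 := fun x hx ↦
    cov_eq_zero ht fun h ↦ hx (closure_minimal (fun y hy ↦ by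
      by_contra h; exact hy (htK y h)) hK.isClosed h)
  set φ : ∀ x : M, TangentSpace (𝓡 m) x →L[ℝ] V x :=
    fun x ↦ (innerSL ℝ (X x)).smulRight (δ x • t x) with hφ
  set ψ : ∀ x, V x := fun x ↦ (-δ x) • cov t x (X x) with hψ
  have key : ∀ (z : ∀ x, V x), ∫ x, inner ℝ (z x) (ψ x) ∂(riemannianMeasure m M) =
      - ∫ x, inner ℝ (z x) (cov t x (X x)) ∂(coordMeasure m x₀) := fun z ↦ by
    rw [integral_riemannianMeasure_eq (x₀ := x₀), ← integral_neg]
    · refine integral_congr_ae (Eventually.of_forall fun x ↦ ?_)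
      by_cases hx : x ∈ K
      · simp only [hψ, real_inner_smul_right]
        linear_combination (-inner ℝ (z x) (cov t x (X x))) * hδU x (hKU hx)
      · simp [hψ, htK' x hx]
    · intro x hx
      simp [hψ, htK' x fun h ↦ hx (hUS (hKU h))]
  have key2 : ∀ (A : ∀ x : M, TangentSpace (𝓡 m) x →L[ℝ] V x),
      ∫ x, homInner ℝ (A x) (φ x) ∂(riemannianMeasure m M) =
      ∫ x, inner ℝ (A x (X x)) (t x) ∂(coordMeasure m x₀) := fun A ↦ by
    simp only [hφ, homInner_smulRight]
    rw [integral_riemannianMeasure_eq (x₀ := x₀)]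
    · refine integral_congr_ae (Eventually.of_forall fun x ↦ ?_)
      by_cases hx : x ∈ K
      · simp only [real_inner_smul_right]
        linear_combination (inner ℝ (A x (X x)) (t x)) * hδU x (hKU hx)
      · simp [htK x hx]
    · intro x hx
      simp [htK x fun h ↦ hx (hUS (hKU h))]
  have hadj : IsFormalAdjoint ℝ m F cov φ ψ := by
    refine ⟨(hX.innerSL_smulRight (ht.smul hδ)).isTestSection hK fun x hx ↦ ?_,
      (((isSmoothSection_cov hcov.smooth ht).apply hX).smul hδ.neg).isTestSection hK
        fun x hx ↦ ?_, fun u hu ↦ ?_⟩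
    · ext; simp [hφ, htK x hx]
    · simp [htK' x hx]
    · rw [key, key2, integral_inner_cov_add_eq_zero hcov hX hUS hXU hK hKU hu.1 ht htK, neg_neg]
  have h := hsw φ ψ hadj
  rw [key, key2] at h
  rw [← h, neg_neg]

end WeakIdentity

/-! ### Frames adapted to a chart, with uniform bounds. -/

section LocalFrame

variable {m : ℕ} {M : Type*} [TopologicalSpace M] [T2Space M] [SecondCountableTopology M]
  [ChartedSpace (EuclideanSpace ℝ (Fin m)) M] [IsManifold (𝓡 m) ∞ M]
  [RiemannianBundle (fun x : M ↦ TangentSpace (𝓡 m) x)]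
  [IsContMDiffRiemannianBundle (𝓡 m) ∞ (EuclideanSpace ℝ (Fin m))
    (fun x : M ↦ TangentSpace (𝓡 m) x)]
  {F : Type*} [NormedAddCommGroup F] [NormedSpace ℝ F] [FiniteDimensional ℝ F]
  {V : M → Type*} [TopologicalSpace (TotalSpace F V)]
  [∀ x, NormedAddCommGroup (V x)] [∀ x, InnerProductSpace ℝ (V x)]
  [FiberBundle F V] [VectorBundle ℝ F V] [ContMDiffVectorBundle ∞ F V (𝓡 m)]
  [IsContMDiffRiemannianBundle (𝓡 m) ∞ F V]

/-- Smooth sections and vector fields that form, on the neighbourhood `U` of `x₀`, an orthonormal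
frame of `V` and the coordinate frame of the chart around `x₀`, with bounds by `C`. -/
structure IsAdaptedFrame (cov : CovariantDerivative (𝓡 m) F V) (x₀ : M) (U : Set M)
    (E : Fin (Module.finrank ℝ F) → ∀ x, V x) (X : Fin m → ∀ x : M, TangentSpace (𝓡 m) x)
    (δ : M → ℝ) (C : ℝ) : Prop where
  isOpen : IsOpen U
  mem : x₀ ∈ U
  subset_source : U ⊆ (chartAt (EuclideanSpace ℝ (Fin m)) x₀).source
  isTestSection (a) : IsTestSection F m (E a)
  orthonormalBasis (x) (hx : x ∈ U) :
    ∃ b : OrthonormalBasis (Fin (Module.finrank ℝ F)) ℝ (V x), ∀ a, b a = E a x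
  isSmoothSection (k) : IsSmoothSection (EuclideanSpace ℝ (Fin m)) m (X k)
  eq_coordVec (k x) (hx : x ∈ U) : X k x = coordVec x₀ (EuclideanSpace.single k 1) x
  contMDiff : ContMDiff (𝓡 m) 𝓘(ℝ) ∞ δ
  density_mul (x) (hx : x ∈ U) : chartDensity m x₀ x * δ x = 1
  nonneg : 0 ≤ C
  density_le (x) (hx : x ∈ U) : chartDensity m x₀ x ≤ C
  le_bound (x) (hx : x ∈ U) : δ x ≤ C
  norm_field_sq_le (k x) (hx : x ∈ U) : ‖X k x‖ ^ 2 ≤ C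
  norm_cov_sq_le (a k x) (hx : x ∈ U) : ‖cov (E a) x (X k x)‖ ^ 2 ≤ C
  homNormSq_le (x) (hx : x ∈ U) (A : TangentSpace (𝓡 m) x →L[ℝ] V x) :
    homNormSq A ≤ C * ∑ k, ‖A (X k x)‖ ^ 2

theorem homNormSq_le_sum_of_eq_sum {T W : Type*} [NormedAddCommGroup T] [InnerProductSpace ℝ T]
    [FiniteDimensional ℝ T] [NormedAddCommGroup W] [InnerProductSpace ℝ W] {ι κ : Type*} [Fintype ι]
    [Fintype κ] (b : OrthonormalBasis ι ℝ T) (X : κ → T) (c : ι → κ → ℝ)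
    (h : ∀ i, b i = ∑ k, c i k • X k) (A : T →L[ℝ] W) :
    homNormSq A ≤ (∑ i, ∑ k, c i k ^ 2) * ∑ k, ‖A (X k)‖ ^ 2 := by
  rw [homNormSq_eq_sum b, Finset.sum_mul]
  refine Finset.sum_le_sum fun i _ ↦ ?_
  have h1 : ‖A (b i)‖ ≤ ∑ k, |c i k| * ‖A (X k)‖ := by
    rw [h i, map_sum]
    refine (norm_sum_le _ _).trans (Finset.sum_le_sum fun k _ ↦ ?_)
    rw [map_smul, norm_smul, Real.norm_eq_abs]
  calc ‖A (b i)‖ ^ 2 ≤ (∑ k, |c i k| * ‖A (X k)‖) ^ 2 := by gcongr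
    _ ≤ (∑ k, |c i k| ^ 2) * ∑ k, ‖A (X k)‖ ^ 2 := Finset.sum_mul_sq_le_sq_mul_sq _ _ _
    _ = _ := by simp

theorem MetricSobolev.IsSmoothSection.eventually_norm_sq_le {s : ∀ x, V x}
    (hs : IsSmoothSection F m s) (x₀ : M) : ∀ᶠ x in 𝓝 x₀, ‖s x‖ ^ 2 ≤ ‖s x₀‖ ^ 2 + 1 := by
  have h := (hs.contMDiff_inner hs).continuous
  simp only [real_inner_self_eq_norm_sq] at h
  exact (h.tendsto x₀).eventually_le_const (lt_add_one _)

theorem exists_contMDiff_chartDensity_mul_eq_one (x₀ : M) :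
    ∃ δ : M → ℝ, ContMDiff (𝓡 m) 𝓘(ℝ) ∞ δ ∧ ∀ᶠ x in 𝓝 x₀, chartDensity m x₀ x * δ x = 1 := by
  have hS := (chartAt (EuclideanSpace ℝ (Fin m)) x₀).open_source
  have hx₀ := mem_chart_source (EuclideanSpace ℝ (Fin m)) x₀
  obtain ⟨f, -, hf⟩ := (SmoothBumpFunction.nhds_basis_tsupport (I := 𝓡 m) x₀).mem_iff.1
    (hS.mem_nhds hx₀)
  refine ⟨fun x ↦ f x * (chartDensity m x₀ x)⁻¹, ?_, ?_⟩
  · refine contMDiff_of_tsupport fun x hx ↦ ?_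
    have hxS := hf (tsupport_mul_subset_left hx)
    have h1 := (contMDiffOn_chartDensity (m := m) x₀).contMDiffAt (hS.mem_nhds hxS)
    exact f.contMDiffAt.mul (ContMDiffAt.inv₀ h1 (chartDensity_pos hxS).ne')
  · filter_upwards [f.eventuallyEq_one, hS.mem_nhds hx₀] with x hx hxS
    rw [hx]
    have := (chartDensity_pos hxS).ne'
    simp [this]

/-- A smooth orthonormal frame has continuous, hence locally bounded, coefficients in the coordinate
frame, and Cauchy–Schwarz turns this bound into the constant. -/
theorem exists_homNormSq_le_sum_coordVec (x₀ : M) : ∃ C : ℝ, ∀ᶠ x in 𝓝 x₀,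
    ∀ A : TangentSpace (𝓡 m) x →L[ℝ] V x,
      homNormSq A ≤ C * ∑ k, ‖A (coordVec x₀ (EuclideanSpace.single k 1) x)‖ ^ 2 := by
  obtain ⟨Y, hY, hb⟩ := exists_orthonormal_frame (m := m) (F := EuclideanSpace ℝ (Fin m))
    (V := fun x : M ↦ TangentSpace (𝓡 m) x) x₀
  set e := trivializationAt (EuclideanSpace ℝ (Fin m)) (TangentSpace (𝓡 m) (M := M)) x₀ with he
  have hx₀ : x₀ ∈ e.baseSet := mem_baseSet_trivializationAt _ _ x₀
  set c : M → Fin (Module.finrank ℝ (EuclideanSpace ℝ (Fin m))) → Fin m → ℝ :=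
    fun x i k ↦ (e ⟨x, Y i x⟩).2 k with hc
  have hcc : ContinuousOn (fun x ↦ ∑ i, ∑ k, c x i k ^ 2) e.baseSet := by
    refine continuousOn_finsetSum _ fun i _ ↦ continuousOn_finsetSum _ fun k _ ↦ ?_
    have h2 : ContinuousOn (fun x ↦ (e ⟨x, Y i x⟩).2) e.baseSet :=
      ((e.contMDiffOn_section_baseSet_iff (IB := 𝓡 m) (n := ∞)).1
        (ContMDiff.contMDiffOn (hY i).1)).continuousOn
    exact ((EuclideanSpace.proj (𝕜 := ℝ) k).continuous.comp_continuousOn h2).pow 2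
  refine ⟨∑ i, ∑ k, c x₀ i k ^ 2 + 1, ?_⟩
  filter_upwards [hb, e.open_baseSet.mem_nhds hx₀,
    (hcc.continuousAt (e.open_baseSet.mem_nhds hx₀)).eventually_le_const (lt_add_one _)]
    with x ⟨b, hbx⟩ hx hle A
  refine (homNormSq_le_sum_of_eq_sum b
    (fun k ↦ coordVec x₀ (EuclideanSpace.single k 1) x) (c x) (fun i ↦ ?_) A).trans ?_
  · have h1 : e.symmL ℝ x (e ⟨x, Y i x⟩).2 = Y i x := by
      rw [e.symmL_apply hx]
      exact e.symm_apply_apply_mk hx (Y i x)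
    rw [hbx, ← h1]
    have h2 : (e ⟨x, Y i x⟩).2 = ∑ k, c x i k • EuclideanSpace.single k (1 : ℝ) := by
      conv_lhs => rw [← (EuclideanSpace.basisFun (Fin m) ℝ).sum_repr (e ⟨x, Y i x⟩).2]
      simp [hc]
    rw [h1]
    conv_lhs => rw [← h1, h2, map_sum]
    refine Finset.sum_congr rfl fun k _ ↦ ?_
    exact map_smul _ _ _
  · exact mul_le_mul_of_nonneg_right hle (Finset.sum_nonneg fun _ _ ↦ by positivity)

theorem exists_isAdaptedFrame {cov : CovariantDerivative (𝓡 m) F V}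
    (hcov : IsMetricConnection ℝ m F cov) (x₀ : M) :
    ∃ U E X δ C, IsAdaptedFrame cov x₀ U E X δ C := by
  have hS := (chartAt (EuclideanSpace ℝ (Fin m)) x₀).open_source
  have hx₀ := mem_chart_source (EuclideanSpace ℝ (Fin m)) x₀
  obtain ⟨E, hE, hE'⟩ := exists_orthonormal_frame (m := m) (F := F) (V := V) x₀
  have h1 := fun k : Fin m ↦ exists_isTestSection_eventuallyEq (m := m)
    (F := EuclideanSpace ℝ (Fin m)) (V := fun x : M ↦ TangentSpace (𝓡 m) x) hS hx₀
    (contMDiffOn_coordVec x₀ (EuclideanSpace.single k 1))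
  choose X hX hX' using h1
  obtain ⟨δ, hδ, hδ'⟩ := exists_contMDiff_chartDensity_mul_eq_one (m := m) x₀
  obtain ⟨C₁, hC₁⟩ := exists_homNormSq_le_sum_coordVec (m := m) (V := V) x₀
  have hD := ((contMDiffOn_chartDensity (m := m) x₀).continuousOn.continuousAt
    (hS.mem_nhds hx₀)).eventually_le_const (lt_add_one _)
  have hδb := (hδ.continuous.tendsto x₀).eventually_le_const (lt_add_one _)
  have hXb := fun k ↦ IsSmoothSection.eventually_norm_sq_le (F := EuclideanSpace ℝ (Fin m))
    (V := fun x : M ↦ TangentSpace (𝓡 m) x) (hX k).1 x₀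
  have hcb := fun a k ↦
    ((isSmoothSection_cov hcov.smooth (hE a).1).apply (hX k).1).eventually_norm_sq_le x₀
  -- One constant beyond all values at `x₀` plus one; by continuity the bounds persist on a common
  -- neighbourhood.
  obtain ⟨C, hC⟩ : ∃ C : ℝ, 0 ≤ C ∧ C₁ ≤ C ∧ chartDensity m x₀ x₀ + 1 ≤ C ∧ δ x₀ + 1 ≤ C ∧
      (∀ k, ‖X k x₀‖ ^ 2 + 1 ≤ C) ∧ ∀ a k, ‖cov (E a) x₀ (X k x₀)‖ ^ 2 + 1 ≤ C := by
    have h1 : ∀ᶠ C in atTop, ∀ k, ‖X k x₀‖ ^ 2 + 1 ≤ C :=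
      eventually_all.2 fun _ ↦ eventually_ge_atTop _
    have h2 : ∀ᶠ C in atTop, ∀ a k, ‖cov (E a) x₀ (X k x₀)‖ ^ 2 + 1 ≤ C :=
      eventually_all.2 fun _ ↦ eventually_all.2 fun _ ↦ eventually_ge_atTop _
    exact ((eventually_ge_atTop 0).and ((eventually_ge_atTop _).and ((eventually_ge_atTop _).and
      ((eventually_ge_atTop _).and (h1.and h2))))).exists
  obtain ⟨hC0, hCC, hCD, hCδ, hCX, hCc⟩ := hC
  have hall := (hS.eventually_mem hx₀).and (hE'.and ((eventually_all.2 hX').and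
    (hδ'.and (hC₁.and (hD.and (hδb.and ((eventually_all.2 hXb).and
      (eventually_all.2 fun a ↦ eventually_all.2 fun k ↦ hcb a k))))))))
  obtain ⟨U, hU, hUo, hxU⟩ := eventually_nhds_iff.1 hall
  refine ⟨U, E, X, δ, C, hUo, hxU, fun x hx ↦ (hU x hx).1, hE, fun x hx ↦ (hU x hx).2.1,
    fun k ↦ (hX k).1, fun k x hx ↦ (hU x hx).2.2.1 k, hδ, fun x hx ↦ (hU x hx).2.2.2.1, hC0,
    fun x hx ↦ (hU x hx).2.2.2.2.2.1.trans hCD, fun x hx ↦ (hU x hx).2.2.2.2.2.2.1.trans hCδ,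
    fun k x hx ↦ ((hU x hx).2.2.2.2.2.2.2.1 k).trans (hCX k),
    fun a k x hx ↦ ((hU x hx).2.2.2.2.2.2.2.2 a k).trans (hCc a k), fun x hx A ↦ ?_⟩
  refine ((hU x hx).2.2.2.2.1 A).trans ?_
  simp_rw [(hU x hx).2.2.1]
  exact mul_le_mul_of_nonneg_right hCC (Finset.sum_nonneg fun _ _ ↦ by positivity)

end LocalFrame

/-! ### Local approximation by mollifying components in an adapted frame. -/

theorem eLpNorm_two_sq_eq_lintegral {α : Type*} [MeasurableSpace α] {μ : Measure α} (f : α → ℝ) :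
    eLpNorm f 2 μ ^ 2 = ∫⁻ x, ‖f x‖ₑ ^ 2 ∂μ := by
  have h := eLpNorm_nnreal_pow_eq_lintegral (f := f) (μ := μ) (p := 2) (by norm_num)
  simp only [NNReal.coe_ofNat, ENNReal.coe_ofNat] at h
  exact_mod_cast h

theorem norm_sum_smul_sq_le {ι W : Type*} [Fintype ι] [NormedAddCommGroup W] [NormedSpace ℝ W]
    (c : ι → ℝ) (w : ι → W) {C : ℝ} (hw : ∀ i, ‖w i‖ ^ 2 ≤ C) :
    ‖∑ i, c i • w i‖ ^ 2 ≤ (∑ i, c i ^ 2) * (Fintype.card ι * C) := by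
  have h1 : ‖∑ i, c i • w i‖ ≤ ∑ i, |c i| * ‖w i‖ :=
    (norm_sum_le _ _).trans (Finset.sum_le_sum fun i _ ↦ by rw [norm_smul, Real.norm_eq_abs])
  calc ‖∑ i, c i • w i‖ ^ 2 ≤ (∑ i, |c i| * ‖w i‖) ^ 2 := by gcongr
    _ ≤ (∑ i, |c i| ^ 2) * ∑ i, ‖w i‖ ^ 2 := Finset.sum_mul_sq_le_sq_mul_sq _ _ _
    _ ≤ _ := by
      simp only [sq_abs]
      gcongr
      exact (Finset.sum_le_sum fun i _ ↦ hw i).trans (by simp)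

theorem tendsto_lintegral_zero_of_le_sum_sq {α ι : Type*} [MeasurableSpace α] {μ : Measure α}
    [Fintype ι] {q : ℕ → ι → α → ℝ} (hq : ∀ n i, AEMeasurable (q n i) μ)
    (h0 : ∀ i, Tendsto (fun n ↦ ∫⁻ x, ‖q n i x‖ₑ ^ 2 ∂μ) atTop (𝓝 0)) {f : ℕ → α → ℝ} {B : ℝ}
    (hf : ∀ n x, f n x ≤ B * ∑ i, q n i x ^ 2) :
    Tendsto (fun n ↦ ∫⁻ x, ENNReal.ofReal (f n x) ∂μ) atTop (𝓝 0) := by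
  have h1 : Tendsto (fun n ↦ ENNReal.ofReal B * ∑ i, ∫⁻ x, ‖q n i x‖ₑ ^ 2 ∂μ) atTop (𝓝 0) := by
    have := ENNReal.Tendsto.const_mul (a := ENNReal.ofReal B)
      (tendsto_finset_sum Finset.univ fun i _ ↦ h0 i) (Or.inr ENNReal.ofReal_ne_top)
    simpa using this
  refine tendsto_of_tendsto_of_tendsto_of_le_of_le tendsto_const_nhds h1 (fun _ ↦ zero_le) fun n ↦ ?_
  dsimp only
  rw [← lintegral_finsetSum' _ fun i _ ↦ (hq n i).enorm.pow_const 2,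
    ← lintegral_const_mul' _ _ ENNReal.ofReal_ne_top]
  refine lintegral_mono fun x ↦ (ENNReal.ofReal_le_ofReal (hf n x)).trans ?_
  have h2 : 0 ≤ ∑ i, q n i x ^ 2 := Finset.sum_nonneg fun _ _ ↦ by positivity
  rw [ENNReal.ofReal_mul' h2, ENNReal.ofReal_sum_of_nonneg fun _ _ ↦ by positivity]
  simp_rw [← sq_abs (q n _ x), ENNReal.ofReal_pow (abs_nonneg _), ← Real.norm_eq_abs, ofReal_norm]
  exact le_rfl

section Approximable

variable {m : ℕ} {M : Type*} [TopologicalSpace M] [ChartedSpace (EuclideanSpace ℝ (Fin m)) M]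
  [IsManifold (𝓡 m) ∞ M] [RiemannianBundle (fun x : M ↦ TangentSpace (𝓡 m) x)]
  [MeasurableSpace M]
  {F : Type*} [NormedAddCommGroup F] [NormedSpace ℝ F]
  {V : M → Type*} [TopologicalSpace (TotalSpace F V)]
  [∀ x, NormedAddCommGroup (V x)] [∀ x, NormedSpace ℝ (V x)]
  [FiberBundle F V] [VectorBundle ℝ F V]

/-- `(s, w)` is a limit of pairs `(u, ∇ u)` in `L²`, with smooth compactly supported `u`. -/
def IsApproximable (cov : CovariantDerivative (𝓡 m) F V) (s : ∀ x, V x)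
    (w : ∀ x : M, TangentSpace (𝓡 m) x →L[ℝ] V x) : Prop :=
  ∃ u : ℕ → ∀ x, V x, (∀ i, IsTestSection F m (u i)) ∧
    Tendsto (fun i ↦ normSqL2 m (fun x ↦ u i x - s x)) atTop (𝓝 0) ∧
    Tendsto (fun i ↦ formNormSqL2 m (fun x ↦ cov (u i) x - w x)) atTop (𝓝 0)

end Approximable

namespace IsAdaptedFrame

variable {m : ℕ} {M : Type*} [TopologicalSpace M] [T2Space M] [SecondCountableTopology M]
  [ChartedSpace (EuclideanSpace ℝ (Fin m)) M] [IsManifold (𝓡 m) ∞ M]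
  [RiemannianBundle (fun x : M ↦ TangentSpace (𝓡 m) x)]
  [IsContMDiffRiemannianBundle (𝓡 m) ∞ (EuclideanSpace ℝ (Fin m))
    (fun x : M ↦ TangentSpace (𝓡 m) x)]
  {F : Type*} [NormedAddCommGroup F] [NormedSpace ℝ F] [FiniteDimensional ℝ F]
  {V : M → Type*} [TopologicalSpace (TotalSpace F V)]
  [∀ x, NormedAddCommGroup (V x)] [∀ x, InnerProductSpace ℝ (V x)]
  [FiberBundle F V] [VectorBundle ℝ F V] [ContMDiffVectorBundle ∞ F V (𝓡 m)]
  [IsContMDiffRiemannianBundle (𝓡 m) ∞ F V]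
  {cov : CovariantDerivative (𝓡 m) F V} {x₀ : M} {U : Set M}
  {E : Fin (Module.finrank ℝ F) → ∀ x, V x} {X : Fin m → ∀ x : M, TangentSpace (𝓡 m) x}
  {δ : M → ℝ} {C : ℝ} (H : IsAdaptedFrame cov x₀ U E X δ C)

include H

/-- The functions `⟨E a, E b⟩` are constant on `U`, so the connection coefficients of a metric
connection are skew-symmetric. -/
theorem inner_cov_eq_neg [MeasurableSpace M] (hcov : IsMetricConnection ℝ m F cov) {x : M}
    (hx : x ∈ U) (k a b) :
    inner ℝ (cov (E a) x (X k x)) (E b x) = - inner ℝ (E a x) (cov (E b) x (X k x)) := by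
  rw [eq_neg_iff_add_eq_zero, ← hcov.metric _ _ (H.isTestSection a).1 (H.isTestSection b).1,
    mvfderiv_eq_zero_of_eventuallyEq_const (c := if a = b then 1 else 0)]
  · simp
  · filter_upwards [H.isOpen.mem_nhds hx] with y hy
    obtain ⟨e, he⟩ := H.orthonormalBasis y hy
    rw [← he, ← he, orthonormal_iff_ite.1 e.orthonormal]

theorem eq_sum {x : M} (hx : x ∈ U) (w : V x) : w = ∑ a, inner ℝ w (E a x) • E a x := by
  obtain ⟨e, he⟩ := H.orthonormalBasis x hx
  conv_lhs => rw [← e.sum_repr' w]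
  simp_rw [he, real_inner_comm]

theorem norm_sum_sq {x : M} (hx : x ∈ U) (c : Fin (Module.finrank ℝ F) → ℝ) :
    ‖∑ a, c a • E a x‖ ^ 2 = ∑ a, c a ^ 2 := by
  obtain ⟨e, he⟩ := H.orthonormalBasis x hx
  simp_rw [← he]
  rw [← real_inner_self_eq_norm_sq, e.orthonormal.inner_sum]
  simp [sq]

theorem norm_eq_one {x : M} (hx : x ∈ U) (a) : ‖E a x‖ = 1 := by
  obtain ⟨e, he⟩ := H.orthonormalBasis x hx
  rw [← he, e.norm_eq_one]

/-- Skew-symmetry of the connection coefficients moves `∇` from one frame vector to the other. This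
lets the connection terms in the derivatives of the components of `s` pair with the terms `μ a • ∇E
a` of a reassembled section. -/
theorem sum_inner_cov_smul [MeasurableSpace M] (hcov : IsMetricConnection ℝ m F cov) {x : M}
    (hx : x ∈ U) (k)
    (s : V x) : ∑ a, inner ℝ s (cov (E a) x (X k x)) • E a x =
      - ∑ a, inner ℝ s (E a x) • cov (E a) x (X k x) := by
  obtain ⟨e, he⟩ := H.orthonormalBasis x hx
  refine InnerProductSpace.ext_inner_right_basis e.toBasis fun b ↦ ?_
  rw [e.coe_toBasis, he, inner_neg_left, sum_inner, sum_inner]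
  simp_rw [real_inner_smul_left, H.inner_cov_eq_neg hcov hx]
  simp_rw [← he, orthonormal_iff_ite.1 e.orthonormal]
  simp only [mul_ite, mul_one, mul_zero, Finset.sum_ite_eq', Finset.mem_univ, if_true, mul_neg,
    Finset.sum_neg_distrib, neg_neg]
  exact (e.sum_inner_mul_inner _ _).symm

variable [MeasurableSpace M] [BorelSpace M]

/-- On `U` the two measures are comparable up to `C`: here `1 = density · δ ≤ C · density`, while
the reverse estimate uses `density ≤ C`. -/
theorem lintegral_coordMeasure_le {g : M → ℝ≥0∞} (hg : ∀ x ∉ U, g x = 0) :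
    ∫⁻ x, g x ∂(coordMeasure m x₀) ≤ ENNReal.ofReal C * ∫⁻ x, g x ∂(riemannianMeasure m M) := by
  rw [lintegral_riemannianMeasure_eq (x₀ := x₀) fun x hx ↦ hg x fun h ↦ hx (H.subset_source h),
    ← lintegral_const_mul' _ _ ENNReal.ofReal_ne_top]
  refine lintegral_mono fun x ↦ ?_
  by_cases hx : x ∈ U
  · dsimp only
    rw [← mul_assoc, ← ENNReal.ofReal_mul H.nonneg]
    refine le_mul_of_one_le_left' ?_
    rw [ENNReal.one_le_ofReal, ← H.density_mul x hx, mul_comm C]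
    exact mul_le_mul_of_nonneg_left (H.le_bound x hx) (Real.sqrt_nonneg _)
  · simp [hg x hx]

theorem lintegral_riemannianMeasure_le {g : M → ℝ≥0∞} (hg : ∀ x ∉ U, g x = 0) :
    ∫⁻ x, g x ∂(riemannianMeasure m M) ≤ ENNReal.ofReal C * ∫⁻ x, g x ∂(coordMeasure m x₀) := by
  rw [lintegral_riemannianMeasure_eq (x₀ := x₀) fun x hx ↦ hg x fun h ↦ hx (H.subset_source h),
    ← lintegral_const_mul' _ _ ENNReal.ofReal_ne_top]
  refine lintegral_mono fun x ↦ ?_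
  by_cases hx : x ∈ U
  · exact mul_le_mul_left (ENNReal.ofReal_le_ofReal (H.density_le x hx)) _
  · simp [hg x hx]

theorem memLp_toChart {s : ∀ x, V x} {v : ∀ x : M, TangentSpace (𝓡 m) x →L[ℝ] V x}
    (hs : normSqL2 m s < ⊤) (hsm : HasMeasurableCoeffs m F (riemannianMeasure m M) s)
    (hv : formNormSqL2 m v < ⊤) {g : M → ℝ} (hgm : AEMeasurable g (coordMeasure m x₀))
    (hg : ∀ x ∉ U, g x = 0) {B : ℝ}
    (hB : ∀ x ∈ U, g x ^ 2 ≤ B * (‖s x‖ ^ 2 + homNormSq (v x))) : MemLp (toChart m x₀ g) 2 volume := by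
  refine ⟨(aemeasurable_toChart hgm).aestronglyMeasurable, ?_⟩
  suffices h : eLpNorm (toChart m x₀ g) 2 volume ^ 2 < ⊤ by
    simpa using ENNReal.pow_lt_top_iff.1 h
  rw [eLpNorm_two_sq_eq_lintegral, lintegral_toChart_sq hgm]
  refine (H.lintegral_coordMeasure_le fun x hx ↦ by simp [hg x hx]).trans_lt ?_
  refine ENNReal.mul_lt_top ENNReal.ofReal_lt_top ?_
  have h1 : ∀ x, ‖g x‖ₑ ^ 2 ≤ ENNReal.ofReal B * (‖s x‖ₑ ^ 2 + ENNReal.ofReal (homNormSq (v x))) := by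
    intro x
    by_cases hx : x ∈ U
    · rw [← ofReal_norm, ← ofReal_norm, ← ENNReal.ofReal_pow (norm_nonneg _),
        ← ENNReal.ofReal_pow (norm_nonneg _), ← ENNReal.ofReal_add (by positivity)
          (homNormSq_nonneg _), ← ENNReal.ofReal_mul' (by have := homNormSq_nonneg (v x); positivity)]
      refine ENNReal.ofReal_le_ofReal ?_
      rw [Real.norm_eq_abs, sq_abs]
      exact hB x hx
    · simp [hg x hx]
  refine (lintegral_mono h1).trans_lt ?_
  rw [lintegral_const_mul' _ _ ENNReal.ofReal_ne_top, lintegral_add_left' hsm.aemeasurable_enorm_sq]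
  exact ENNReal.mul_lt_top ENNReal.ofReal_lt_top (ENNReal.add_lt_top.2 ⟨hs, hv⟩)

end IsAdaptedFrame

namespace IsAdaptedFrame

variable {m : ℕ} {M : Type*} [TopologicalSpace M] [T2Space M] [SecondCountableTopology M]
  [ChartedSpace (EuclideanSpace ℝ (Fin m)) M] [IsManifold (𝓡 m) ∞ M]
  [RiemannianBundle (fun x : M ↦ TangentSpace (𝓡 m) x)]
  [IsContMDiffRiemannianBundle (𝓡 m) ∞ (EuclideanSpace ℝ (Fin m))
    (fun x : M ↦ TangentSpace (𝓡 m) x)]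
  [MeasurableSpace M] [BorelSpace M]
  {F : Type*} [NormedAddCommGroup F] [NormedSpace ℝ F] [FiniteDimensional ℝ F]
  {V : M → Type*} [TopologicalSpace (TotalSpace F V)]
  [∀ x, NormedAddCommGroup (V x)] [∀ x, InnerProductSpace ℝ (V x)]
  [FiberBundle F V] [VectorBundle ℝ F V] [ContMDiffVectorBundle ∞ F V (𝓡 m)]
  [IsContMDiffRiemannianBundle (𝓡 m) ∞ F V]
  {cov : CovariantDerivative (𝓡 m) F V} {x₀ : M} {U : Set M}
  {E : Fin (Module.finrank ℝ F) → ∀ x, V x} {X : Fin m → ∀ x : M, TangentSpace (𝓡 m) x}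
  {δ : M → ℝ} {C : ℝ} (H : IsAdaptedFrame cov x₀ U E X δ C)

include H

theorem image_subset_target {K : Set M} (hK : K ⊆ U) :
    chartAt (EuclideanSpace ℝ (Fin m)) x₀ '' K ⊆
      (chartAt (EuclideanSpace ℝ (Fin m)) x₀).target := by
  rintro _ ⟨x, hx, rfl⟩
  exact (chartAt _ x₀).map_source (H.subset_source (hK hx))

/-- The weak form of the equation `∇ s = v` in the coordinates around `x₀`. -/
theorem integral_toChart_mul_fderiv (hcov : IsMetricConnection ℝ m F cov)
    {s : ∀ x, V x} {v : ∀ x : M, TangentSpace (𝓡 m) x →L[ℝ] V x}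
    (hs : normSqL2 m s < ⊤) (hsm : HasMeasurableCoeffs m F (riemannianMeasure m M) s)
    (hv : formNormSqL2 m v < ⊤) (hvm : HasMeasurableFormCoeffs m F (riemannianMeasure m M) v)
    (hsv : ∀ φ ψ, IsFormalAdjoint ℝ m F cov φ ψ →
      ∫ x, (inner ℝ (s x) (ψ x) : ℝ) ∂(riemannianMeasure m M) =
        ∫ x, homInner ℝ (v x) (φ x) ∂(riemannianMeasure m M))
    {ρ : M → ℝ} (hρ : ContMDiff (𝓡 m) 𝓘(ℝ) ∞ ρ) (hρc : HasCompactSupport ρ)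
    (hρU : tsupport ρ ⊆ U) (a : Fin (Module.finrank ℝ F)) :
    MemLp (toChart m x₀ fun x ↦ ρ x * inner ℝ (s x) (E a x)) 2 volume ∧ ∀ k,
    MemLp (toChart m x₀ fun x ↦
      ρ x * (inner ℝ (v x (X k x)) (E a x) + inner ℝ (s x) (cov (E a) x (X k x))) +
        mvfderiv (𝓡 m) ρ x (X k x) * inner ℝ (s x) (E a x)) 2 volume ∧
    ∀ κ : EuclideanSpace ℝ (Fin m) → ℝ, ContDiff ℝ ∞ κ → HasCompactSupport κ →
    ∫ y, toChart m x₀ (fun x ↦ ρ x * inner ℝ (s x) (E a x)) y *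
        fderiv ℝ κ y (EuclideanSpace.single k 1) =
      - ∫ y, toChart m x₀ (fun x ↦
          ρ x * (inner ℝ (v x (X k x)) (E a x) + inner ℝ (s x) (cov (E a) x (X k x))) +
          mvfderiv (𝓡 m) ρ x (X k x) * inner ℝ (s x) (E a x)) y * κ y := by
  have hac := coordMeasure_absolutelyContinuous (m := m) x₀
  have hρ0 : ∀ x ∉ tsupport ρ, ρ x = 0 := fun x hx ↦ image_eq_zero_of_notMem_tsupport hx
  have hdρ0 : ∀ x ∉ tsupport ρ, mvfderiv (𝓡 m) ρ x = 0 := fun x hx ↦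
    mvfderiv_eq_zero_of_notMem_tsupport hx
  have hcovs := fun k ↦ (isSmoothSection_cov hcov.smooth (H.isTestSection a).1).apply
    (H.isSmoothSection k)
  have hσm : AEMeasurable (fun x ↦ inner ℝ (s x) (E a x)) (coordMeasure m x₀) :=
    (hsm _ (H.isTestSection a).1).mono_ac hac
  have hcm : ∀ k, AEMeasurable (fun x ↦ inner ℝ (s x) (cov (E a) x (X k x))) (coordMeasure m x₀) :=
    fun k ↦ (hsm _ (hcovs k)).mono_ac hac
  have hvm' : ∀ k, AEMeasurable (fun x ↦ inner ℝ (v x (X k x)) (E a x)) (coordMeasure m x₀) :=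
    fun k ↦ (hvm _ (H.isSmoothSection k) _ (H.isTestSection a).1).mono_ac hac
  have hρm : AEMeasurable ρ (coordMeasure m x₀) := hρ.continuous.aemeasurable
  have hdρm : ∀ k, AEMeasurable (fun x ↦ mvfderiv (𝓡 m) ρ x (X k x)) (coordMeasure m x₀) :=
    fun k ↦ (hρ.contMDiff_mvfderiv_apply (H.isSmoothSection k)).continuous.aemeasurable
  obtain ⟨B, hB0, hB⟩ : ∃ B : ℝ, 0 ≤ B ∧ ∀ x, ρ x ^ 2 ≤ B := by
    obtain ⟨b, hb⟩ := hρ.continuous.bounded_above_of_compact_support hρc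
    refine ⟨b ^ 2, sq_nonneg _, fun x ↦ ?_⟩
    rw [← sq_abs]
    exact pow_le_pow_left₀ (abs_nonneg _) (hb x) 2
  have hB' : ∀ k, ∃ B' : ℝ, 0 ≤ B' ∧ ∀ x, mvfderiv (𝓡 m) ρ x (X k x) ^ 2 ≤ B' := fun k ↦ by
    obtain ⟨b, hb⟩ := (hρ.contMDiff_mvfderiv_apply
      (H.isSmoothSection k)).continuous.bounded_above_of_compact_support
      (hρc.mono' fun x hx ↦ by
        by_contra h
        exact hx (by simp [hdρ0 x h]))
    refine ⟨b ^ 2, sq_nonneg _, fun x ↦ ?_⟩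
    rw [← sq_abs]
    exact pow_le_pow_left₀ (abs_nonneg _) (hb x) 2
  have hσ : ∀ x ∈ U, inner ℝ (s x) (E a x) ^ 2 ≤ ‖s x‖ ^ 2 := fun x hx ↦ by
    rw [← sq_abs]
    refine pow_le_pow_left₀ (abs_nonneg _) ((abs_real_inner_le_norm _ _).trans ?_) 2
    rw [H.norm_eq_one hx, mul_one]
  have hvX : ∀ k, ∀ x ∈ U, inner ℝ (v x (X k x)) (E a x) ^ 2 ≤ C * homNormSq (v x) := fun k x hx ↦ by
    rw [← sq_abs]
    refine (pow_le_pow_left₀ (abs_nonneg _) (abs_real_inner_le_norm _ _) 2).trans ?_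
    rw [H.norm_eq_one hx, mul_one]
    refine (norm_apply_sq_le_homNormSq _ _).trans ?_
    rw [mul_comm]
    exact mul_le_mul_of_nonneg_right (H.norm_field_sq_le k x hx) (homNormSq_nonneg _)
  have hsc : ∀ k, ∀ x ∈ U, inner ℝ (s x) (cov (E a) x (X k x)) ^ 2 ≤ C * ‖s x‖ ^ 2 :=
    fun k x hx ↦ by
    rw [← sq_abs]
    refine (pow_le_pow_left₀ (abs_nonneg _) (abs_real_inner_le_norm _ _) 2).trans ?_
    rw [mul_pow, mul_comm]
    exact mul_le_mul_of_nonneg_right (H.norm_cov_sq_le a k x hx) (sq_nonneg _)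
  have hC := H.nonneg
  have hf : MemLp (toChart m x₀ fun x ↦ ρ x * inner ℝ (s x) (E a x)) 2 volume := by
    refine H.memLp_toChart hs hsm hv (hρm.mul hσm) (fun x hx ↦ by
      simp [hρ0 x fun h ↦ hx (hρU h)]) (B := B) fun x hx ↦ ?_
    rw [mul_pow]
    have := hσ x hx
    have := homNormSq_nonneg (v x)
    gcongr
    · exact hB x
    · linarith
  -- This summand of the weak derivative needs its own integrability: it occurs on both sides of the
  -- tested equation and is split off before it cancels.
  have hr : ∀ k, MemLp (toChart m x₀ fun x ↦ ρ x * inner ℝ (v x (X k x)) (E a x)) 2 volume := by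
    intro k
    refine H.memLp_toChart hs hsm hv (hρm.mul (hvm' k)) (fun x hx ↦ by
      simp [hρ0 x fun h ↦ hx (hρU h)]) (B := B * C) fun x hx ↦ ?_
    rw [mul_pow, mul_assoc]
    have := hvX k x hx
    have h2 : 0 ≤ C * ‖s x‖ ^ 2 := by positivity
    gcongr
    · exact hB x
    · linarith
  have hg : ∀ k, MemLp (toChart m x₀ fun x ↦
      ρ x * (inner ℝ (v x (X k x)) (E a x) + inner ℝ (s x) (cov (E a) x (X k x))) +
        mvfderiv (𝓡 m) ρ x (X k x) * inner ℝ (s x) (E a x)) 2 volume := by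
    intro k
    obtain ⟨B', hB'0, hB'⟩ := hB' k
    refine H.memLp_toChart hs hsm hv ((hρm.mul ((hvm' k).add (hcm k))).add ((hdρm k).mul hσm))
      (fun x hx ↦ by
        simp [hρ0 x fun h ↦ hx (hρU h), hdρ0 x fun h ↦ hx (hρU h)])
      (B := 4 * B * C + 2 * B') fun x hx ↦ ?_
    have h1 := hvX k x hx
    have h2 := hsc k x hx
    have h3 := hσ x hx
    set p := inner ℝ (v x (X k x)) (E a x)
    set q := inner ℝ (s x) (cov (E a) x (X k x))
    set r := inner ℝ (s x) (E a x)
    set d := mvfderiv (𝓡 m) ρ x (X k x)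
    have hn := homNormSq_nonneg (v x)
    calc (ρ x * (p + q) + d * r) ^ 2 ≤ 2 * (ρ x ^ 2 * (2 * (p ^ 2 + q ^ 2))) + 2 * (d ^ 2 * r ^ 2) := by
          nlinarith [sq_nonneg (ρ x * (p + q) - d * r), mul_nonneg (sq_nonneg (ρ x)) (sq_nonneg (p - q))]
      _ ≤ 2 * (B * (2 * (C * homNormSq (v x) + C * ‖s x‖ ^ 2))) + 2 * (B' * ‖s x‖ ^ 2) := by
          gcongr
          · exact hB x
          · exact hB' x
      _ ≤ _ := by
          have : 0 ≤ B' * homNormSq (v x) := by positivity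
          linarith
  refine ⟨hf, fun k ↦ ⟨hg k, fun κ hκ hκc ↦ ?_⟩⟩
  have hKT : tsupport ρ ⊆ (chartAt (EuclideanSpace ℝ (Fin m)) x₀).source := hρU.trans H.subset_source
  set K := tsupport ρ with hKdef
  have hρC := contDiff_toChart (x₀ := x₀) hρ hρc.isCompact hKT hρ0
  have hρS := hasCompactSupport_toChart (x₀ := x₀) hρc.isCompact hKT hρ0
  -- The test section is `ρ κ E a`, which is compactly supported in `U` although `κ` is arbitrary.
  -- Its covariant derivative falls on `κ`, on `ρ` and on `E a`; the first part is the left-hand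
  -- side, the other two belong to the claimed weak derivative.
  set κ' : EuclideanSpace ℝ (Fin m) → ℝ := fun y ↦ toChart m x₀ ρ y * κ y with hκ'
  have hκ'C : ContDiff ℝ ∞ κ' := hρC.mul hκ
  have hκ'S : HasCompactSupport κ' := hρS.mul_right
  have hκ'K : tsupport κ' ⊆ chartAt (EuclideanSpace ℝ (Fin m)) x₀ '' K :=
    tsupport_mul_subset_left.trans (tsupport_toChart_subset hρc.isCompact hKT hρ0)
  have hκ'T := hκ'K.trans (H.image_subset_target hρU)
  have hκM := contMDiff_ofChart hκ'C hκ'S hκ'T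
  have hκ0 : ∀ x ∉ K, ofChart x₀ κ' x = 0 := fun x hx ↦ by
    by_cases hxS : x ∈ (chartAt (EuclideanSpace ℝ (Fin m)) x₀).source
    · rw [ofChart_of_mem _ hxS]
      simp only [hκ']
      rw [toChart_of_mem _ ((chartAt _ x₀).map_source hxS), (chartAt _ x₀).left_inv hxS, hρ0 x hx,
        zero_mul]
    · exact Set.indicator_of_notMem hxS _
  have ht := (H.isTestSection a).1.smul hκM
  have htK : ∀ x ∉ K, ofChart x₀ κ' x • E a x = 0 := fun x hx ↦ by rw [hκ0 x hx, zero_smul]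
  have hmain := integral_coordMeasure_inner_eq_neg hcov hsv (H.isSmoothSection k) H.contMDiff
    H.subset_source (H.eq_coordVec k) H.density_mul hρc.isCompact hρU ht htK
  have hm1 : AEMeasurable (fun x ↦ inner ℝ (s x)
      (cov (fun x ↦ ofChart x₀ κ' x • E a x) x (X k x))) (coordMeasure m x₀) :=
    (hsm _ ((isSmoothSection_cov hcov.smooth ht).apply (H.isSmoothSection k))).mono_ac hac
  have hm2 : AEMeasurable (fun x ↦ inner ℝ (v x (X k x)) (ofChart x₀ κ' x • E a x))
      (coordMeasure m x₀) := (hvm _ (H.isSmoothSection k) _ ht).mono_ac hac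
  rw [integral_coordMeasure hm1, integral_coordMeasure hm2] at hmain
  have hκL : MemLp κ 2 volume := hκ.continuous.memLp_of_hasCompactSupport hκc
  have hdκL : MemLp (fun y ↦ fderiv ℝ κ y (EuclideanSpace.single k 1)) 2 volume :=
    ((hκ.continuous_fderiv (by simp)).clm_apply continuous_const).memLp_of_hasCompactSupport
      (hκc.fderiv_apply ℝ _)
  have hP := hf.integrable_mul hdκL
  have hQ := (hg k).integrable_mul hκL
  have hR := (hr k).integrable_mul hκL
  have e1 : ∀ y, toChart m x₀ (fun x ↦ inner ℝ (v x (X k x)) (ofChart x₀ κ' x • E a x)) y =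
      toChart m x₀ (fun x ↦ ρ x * inner ℝ (v x (X k x)) (E a x)) y * κ y := fun y ↦ by
    by_cases hy : y ∈ (chartAt (EuclideanSpace ℝ (Fin m)) x₀).target
    · rw [toChart_of_mem _ hy, toChart_of_mem _ hy, real_inner_smul_right,
        ofChart_of_mem _ ((chartAt _ x₀).map_target hy), (chartAt _ x₀).right_inv hy]
      simp only [hκ']
      rw [toChart_of_mem _ hy]
      ring
    · simp [toChart, hy]
  have e2 : ∀ y, toChart m x₀ (fun x ↦ inner ℝ (s x)
      (cov (fun x ↦ ofChart x₀ κ' x • E a x) x (X k x))) y =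
      toChart m x₀ (fun x ↦ ρ x * inner ℝ (s x) (E a x)) y *
        fderiv ℝ κ y (EuclideanSpace.single k 1) +
      (toChart m x₀ (fun x ↦
          ρ x * (inner ℝ (v x (X k x)) (E a x) + inner ℝ (s x) (cov (E a) x (X k x))) +
          mvfderiv (𝓡 m) ρ x (X k x) * inner ℝ (s x) (E a x)) y * κ y -
      toChart m x₀ (fun x ↦ ρ x * inner ℝ (v x (X k x)) (E a x)) y * κ y) := fun y ↦ by
    by_cases hy : y ∈ (chartAt (EuclideanSpace ℝ (Fin m)) x₀).target
    · rw [toChart_of_mem _ hy, toChart_of_mem _ hy, toChart_of_mem _ hy, toChart_of_mem _ hy]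
      obtain ⟨x, hx, rfl⟩ : ∃ x ∈ (chartAt (EuclideanSpace ℝ (Fin m)) x₀).source,
        chartAt _ x₀ x = y := ⟨_, (chartAt _ x₀).map_target hy, (chartAt _ x₀).right_inv hy⟩
      rw [(chartAt _ x₀).left_inv hx]
      by_cases hxK : x ∈ K
      · rw [cov_smul (H.isTestSection a).1 hκM]
        have h1 : ofChart x₀ κ' x = ρ x * κ (chartAt _ x₀ x) := by
          rw [ofChart_of_mem _ hx]
          simp only [hκ']
          rw [toChart_of_mem _ hy, (chartAt _ x₀).left_inv hx]
        have h2 : mvfderiv (𝓡 m) (ofChart x₀ κ') x (X k x) =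
            ρ x * fderiv ℝ κ (chartAt _ x₀ x) (EuclideanSpace.single k 1) +
            κ (chartAt _ x₀ x) * mvfderiv (𝓡 m) ρ x (X k x) := by
          rw [H.eq_coordVec k x (hρU hxK), mvfderiv_ofChart_coordVec hκ'C hκ'S hκ'T hx,
            mvfderiv_coordVec (hρ.contMDiffAt.mdifferentiableAt (by simp)) hx,
            ← (toChart_eventuallyEq ρ hy).fderiv_eq]
          simp only [hκ']
          rw [fderiv_fun_mul (hρC.differentiable (by simp) _) (hκ.differentiable (by simp) _),
            toChart_of_mem _ hy, (chartAt _ x₀).left_inv hx]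
          rfl
        have h3 : (ofChart x₀ κ' x • cov (E a) x +
            (mvfderiv (𝓡 m) (ofChart x₀ κ') x).smulRight (E a x)) (X k x) =
            ofChart x₀ κ' x • cov (E a) x (X k x) +
              mvfderiv (𝓡 m) (ofChart x₀ κ') x (X k x) • E a x := rfl
        rw [h3, inner_add_right, real_inner_smul_right, real_inner_smul_right, h1, h2]
        ring
      · have h4 : cov (fun x ↦ ofChart x₀ κ' x • E a x) x = 0 :=
          cov_eq_zero ht fun h ↦ hxK (closure_minimal (fun z hz ↦ by
            by_contra h; exact hz (htK z h)) (isClosed_tsupport ρ) h)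
        simp [h4, hρ0 x hxK, hdρ0 x hxK]
    · simp [toChart, hy]
  simp_rw [e1, e2] at hmain
  have h5 := integral_add hP (hQ.sub hR)
  have h6 := integral_sub hQ hR
  simp only [Pi.mul_apply, Pi.sub_apply] at h5 h6
  linarith

end IsAdaptedFrame

namespace IsAdaptedFrame

variable {m : ℕ} {M : Type*} [TopologicalSpace M] [T2Space M] [SecondCountableTopology M]
  [ChartedSpace (EuclideanSpace ℝ (Fin m)) M] [IsManifold (𝓡 m) ∞ M]
  [RiemannianBundle (fun x : M ↦ TangentSpace (𝓡 m) x)]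
  [IsContMDiffRiemannianBundle (𝓡 m) ∞ (EuclideanSpace ℝ (Fin m))
    (fun x : M ↦ TangentSpace (𝓡 m) x)]
  [MeasurableSpace M] [BorelSpace M]
  {F : Type*} [NormedAddCommGroup F] [NormedSpace ℝ F] [FiniteDimensional ℝ F]
  {V : M → Type*} [TopologicalSpace (TotalSpace F V)]
  [∀ x, NormedAddCommGroup (V x)] [∀ x, InnerProductSpace ℝ (V x)]
  [FiberBundle F V] [VectorBundle ℝ F V] [ContMDiffVectorBundle ∞ F V (𝓡 m)]
  [IsContMDiffRiemannianBundle (𝓡 m) ∞ F V]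
  {cov : CovariantDerivative (𝓡 m) F V} {x₀ : M} {U : Set M}
  {E : Fin (Module.finrank ℝ F) → ∀ x, V x} {X : Fin m → ∀ x : M, TangentSpace (𝓡 m) x}
  {δ : M → ℝ} {C : ℝ} (H : IsAdaptedFrame cov x₀ U E X δ C)

include H

/-- The components of `∇ (∑ μₐ Eₐ) - (ρ v + dρ ⊗ s)`. -/
theorem cov_sum_sub_apply (hcov : IsMetricConnection ℝ m F cov) {x : M} (hx : x ∈ U)
    (s : V x) (v : TangentSpace (𝓡 m) x →L[ℝ] V x) (l : TangentSpace (𝓡 m) x →L[ℝ] ℝ) (ρ : ℝ)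
    {μ : Fin (Module.finrank ℝ F) → M → ℝ} (hμ : ∀ a, ContMDiff (𝓡 m) 𝓘(ℝ) ∞ (μ a)) (k : Fin m) :
    (cov (fun y ↦ ∑ a, μ a y • E a y) x - (ρ • v + l.smulRight s)) (X k x) =
      ∑ a, (mvfderiv (𝓡 m) (μ a) x (X k x) - (ρ * (inner ℝ (v (X k x)) (E a x) +
        inner ℝ s (cov (E a) x (X k x))) + l (X k x) * inner ℝ s (E a x))) • E a x +
      ∑ a, (μ a x - ρ * inner ℝ s (E a x)) • cov (E a) x (X k x) := by
  have h1 : cov (fun y ↦ ∑ a, μ a y • E a y) x (X k x) = ∑ a, (μ a x • cov (E a) x (X k x) +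
      mvfderiv (𝓡 m) (μ a) x (X k x) • E a x) := by
    rw [cov_sum fun a ↦ (H.isTestSection a).1.smul (hμ a), ContinuousLinearMap.sum_apply]
    refine Finset.sum_congr rfl fun a _ ↦ ?_
    rw [cov_smul (H.isTestSection a).1 (hμ a)]
    rfl
  have h2 : (ρ • v + l.smulRight s) (X k x) = ρ • v (X k x) + l (X k x) • s := rfl
  -- Replaces `∑ ⟨s, ∇E a⟩ E a` by `-∑ ⟨s, E a⟩ ∇E a`, after which the connection terms carry
  -- precisely the errors `μ a - ρ ⟨s, E a⟩`.
  have h3 := H.sum_inner_cov_smul hcov hx k s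
  rw [ContinuousLinearMap.sub_apply, h1, h2]
  conv_lhs => rw [H.eq_sum hx (v (X k x)), H.eq_sum hx s]
  simp only [sub_smul, add_smul, Finset.sum_add_distrib, Finset.sum_sub_distrib, mul_add, mul_smul,
    ← Finset.smul_sum]
  rw [h3]
  module

/-- The derivative errors multiply an orthonormal frame, and the errors of the components multiply
the bounded sections `∇E a`. In the constant, `C` compares the norm with the coordinate directions,
`m` counts these directions, and `2 + 2rC`, with `r` the rank, comes from splitting the two sums. -/
theorem homNormSq_cov_sum_sub_le (hcov : IsMetricConnection ℝ m F cov) {x : M} (hx : x ∈ U)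
    (s : V x) (v : TangentSpace (𝓡 m) x →L[ℝ] V x) (l : TangentSpace (𝓡 m) x →L[ℝ] ℝ) (ρ : ℝ)
    {μ : Fin (Module.finrank ℝ F) → M → ℝ} (hμ : ∀ a, ContMDiff (𝓡 m) 𝓘(ℝ) ∞ (μ a)) :
    homNormSq (cov (fun y ↦ ∑ a, μ a y • E a y) x - (ρ • v + l.smulRight s)) ≤
      (C * (m * (2 + 2 * (Fintype.card (Fin (Module.finrank ℝ F)) * C)))) *
        (∑ a, (μ a x - ρ * inner ℝ s (E a x)) ^ 2 +
          ∑ k, ∑ a, (mvfderiv (𝓡 m) (μ a) x (X k x) - (ρ * (inner ℝ (v (X k x)) (E a x) +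
            inner ℝ s (cov (E a) x (X k x))) + l (X k x) * inner ℝ s (E a x))) ^ 2) := by
  have hC := H.nonneg
  refine (H.homNormSq_le x hx _).trans ?_
  rw [mul_assoc]
  refine mul_le_mul_of_nonneg_left ?_ hC
  simp_rw [H.cov_sum_sub_apply hcov hx s v l ρ hμ]
  generalize hp : (fun a ↦ μ a x - ρ * inner ℝ s (E a x)) = p
  generalize hd : (fun k a ↦ mvfderiv (𝓡 m) (μ a) x (X k x) - (ρ * (inner ℝ (v (X k x)) (E a x) +
    inner ℝ s (cov (E a) x (X k x))) + l (X k x) * inner ℝ s (E a x))) = d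
  have hp' : ∀ a, μ a x - ρ * inner ℝ s (E a x) = p a := congrFun hp
  have hd' : ∀ k a, mvfderiv (𝓡 m) (μ a) x (X k x) - (ρ * (inner ℝ (v (X k x)) (E a x) +
    inner ℝ s (cov (E a) x (X k x))) + l (X k x) * inner ℝ s (E a x)) = d k a :=
    fun k ↦ congrFun (congrFun hd k)
  simp_rw [hp', hd']
  set r : ℝ := (Fintype.card (Fin (Module.finrank ℝ F)) : ℝ)
  have hk : ∀ k ∈ (Finset.univ : Finset (Fin m)),
      ‖∑ a, d k a • E a x + ∑ a, p a • cov (E a) x (X k x)‖ ^ 2 ≤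
      (2 + 2 * (r * C)) * (∑ a, p a ^ 2 + ∑ k, ∑ a, d k a ^ 2) := by
    intro k _
    refine (norm_add_sq_le_two_mul _ _).trans ?_
    rw [H.norm_sum_sq hx]
    have h5 := norm_sum_smul_sq_le p (fun a ↦ cov (E a) x (X k x))
      fun a ↦ H.norm_cov_sq_le a k x hx
    have h7 : ∑ a, d k a ^ 2 ≤ ∑ k, ∑ a, d k a ^ 2 :=
      Finset.single_le_sum (f := fun k ↦ ∑ a, d k a ^ 2) (fun _ _ ↦ by positivity)
        (Finset.mem_univ k)
    have h8 : 0 ≤ ∑ a, p a ^ 2 := by positivity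
    have h9 : 0 ≤ r * C := by positivity
    have h10 : 0 ≤ ∑ k, ∑ a, d k a ^ 2 := by positivity
    have h11 := mul_nonneg h9 h10
    linarith
  refine (Finset.sum_le_sum hk).trans (le_of_eq ?_)
  rw [Finset.sum_const, Finset.card_univ, Fintype.card_fin, nsmul_eq_mul, mul_assoc]

/-- The components of `ρ s` are mollified in the chart, carried back to `M` and recombined with the
frame. Both `L²` errors are bounded pointwise by the component errors, which tend to zero. -/
theorem isApproximable_smul (hcov : IsMetricConnection ℝ m F cov)
    {s : ∀ x, V x} {v : ∀ x : M, TangentSpace (𝓡 m) x →L[ℝ] V x}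
    (hs : normSqL2 m s < ⊤) (hsm : HasMeasurableCoeffs m F (riemannianMeasure m M) s)
    (hv : formNormSqL2 m v < ⊤) (hvm : HasMeasurableFormCoeffs m F (riemannianMeasure m M) v)
    (hsv : ∀ φ ψ, IsFormalAdjoint ℝ m F cov φ ψ →
      ∫ x, (inner ℝ (s x) (ψ x) : ℝ) ∂(riemannianMeasure m M) =
        ∫ x, homInner ℝ (v x) (φ x) ∂(riemannianMeasure m M))
    {ρ : M → ℝ} (hρ : ContMDiff (𝓡 m) 𝓘(ℝ) ∞ ρ) (hρc : HasCompactSupport ρ)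
    (hρU : tsupport ρ ⊆ U) : IsApproximable cov (fun x ↦ ρ x • s x)
      (fun x ↦ ρ x • v x + (mvfderiv (𝓡 m) ρ x).smulRight (s x)) := by
  have hac := coordMeasure_absolutelyContinuous (m := m) x₀
  have hρ0 : ∀ x ∉ tsupport ρ, ρ x = 0 := fun x hx ↦ image_eq_zero_of_notMem_tsupport hx
  have hdρ0 : ∀ x ∉ tsupport ρ, mvfderiv (𝓡 m) ρ x = 0 := fun x hx ↦
    mvfderiv_eq_zero_of_notMem_tsupport hx
  set f : Fin (Module.finrank ℝ F) → M → ℝ := fun a x ↦ ρ x * inner ℝ (s x) (E a x) with hf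
  set g : Fin (Module.finrank ℝ F) → Fin m → M → ℝ := fun a k x ↦
    ρ x * (inner ℝ (v x (X k x)) (E a x) + inner ℝ (s x) (cov (E a) x (X k x))) +
      mvfderiv (𝓡 m) ρ x (X k x) * inner ℝ (s x) (E a x) with hg
  have hf0 : ∀ a, ∀ x ∉ tsupport ρ, f a x = 0 := fun a x hx ↦ by simp [hf, hρ0 x hx]
  have hg0 : ∀ a k, ∀ x ∉ tsupport ρ, g a k x = 0 := fun a k x hx ↦ by
    simp [hg, hρ0 x hx, hdρ0 x hx]
  have hfm : ∀ a, AEMeasurable (f a) (coordMeasure m x₀) := fun a ↦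
    hρ.continuous.aemeasurable.mul ((hsm _ (H.isTestSection a).1).mono_ac hac)
  have hgm : ∀ a k, AEMeasurable (g a k) (coordMeasure m x₀) := fun a k ↦
    (hρ.continuous.aemeasurable.mul
      (((hvm _ (H.isSmoothSection k) _ (H.isTestSection a).1).mono_ac hac).add
        ((hsm _ ((isSmoothSection_cov hcov.smooth (H.isTestSection a).1).apply
          (H.isSmoothSection k))).mono_ac hac))).add
      ((hρ.contMDiff_mvfderiv_apply (H.isSmoothSection k)).continuous.aemeasurable.mul
        ((hsm _ (H.isTestSection a).1).mono_ac hac))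
  -- The mollified components have to stay inside the coordinate image of `U`, since the frame is
  -- orthonormal and bounded only there.
  set O : Set (EuclideanSpace ℝ (Fin m)) := (chartAt (EuclideanSpace ℝ (Fin m)) x₀).target ∩
    (chartAt (EuclideanSpace ℝ (Fin m)) x₀).symm ⁻¹' U with hO
  have hOo : IsOpen O := (chartAt _ x₀).symm.isOpen_inter_preimage H.isOpen
  have hKO : chartAt (EuclideanSpace ℝ (Fin m)) x₀ '' tsupport ρ ⊆ O := by
    rintro _ ⟨x, hx, rfl⟩
    have hxS := H.subset_source (hρU hx)
    exact ⟨(chartAt _ x₀).map_source hxS, by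
      rw [Set.mem_preimage, (chartAt _ x₀).left_inv hxS]; exact hρU hx⟩
  have hmoll := fun a ↦ by
    obtain ⟨h1, h2⟩ := H.integral_toChart_mul_fderiv hcov hs hsm hv hvm hsv hρ hρc hρU a
    exact exists_seq_mollification (fun k : Fin m ↦ EuclideanSpace.single k (1 : ℝ)) h1
      (fun k ↦ (h2 k).1) (isCompact_image_chartAt hρc.isCompact (hρU.trans H.subset_source)) hOo hKO
      (fun y hy ↦ by by_contra h; exact hy (toChart_eq_zero (hf0 a) h)) (fun k ↦ (h2 k).2)
  choose μ hμ hμc hμO hμf hμg using hmoll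
  have hμT : ∀ a n, tsupport (μ a n) ⊆ (chartAt (EuclideanSpace ℝ (Fin m)) x₀).target :=
    fun a n ↦ (hμO a n).trans Set.inter_subset_left
  have hμM := fun a n ↦ contMDiff_ofChart (hμ a n) (hμc a n) (hμT a n)
  have hμ0 : ∀ a n, ∀ x ∉ U, ofChart x₀ (μ a n) x = 0 := fun a n x hx ↦ by
    refine ofChart_eq_zero ?_
    rintro ⟨y, hy, rfl⟩
    exact hx (hμO a n hy).2
  set u : ℕ → ∀ x, V x := fun n x ↦ ∑ a, ofChart x₀ (μ a n) x • E a x with hu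
  have hut : ∀ n, IsTestSection F m (u n) := fun n ↦ by
    refine IsSmoothSection.isTestSection (.sum fun a _ ↦ (H.isTestSection a).1.smul (hμM a n))
      (isCompact_iUnion fun a ↦ (H.isTestSection a).2) fun x hx ↦ ?_
    refine Finset.sum_eq_zero fun a _ ↦ ?_
    have : E a x = 0 := by
      by_contra h
      exact hx (Set.mem_iUnion.2 ⟨a, subset_closure h⟩)
    rw [this, smul_zero]
  -- the errors of the components
  set q : ℕ → Option (Fin m) × Fin (Module.finrank ℝ F) → M → ℝ := fun n i x ↦
    i.1.elim (ofChart x₀ (μ i.2 n) x - f i.2 x)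
      fun k ↦ ofChart x₀ (fun y ↦ fderiv ℝ (μ i.2 n) y (EuclideanSpace.single k 1)) x - g i.2 k x
    with hq
  have hdc : ∀ a n k, ContDiff ℝ ∞ fun y ↦ fderiv ℝ (μ a n) y (EuclideanSpace.single k 1) :=
    fun a n k ↦ ((hμ a n).fderiv_right (m := ∞) (by simp)).clm_apply contDiff_const
  have hdt : ∀ a n k, tsupport (fun y ↦ fderiv ℝ (μ a n) y (EuclideanSpace.single k 1)) ⊆
      tsupport (μ a n) := fun a n k ↦ tsupport_fderiv_apply_subset ℝ _
  have hqm : ∀ n i, AEMeasurable (q n i) (coordMeasure m x₀) := by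
    rintro n ⟨_ | k, a⟩
    · exact (hμM a n).continuous.aemeasurable.sub (hfm a)
    · exact (contMDiff_ofChart (hdc a n k) ((hμc a n).fderiv_apply ℝ _)
        ((hdt a n k).trans (hμT a n))).continuous.aemeasurable.sub (hgm a k)
  have hto : ∀ (κ : EuclideanSpace ℝ (Fin m) → ℝ) (h : M → ℝ),
      tsupport κ ⊆ (chartAt (EuclideanSpace ℝ (Fin m)) x₀).target →
      toChart m x₀ (fun x ↦ ofChart x₀ κ x - h x) = fun y ↦ κ y - toChart m x₀ h y := by
    intro κ h hκ
    funext y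
    by_cases hy : y ∈ (chartAt (EuclideanSpace ℝ (Fin m)) x₀).target
    · rw [toChart_of_mem _ hy, toChart_of_mem _ hy, ofChart_of_mem _ ((chartAt _ x₀).map_target hy),
        (chartAt _ x₀).right_inv hy]
    · simp [toChart, hy, image_eq_zero_of_notMem_tsupport fun h ↦ hy (hκ h)]
  have hq0 : ∀ i, Tendsto (fun n ↦ ∫⁻ x, ‖q n i x‖ₑ ^ 2 ∂(coordMeasure m x₀)) atTop (𝓝 0) := by
    rintro i
    simp_rw [← lintegral_toChart_sq (hqm _ i), ← eLpNorm_two_sq_eq_lintegral]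
    have hz : (0 : ℝ≥0∞) = 0 ^ 2 := by simp
    rw [hz]
    refine (ENNReal.continuous_pow 2).continuousAt.tendsto.comp ?_
    obtain ⟨_ | k, a⟩ := i
    · refine (hμf a).congr fun n ↦ ?_
      simp only [hq, Option.elim]
      rw [hto _ _ (hμT a n)]
    · refine (hμg a k).congr fun n ↦ ?_
      simp only [hq, Option.elim]
      rw [hto _ _ ((hdt a n k).trans (hμT a n))]
  have hρU0 : ∀ x ∉ U, ρ x = 0 := fun x hx ↦ hρ0 x fun h ↦ hx (hρU h)
  have hu0 : ∀ n, ∀ x ∉ U, u n x = 0 := fun n x hx ↦ by simp [hu, hμ0 _ n x hx]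
  have hcu0 : ∀ n, ∀ x ∉ U, cov (u n) x = 0 := fun n x hx ↦ by
    rw [hu, cov_sum fun a ↦ (H.isTestSection a).1.smul (hμM a n)]
    refine Finset.sum_eq_zero fun a _ ↦ ?_
    have hx' : x ∉ tsupport (ofChart x₀ (μ a n)) := fun h ↦ by
      have h1 : tsupport (ofChart x₀ (μ a n)) ⊆
          (chartAt (EuclideanSpace ℝ (Fin m)) x₀).symm '' tsupport (μ a n) :=
        closure_minimal (fun y hy ↦ by by_contra h; exact hy (ofChart_eq_zero h))
          ((hμc a n).isCompact.image_of_continuousOn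
            ((chartAt _ x₀).continuousOn_symm.mono (hμT a n))).isClosed
      obtain ⟨y, hy, rfl⟩ := h1 h
      exact hx (hμO a n hy).2
    rw [cov_smul (H.isTestSection a).1 (hμM a n), mvfderiv_eq_zero_of_notMem_tsupport hx',
      image_eq_zero_of_notMem_tsupport hx']
    simp
  refine ⟨u, hut, ?_, ?_⟩
  · have h1 : ∀ n x, ‖u n x - ρ x • s x‖ ^ 2 ≤ 1 * ∑ i, q n i x ^ 2 := by
      intro n x
      by_cases hx : x ∈ U
      · have h2 : u n x - ρ x • s x = ∑ a, q n (none, a) x • E a x := by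
          conv_lhs => rw [H.eq_sum hx (s x)]
          simp only [hu, hq, hf, Option.elim, sub_smul, Finset.sum_sub_distrib, Finset.smul_sum,
            mul_smul]
        rw [h2, H.norm_sum_sq hx, one_mul, Fintype.sum_prod_type, Fintype.sum_option]
        exact le_add_of_nonneg_right (by positivity)
      · rw [hu0 n x hx, hρU0 x hx]
        simp only [zero_smul, sub_zero, norm_zero, one_mul]
        exact (zero_pow two_ne_zero).trans_le (Finset.sum_nonneg fun _ _ ↦ sq_nonneg _)
    have h3 := tendsto_lintegral_zero_of_le_sum_sq hqm hq0 h1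
    have h4 := ENNReal.Tendsto.const_mul (a := ENNReal.ofReal C) h3
      (Or.inr ENNReal.ofReal_ne_top)
    rw [mul_zero] at h4
    refine tendsto_of_tendsto_of_tendsto_of_le_of_le tendsto_const_nhds h4 (fun _ ↦ zero_le)
      fun n ↦ ?_
    refine (H.lintegral_riemannianMeasure_le fun x hx ↦ ?_).trans (mul_le_mul_right
      (lintegral_mono fun x ↦ ?_) _)
    · simp [hu0 n x hx, hρU0 x hx]
    · rw [ENNReal.ofReal_pow (norm_nonneg _), ofReal_norm]
  · set r : ℝ := (Fintype.card (Fin (Module.finrank ℝ F)) : ℝ)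
    have hC := H.nonneg
    have h1 : ∀ n x, homNormSq (cov (u n) x - (ρ x • v x + (mvfderiv (𝓡 m) ρ x).smulRight (s x))) ≤
        (C * (m * (2 + 2 * (r * C)))) * ∑ i, q n i x ^ 2 := by
      intro n x
      by_cases hx : x ∈ U
      · refine (H.homNormSq_cov_sum_sub_le hcov hx (s x) (v x) (mvfderiv (𝓡 m) ρ x) (ρ x)
          (fun a ↦ hμM a n)).trans_eq ?_
        have h3 : ∀ a k, mvfderiv (𝓡 m) (ofChart x₀ (μ a n)) x (X k x) =
            ofChart x₀ (fun y ↦ fderiv ℝ (μ a n) y (EuclideanSpace.single k 1)) x := fun a k ↦ by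
          rw [H.eq_coordVec k x hx, mvfderiv_ofChart_coordVec (hμ a n) (hμc a n) (hμT a n)
            (H.subset_source hx), ofChart_of_mem _ (H.subset_source hx)]
        rw [Fintype.sum_prod_type, Fintype.sum_option]
        simp_rw [h3]
        rfl
      · have hdx := hdρ0 x fun h ↦ hx (hρU h)
        have h0 : cov (u n) x - (ρ x • v x + (mvfderiv (𝓡 m) ρ x).smulRight (s x)) = 0 := by
          rw [hcu0 n x hx, hρU0 x hx, hdx]
          ext; simp
        rw [h0, homNormSq_zero]
        positivity
    have h3 := tendsto_lintegral_zero_of_le_sum_sq hqm hq0 h1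
    have h4 := ENNReal.Tendsto.const_mul (a := ENNReal.ofReal C) h3
      (Or.inr ENNReal.ofReal_ne_top)
    rw [mul_zero] at h4
    refine tendsto_of_tendsto_of_tendsto_of_le_of_le tendsto_const_nhds h4 (fun _ ↦ zero_le)
      fun n ↦ ?_
    refine (H.lintegral_riemannianMeasure_le fun x hx ↦ ?_)
    have hdx := hdρ0 x fun h ↦ hx (hρU h)
    have h0 : cov (u n) x - (ρ x • v x + (mvfderiv (𝓡 m) ρ x).smulRight (s x)) = 0 := by
      rw [hcu0 n x hx, hρU0 x hx, hdx]
      ext; simp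
    beta_reduce
    rw [h0, homNormSq_zero, ENNReal.ofReal_zero]

end IsAdaptedFrame

/-! ### Gluing: approximation on compact sets. -/

theorem tendsto_two_mul_add_two_mul_zero {f g : ℕ → ℝ≥0∞} (hf : Tendsto f atTop (𝓝 0))
    (hg : Tendsto g atTop (𝓝 0)) : Tendsto (fun n ↦ 2 * f n + 2 * g n) atTop (𝓝 0) := by
  simpa using (ENNReal.Tendsto.const_mul (a := 2) hf (by simp)).add
    (ENNReal.Tendsto.const_mul (a := 2) hg (by simp))

section Global

variable {m : ℕ} {M : Type*} [TopologicalSpace M] [T2Space M] [SecondCountableTopology M]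
  [ChartedSpace (EuclideanSpace ℝ (Fin m)) M] [IsManifold (𝓡 m) ∞ M]
  [RiemannianBundle (fun x : M ↦ TangentSpace (𝓡 m) x)]
  [IsContMDiffRiemannianBundle (𝓡 m) ∞ (EuclideanSpace ℝ (Fin m))
    (fun x : M ↦ TangentSpace (𝓡 m) x)]
  [MeasurableSpace M] [BorelSpace M]
  {F : Type*} [NormedAddCommGroup F] [NormedSpace ℝ F] [FiniteDimensional ℝ F]
  {V : M → Type*} [TopologicalSpace (TotalSpace F V)]
  [∀ x, NormedAddCommGroup (V x)] [∀ x, InnerProductSpace ℝ (V x)]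
  [FiberBundle F V] [VectorBundle ℝ F V] [ContMDiffVectorBundle ∞ F V (𝓡 m)]
  [IsContMDiffRiemannianBundle (𝓡 m) ∞ F V]
  {cov : CovariantDerivative (𝓡 m) F V}

theorem normSqL2_add_le {s t : ∀ x, V x}
    (hs : HasMeasurableCoeffs m F (riemannianMeasure m M) s) :
    normSqL2 m (fun x ↦ s x + t x) ≤ 2 * normSqL2 m s + 2 * normSqL2 m t := by
  simp only [normSqL2]
  rw [← lintegral_const_mul' _ _ (by simp), ← lintegral_const_mul' _ _ (by simp),
    ← lintegral_add_left' (hs.aemeasurable_enorm_sq.const_mul _)]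
  refine lintegral_mono fun x ↦ ?_
  have h := ENNReal.ofReal_le_ofReal (norm_add_sq_le_two_mul (s x) (t x))
  rw [ENNReal.ofReal_add (by positivity) (by positivity), ENNReal.ofReal_mul (by norm_num),
    ENNReal.ofReal_mul (by norm_num)] at h
  simpa [ENNReal.ofReal_pow] using h

theorem formNormSqL2_add_le {A B : ∀ x : M, TangentSpace (𝓡 m) x →L[ℝ] V x}
    (hA : HasMeasurableFormCoeffs m F (riemannianMeasure m M) A) :
    formNormSqL2 m (fun x ↦ A x + B x) ≤ 2 * formNormSqL2 m A + 2 * formNormSqL2 m B := by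
  simp only [formNormSqL2]
  rw [← lintegral_const_mul' _ _ (by simp), ← lintegral_const_mul' _ _ (by simp),
    ← lintegral_add_left' (hA.aemeasurable_homNormSq.ennreal_ofReal.const_mul _)]
  refine lintegral_mono fun x ↦ ?_
  have h := ENNReal.ofReal_le_ofReal (homNormSq_add_le (A x) (B x))
  have h1 := homNormSq_nonneg (A x)
  have h2 := homNormSq_nonneg (B x)
  rw [ENNReal.ofReal_add (by positivity) (by positivity), ENNReal.ofReal_mul (by norm_num),
    ENNReal.ofReal_mul (by norm_num)] at h
  simpa using h

theorem HasMeasurableCoeffs.mvfderiv_smulRight {μ : Measure M} {s : ∀ x, V x}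
    (hs : HasMeasurableCoeffs m F μ s) {ρ : M → ℝ} (hρ : ContMDiff (𝓡 m) 𝓘(ℝ) ∞ ρ) :
    HasMeasurableFormCoeffs m F μ (fun x ↦ (mvfderiv (𝓡 m) ρ x).smulRight (s x)) := fun _ hX ↦
  hs.smul (hρ.contMDiff_mvfderiv_apply hX).continuous.aemeasurable

theorem IsApproximable.add (hcov : IsMetricConnection ℝ m F cov) {s t : ∀ x, V x}
    {v w : ∀ x : M, TangentSpace (𝓡 m) x →L[ℝ] V x}
    (hs : HasMeasurableCoeffs m F (riemannianMeasure m M) s)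
    (hv : HasMeasurableFormCoeffs m F (riemannianMeasure m M) v)
    (h1 : IsApproximable cov s v) (h2 : IsApproximable cov t w) :
    IsApproximable cov (fun x ↦ s x + t x) (fun x ↦ v x + w x) := by
  obtain ⟨u, hu, hus, huv⟩ := h1
  obtain ⟨z, hz, hzt, hzw⟩ := h2
  refine ⟨fun n x ↦ u n x + z n x, fun n ↦ (hu n).add (hz n), ?_, ?_⟩
  · refine tendsto_of_tendsto_of_tendsto_of_le_of_le tendsto_const_nhds
      (tendsto_two_mul_add_two_mul_zero hus hzt) (fun _ ↦ zero_le) fun n ↦ ?_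
    refine le_trans (le_of_eq ?_) (normSqL2_add_le ((hu n).1.hasMeasurableCoeffs.sub hs))
    congr 1
    funext x
    exact add_sub_add_comm _ _ _ _
  · refine tendsto_of_tendsto_of_tendsto_of_le_of_le tendsto_const_nhds
      (tendsto_two_mul_add_two_mul_zero huv hzw) (fun _ ↦ zero_le) fun n ↦ ?_
    refine le_trans (le_of_eq ?_) (formNormSqL2_add_le
      ((isSmoothSection_cov hcov.smooth (hu n).1).hasMeasurableFormCoeffs.sub hv))
    congr 1
    funext x
    rw [cov_add (hu n).1 (hz n).1]
    exact add_sub_add_comm _ _ _ _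

theorem isApproximable_zero : IsApproximable cov (fun _ ↦ 0) (fun _ ↦ 0) := by
  refine ⟨fun _ _ ↦ 0, fun _ ↦ isTestSection_zero, ?_, ?_⟩
  · simp [normSqL2]
  · have h : ∀ x, cov (fun _ ↦ 0) x = 0 := congrFun cov.zero
    simp [formNormSqL2, h]

/-- `s` and `v` are in `L²`, and `∇ s = v` in the distributional sense. -/
structure HasWeakCovariantDerivative (cov : CovariantDerivative (𝓡 m) F V) (s : ∀ x, V x)
    (v : ∀ x : M, TangentSpace (𝓡 m) x →L[ℝ] V x) : Prop where
  normSqL2_lt_top : normSqL2 m s < ⊤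
  hasMeasurableCoeffs : HasMeasurableCoeffs m F (riemannianMeasure m M) s
  formNormSqL2_lt_top : formNormSqL2 m v < ⊤
  hasMeasurableFormCoeffs : HasMeasurableFormCoeffs m F (riemannianMeasure m M) v
  integral_eq (φ ψ) (h : IsFormalAdjoint ℝ m F cov φ ψ) :
    ∫ x, (inner ℝ (s x) (ψ x) : ℝ) ∂(riemannianMeasure m M) =
      ∫ x, homInner ℝ (v x) (φ x) ∂(riemannianMeasure m M)

namespace HasWeakCovariantDerivative

variable {s : ∀ x, V x} {v : ∀ x : M, TangentSpace (𝓡 m) x →L[ℝ] V x}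

theorem isApproximable_sum_smul (h : HasWeakCovariantDerivative cov s v)
    (hcov : IsMetricConnection ℝ m F cov) {ι : Type*} (t : Finset ι) {ρ : ι → M → ℝ}
    (hρ : ∀ i, ContMDiff (𝓡 m) 𝓘(ℝ) ∞ (ρ i))
    (hi : ∀ i, IsApproximable cov (fun x ↦ ρ i x • s x)
      (fun x ↦ ρ i x • v x + (mvfderiv (𝓡 m) (ρ i) x).smulRight (s x))) :
    IsApproximable cov (fun x ↦ (∑ i ∈ t, ρ i x) • s x) (fun x ↦ (∑ i ∈ t, ρ i x) • v x +
      (mvfderiv (𝓡 m) (fun x ↦ ∑ i ∈ t, ρ i x) x).smulRight (s x)) := by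
  classical
  induction t using Finset.induction_on with
  | empty =>
    have h0 : ∀ x : M, mvfderiv (𝓡 m) (fun _ : M ↦ (0 : ℝ)) x = 0 := fun x ↦ mvfderiv_const 0
    simp only [Finset.sum_empty, zero_smul, h0, zero_add]
    convert isApproximable_zero (cov := cov) using 2
    ext; simp
  | insert a t ha ih =>
    have hsum : ContMDiff (𝓡 m) 𝓘(ℝ) ∞ fun x ↦ ∑ i ∈ t, ρ i x := contMDiff_finsetSum fun i _ ↦ hρ i
    have h1 := IsApproximable.add hcov
      (h.hasMeasurableCoeffs.smul (hρ a).continuous.aemeasurable)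
      ((h.hasMeasurableFormCoeffs.smul (hρ a).continuous.aemeasurable).add
        (h.hasMeasurableCoeffs.mvfderiv_smulRight (hρ a))) (hi a) ih
    have h2 : ∀ x, mvfderiv (𝓡 m) (fun x ↦ ρ a x + ∑ i ∈ t, ρ i x) x = mvfderiv (𝓡 m) (ρ a) x +
        mvfderiv (𝓡 m) (fun x ↦ ∑ i ∈ t, ρ i x) x := fun x ↦
      mvfderiv_add ((hρ a).contMDiffAt.mdifferentiableAt (by simp))
        (hsum.contMDiffAt.mdifferentiableAt (by simp))
    simp_rw [Finset.sum_insert ha, h2]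
    convert h1 using 2
    · rw [add_smul]
    · ext w
      simp only [add_smul, add_apply, ContinuousLinearMap.smulRight_apply, smul_apply]
      abel

/-- Finitely many adapted neighbourhoods cover the compact support of `θ`. A subordinate partition
of unity splits `θ` into summands supported in one neighbourhood each, and approximability is
additive. -/
theorem isApproximable_smul (h : HasWeakCovariantDerivative cov s v)
    (hcov : IsMetricConnection ℝ m F cov) {θ : M → ℝ} (hθ : ContMDiff (𝓡 m) 𝓘(ℝ) ∞ θ)
    (hθc : HasCompactSupport θ) : IsApproximable cov (fun x ↦ θ x • s x)
      (fun x ↦ θ x • v x + (mvfderiv (𝓡 m) θ x).smulRight (s x)) := by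
  have : LocallyCompactSpace M := ChartedSpace.locallyCompactSpace (EuclideanSpace ℝ (Fin m)) M
  choose U E X δ C H using fun x₀ : M ↦ exists_isAdaptedFrame hcov x₀
  obtain ⟨t, ht⟩ := hθc.isCompact.elim_finite_subcover U (fun x ↦ (H x).isOpen)
    fun x _ ↦ Set.mem_iUnion.2 ⟨x, (H x).mem⟩
  obtain ⟨f, hf⟩ := SmoothPartitionOfUnity.exists_isSubordinate (𝓡 m) (isClosed_tsupport θ)
    (fun i : t ↦ U i) (fun i ↦ (H i).isOpen) (by simpa [Set.iUnion_subtype] using ht)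
  have h1 : ∀ i, ContMDiff (𝓡 m) 𝓘(ℝ) ∞ fun x ↦ f i x * θ x := fun i ↦ (f i).contMDiff.mul hθ
  have h2 : (fun x ↦ ∑ i, f i x * θ x) = θ := by
    funext x
    by_cases hx : x ∈ tsupport θ
    · rw [← Finset.sum_mul, ← finsum_eq_sum_of_fintype, f.sum_eq_one hx, one_mul]
    · simp [image_eq_zero_of_notMem_tsupport hx]
  have h3 := h.isApproximable_sum_smul hcov Finset.univ h1 fun i ↦
    (H i).isApproximable_smul hcov h.1 h.2 h.3 h.4 h.5 (h1 i) hθc.mul_left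
      ((tsupport_mul_subset_left).trans (hf i))
  have h4 : ∀ x, ∑ i, f i x * θ x = θ x := congrFun h2
  simpa only [h4] using h3

/-- Approximates `χ s` for a compactly supported `χ` equal to `1` near `K`: on `K` both `χ s = s`
and `χ v + dχ ⊗ s = v`. -/
theorem exists_isTestSection_lintegral_le (h : HasWeakCovariantDerivative cov s v)
    (hcov : IsMetricConnection ℝ m F cov) {K : Set M} (hK : IsCompact K) {ε : ℝ≥0∞} (hε : 0 < ε) :
    ∃ u : ∀ x, V x, IsTestSection F m u ∧
      ∫⁻ x in K, ‖u x - s x‖ₑ ^ 2 ∂(riemannianMeasure m M) ≤ ε ∧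
      ∫⁻ x in K, ENNReal.ofReal (homNormSq (cov u x - v x)) ∂(riemannianMeasure m M) ≤ ε := by
  have : LocallyCompactSpace M := ChartedSpace.locallyCompactSpace (EuclideanSpace ℝ (Fin m)) M
  obtain ⟨K', hK', hKK'⟩ := exists_compact_superset hK
  obtain ⟨χ, hχ1, hχ0, -⟩ := exists_contMDiffMap_one_nhds_of_subset_interior (n := (⊤ : ℕ∞)) (𝓡 m)
    hK.isClosed hKK'
  obtain ⟨u, hu, hus, huv⟩ := h.isApproximable_smul hcov χ.contMDiff
    (HasCompactSupport.of_support_subset_isCompact hK' fun x hx ↦ by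
      by_contra h; exact hx (hχ0 x h))
  obtain ⟨n, hn1, hn2⟩ := ((hus.eventually_le_const hε).and (huv.eventually_le_const hε)).exists
  refine ⟨u n, hu n, le_trans ?_ hn1, le_trans ?_ hn2⟩
  · refine le_trans (le_of_eq ?_) (setLIntegral_le_lintegral K _)
    refine setLIntegral_congr_fun hK.measurableSet fun x hx ↦ ?_
    beta_reduce
    rw [(eventually_nhdsSet_iff_forall.1 hχ1 x hx).self_of_nhds, one_smul]
  · refine le_trans (le_of_eq ?_) (setLIntegral_le_lintegral K _)
    refine setLIntegral_congr_fun hK.measurableSet fun x hx ↦ ?_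
    have h1 := eventually_nhdsSet_iff_forall.1 hχ1 x hx
    beta_reduce
    rw [h1.self_of_nhds, one_smul, mvfderiv_eq_zero_of_eventuallyEq_const h1]
    congr 3
    ext; simp

end HasWeakCovariantDerivative

end Global

/-! ### Convergence lemmas. -/

section MeasureLemmas

/-- The sum of all `f n` has finite integral, so it converges almost everywhere and its terms tend
to zero. Geometric bounds thus make the passage to a subsequence unnecessary. -/
theorem ae_tendsto_zero_of_lintegral_le {α : Type*} [MeasurableSpace α] {μ : Measure α}
    {f : ℕ → α → ℝ≥0∞} (hf : ∀ n, AEMeasurable (f n) μ)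
    (h : ∀ n, ∫⁻ x, f n x ∂μ ≤ 2⁻¹ ^ n) : ∀ᵐ x ∂μ, Tendsto (fun n ↦ f n x) atTop (𝓝 0) := by
  have h1 : ∫⁻ x, ∑' n, f n x ∂μ ≠ ⊤ := by
    rw [lintegral_tsum hf]
    refine ne_top_of_le_ne_top ?_ (ENNReal.tsum_le_tsum h)
    rw [ENNReal.tsum_geometric]
    simp
  filter_upwards [ae_lt_top' (AEMeasurable.ennreal_tsum hf) h1] with x hx
  exact ENNReal.tendsto_atTop_zero_of_tsum_ne_top hx.ne

theorem tendsto_norm_zero_of_enorm_sq {W : Type*} [NormedAddCommGroup W] {y : ℕ → W}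
    (h : Tendsto (fun n ↦ ‖y n‖ₑ ^ 2) atTop (𝓝 0)) : Tendsto (fun n ↦ ‖y n‖) atTop (𝓝 0) := by
  have h1 := (ENNReal.tendsto_toReal ENNReal.zero_ne_top).comp h
  have h2 := (Real.continuous_sqrt.tendsto _).comp h1
  simpa [Function.comp_def] using h2

theorem tendsto_lintegral_ofReal_mul_zero {α : Type*} [MeasurableSpace α] {μ : Measure α}
    {c : ℕ → α → ℝ} {G : α → ℝ} {B : ℝ} (hc : ∀ n, AEMeasurable (c n) μ)
    (hcB : ∀ n x, c n x ≤ B) (hc0 : ∀ᵐ x ∂μ, Tendsto (fun n ↦ c n x) atTop (𝓝 0))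
    (hGm : AEMeasurable G μ) (hG0 : ∀ x, 0 ≤ G x) (hG : ∫⁻ x, ENNReal.ofReal (G x) ∂μ < ⊤) :
    Tendsto (fun n ↦ ∫⁻ x, ENNReal.ofReal (c n x * G x) ∂μ) atTop (𝓝 0) := by
  have h := tendsto_lintegral_of_dominated_convergence' (μ := μ) (f := fun _ ↦ 0)
    (F := fun n x ↦ ENNReal.ofReal (c n x * G x)) (fun x ↦ ENNReal.ofReal B * ENNReal.ofReal (G x))
    (fun n ↦ ((hc n).mul hGm).ennreal_ofReal) (fun n ↦ Eventually.of_forall fun x ↦ ?_) ?_ ?_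
  · simpa using h
  · beta_reduce
    rw [← ENNReal.ofReal_mul' (hG0 x)]
    exact ENNReal.ofReal_le_ofReal (mul_le_mul_of_nonneg_right (hcB n x) (hG0 x))
  · rw [lintegral_const_mul' _ _ ENNReal.ofReal_ne_top]
    exact (ENNReal.mul_lt_top ENNReal.ofReal_lt_top hG).ne
  · filter_upwards [hc0] with x hx
    have h1 := ENNReal.tendsto_ofReal (hx.mul_const (G x))
    simpa using h1

end MeasureLemmas

/-! ### Smooth cut-off functions with small differential. -/

section Cutoffs

variable {m : ℕ} {M : Type*} [TopologicalSpace M] [T2Space M] [SecondCountableTopology M]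
  [ChartedSpace (EuclideanSpace ℝ (Fin m)) M] [IsManifold (𝓡 m) ∞ M]
  [RiemannianBundle (fun x : M ↦ TangentSpace (𝓡 m) x)]
  [IsContMDiffRiemannianBundle (𝓡 m) ∞ (EuclideanSpace ℝ (Fin m))
    (fun x : M ↦ TangentSpace (𝓡 m) x)]
  [MeasurableSpace M] [BorelSpace M]

omit [T2Space M] [SecondCountableTopology M] [IsManifold (𝓡 m) ∞ M] [MeasurableSpace M]
  [BorelSpace M] [RiemannianBundle (fun x : M ↦ TangentSpace (𝓡 m) x)]
  [IsContMDiffRiemannianBundle (𝓡 m) ∞ (EuclideanSpace ℝ (Fin m))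
    (fun x : M ↦ TangentSpace (𝓡 m) x)] in
theorem MetricSobolev.IsSmoothSection.contMDiff {f : M → ℝ}
    (hf : IsSmoothSection ℝ (V := Bundle.Trivial M ℝ) m f) : ContMDiff (𝓡 m) 𝓘(ℝ) ∞ f := fun x ↦
  (Bundle.contMDiffAt_section (E := Bundle.Trivial M ℝ) x).1 (hf x)

theorem ContMDiff.hasMeasurableFormCoeffs_mvfderiv {μ : Measure M} {f : M → ℝ}
    (hf : ContMDiff (𝓡 m) 𝓘(ℝ) ∞ f) : HasMeasurableFormCoeffs m ℝ (V := Bundle.Trivial M ℝ) μ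
      (fun x ↦ (mvfderiv (𝓡 m) f x : TangentSpace (𝓡 m) x →L[ℝ] ℝ)) := fun X hX t ht ↦
  ((hf.contMDiff_mvfderiv_apply hX).continuous.inner ht.contMDiff.continuous).measurable.aemeasurable

theorem exists_isTestSection_lintegral_mvfderiv_le {φ : M → ℝ}
    {η : ∀ x : M, TangentSpace (𝓡 m) x →L[ℝ] ℝ} (h : IsMinExteriorDerivative m φ η) {ε : ℝ≥0∞}
    (hε : 0 < ε) : ∃ g : M → ℝ, ContMDiff (𝓡 m) 𝓘(ℝ) ∞ g ∧ HasCompactSupport g ∧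
      ∫⁻ x, ‖g x - φ x‖ₑ ^ 2 ∂(riemannianMeasure m M) ≤ ε ∧
      ∫⁻ x, ENNReal.ofReal (homNormSq (mvfderiv (𝓡 m) g x)) ∂(riemannianMeasure m M) ≤
        2 * ε + 2 * formNormSqL2 m (V := Bundle.Trivial M ℝ) η := by
  obtain ⟨hφ, hη, u, hu, hu1, hu2⟩ := h
  obtain ⟨n, hn1, hn2⟩ := ((hu1.eventually_le_const hε).and (hu2.eventually_le_const hε)).exists
  have hus := (hu n).1.contMDiff
  refine ⟨u n, hus, (hu n).2, hn1, ?_⟩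
  have hm : HasMeasurableFormCoeffs m ℝ (V := Bundle.Trivial M ℝ) (riemannianMeasure m M) η :=
    hη.1.hasMeasurableFormCoeffs
  have h1 := formNormSqL2_add_le (B := η) (hus.hasMeasurableFormCoeffs_mvfderiv.sub hm)
  refine (le_of_eq ?_).trans (h1.trans (add_le_add (mul_le_mul_right hn2 _) le_rfl))
  simp only [sub_add_cancel]
  rfl

/-- Smooth approximations `g j` of `φ j` need not stay bounded by one. Composition with `t ↦ sin (π
t / 2)` bounds them; since this map fixes `0` and `1` and has slope at most `π / 2`, it preserves
compact support, the limit `1` and the decay of the differentials. -/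
theorem exists_smooth_cutoffs {φ : ℕ → M → ℝ}
    (hφ_lim : ∀ x, Tendsto (fun j ↦ φ j x) atTop (𝓝 1))
    {η : ℕ → ∀ x : M, TangentSpace (𝓡 m) x →L[ℝ] ℝ}
    (hη : ∀ j, IsMinExteriorDerivative m (φ j) (η j))
    (hη_lim : Tendsto (fun j ↦ formNormSqL2 m (V := Bundle.Trivial M ℝ) (η j)) atTop (𝓝 0)) :
    ∃ θ : ℕ → M → ℝ, (∀ j, ContMDiff (𝓡 m) 𝓘(ℝ) ∞ (θ j)) ∧ (∀ j, HasCompactSupport (θ j)) ∧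
      (∀ j x, |θ j x| ≤ 1) ∧
      (∀ᵐ x ∂(riemannianMeasure m M), Tendsto (fun j ↦ θ j x) atTop (𝓝 1)) ∧
      Tendsto (fun j ↦ ∫⁻ x, ENNReal.ofReal (homNormSq (mvfderiv (𝓡 m) (θ j) x))
        ∂(riemannianMeasure m M)) atTop (𝓝 0) := by
  have hpos : ∀ n : ℕ, (0 : ℝ≥0∞) < 2⁻¹ ^ n := fun n ↦ ENNReal.pow_pos (by simp) n
  choose g hg hgc hgφ hgη using fun j ↦ exists_isTestSection_lintegral_mvfderiv_le (hη j) (hpos j)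
  have hφm : ∀ j, AEMeasurable (φ j) (riemannianMeasure m M) := fun j ↦ by
    have h1 := (hη j).1.1.aemeasurable_inner (V := Bundle.Trivial M ℝ) (m := m)
      (t := fun _ ↦ (1 : ℝ)) (fun x ↦ (Bundle.contMDiffAt_section (E := Bundle.Trivial M ℝ) x).2
        contMDiffAt_const)
    refine h1.congr (Eventually.of_forall fun x ↦ ?_)
    exact one_mul (φ j x)
  have hae := ae_tendsto_zero_of_lintegral_le (μ := riemannianMeasure m M)
    (fun j ↦ (((hg j).continuous.aemeasurable.sub (hφm j)).enorm.pow_const 2)) hgφ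
  refine ⟨fun j x ↦ Real.sin (Real.pi / 2 * g j x), fun j ↦ ?_, fun j ↦ ?_,
    fun j x ↦ Real.abs_sin_le_one _, ?_, ?_⟩
  · exact (Real.contDiff_sin.contMDiff).comp (contMDiff_const.mul (hg j))
  · exact (hgc j).comp_left (g := fun t ↦ Real.sin (Real.pi / 2 * t)) (by simp)
  · filter_upwards [hae] with x hx
    have h1 : Tendsto (fun j ↦ g j x) atTop (𝓝 1) := by
      have h2 := tendsto_zero_iff_norm_tendsto_zero.2 (tendsto_norm_zero_of_enorm_sq hx)
      simpa using h2.add (hφ_lim x)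
    have h3 : Continuous fun t : ℝ ↦ Real.sin (Real.pi / 2 * t) := by fun_prop
    simpa [Function.comp_def] using (h3.tendsto 1).comp h1
  · have h0 : Tendsto (fun n : ℕ ↦ (2⁻¹ : ℝ≥0∞) ^ n) atTop (𝓝 0) :=
      ENNReal.tendsto_pow_atTop_nhds_zero_of_lt_one (by simp)
    have h1 := ENNReal.Tendsto.const_mul (a := ENNReal.ofReal ((Real.pi / 2) ^ 2))
      (tendsto_two_mul_add_two_mul_zero h0 hη_lim) (Or.inr ENNReal.ofReal_ne_top)
    rw [mul_zero] at h1
    refine tendsto_of_tendsto_of_tendsto_of_le_of_le tendsto_const_nhds h1 (fun _ ↦ zero_le)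
      fun j ↦ ?_
    refine le_trans ?_ (mul_le_mul_right (hgη j) _)
    rw [← lintegral_const_mul' _ _ ENNReal.ofReal_ne_top]
    refine lintegral_mono fun x ↦ ?_
    have h2 : HasDerivAt (fun t : ℝ ↦ Real.sin (Real.pi / 2 * t))
        (Real.cos (Real.pi / 2 * g j x) * (Real.pi / 2)) (g j x) := by
      have := (hasDerivAt_id (g j x)).const_mul (Real.pi / 2)
      simpa using this.sin
    beta_reduce
    rw [mvfderiv_comp_of_hasDerivAt ((hg j).contMDiffAt.mdifferentiableAt (by simp)) h2,
      homNormSq_smul, ← ENNReal.ofReal_mul (by positivity)]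
    refine ENNReal.ofReal_le_ofReal (mul_le_mul_of_nonneg_right ?_ (homNormSq_nonneg _))
    rw [mul_pow]
    exact mul_le_of_le_one_left (by positivity) (Real.cos_sq_le_one _)

end Cutoffs

/-! ### Smooth truncation of sections. -/

section Truncation

variable {m : ℕ} {M : Type*} [TopologicalSpace M] [T2Space M] [SecondCountableTopology M]
  [ChartedSpace (EuclideanSpace ℝ (Fin m)) M] [IsManifold (𝓡 m) ∞ M]
  [RiemannianBundle (fun x : M ↦ TangentSpace (𝓡 m) x)]
  [IsContMDiffRiemannianBundle (𝓡 m) ∞ (EuclideanSpace ℝ (Fin m))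
    (fun x : M ↦ TangentSpace (𝓡 m) x)]
  [MeasurableSpace M] [BorelSpace M]
  {F : Type*} [NormedAddCommGroup F] [NormedSpace ℝ F] [FiniteDimensional ℝ F]
  {V : M → Type*} [TopologicalSpace (TotalSpace F V)]
  [∀ x, NormedAddCommGroup (V x)] [∀ x, InnerProductSpace ℝ (V x)]
  [FiberBundle F V] [VectorBundle ℝ F V] [ContMDiffVectorBundle ∞ F V (𝓡 m)]
  [IsContMDiffRiemannianBundle (𝓡 m) ∞ F V]
  {cov : CovariantDerivative (𝓡 m) F V}

theorem homNormSq_add_add_add_le {T W : Type*} [NormedAddCommGroup T] [InnerProductSpace ℝ T]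
    [FiniteDimensional ℝ T] [NormedAddCommGroup W] [NormedSpace ℝ W] (A B C D : T →L[ℝ] W) :
    homNormSq (A + B + (C + D)) ≤
      4 * homNormSq A + 4 * homNormSq B + 4 * homNormSq C + 4 * homNormSq D := by
  have h1 := homNormSq_add_le (A + B) (C + D)
  have h2 := homNormSq_add_le A B
  have h3 := homNormSq_add_le C D
  linarith

theorem homNormSq_smulRight_inner_le {T W : Type*} [NormedAddCommGroup T] [InnerProductSpace ℝ T]
    [FiniteDimensional ℝ T] [NormedAddCommGroup W] [InnerProductSpace ℝ W] (A : T →L[ℝ] W) (u : W)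
    (l : T →L[ℝ] ℝ) (hl : ∀ X, l X = inner ℝ (A X) u) :
    homNormSq (l.smulRight u) ≤ (‖u‖ ^ 2) ^ 2 * homNormSq A := by
  rw [homNormSq, homNormSq, Finset.mul_sum]
  refine Finset.sum_le_sum fun i _ ↦ ?_
  rw [ContinuousLinearMap.smulRight_apply, norm_smul, hl, mul_pow, Real.norm_eq_abs]
  have h1 := pow_le_pow_left₀ (abs_nonneg _) (abs_real_inner_le_norm
    (A (stdOrthonormalBasis ℝ T i)) u) 2
  calc _ ≤ (‖A (stdOrthonormalBasis ℝ T i)‖ * ‖u‖) ^ 2 * ‖u‖ ^ 2 := by gcongr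
    _ = _ := by ring

/-- The factor `(1 + λ |u|²)⁻¹` that truncates `u` smoothly. -/
noncomputable def truncation (l : ℝ) (u : ∀ x, V x) (x : M) : ℝ :=
  (1 + l * inner ℝ (u x) (u x))⁻¹

omit [∀ x, InnerProductSpace ℝ (V x)] in
theorem one_le_one_add_mul_inner {l : ℝ} (hl : 0 ≤ l) [∀ x, InnerProductSpace ℝ (V x)]
    (u : ∀ x, V x) (x : M) : 1 ≤ 1 + l * inner ℝ (u x) (u x) :=
  le_add_of_nonneg_right (mul_nonneg hl real_inner_self_nonneg)

theorem contMDiff_truncation {l : ℝ} (hl : 0 ≤ l) {u : ∀ x, V x} (hu : IsSmoothSection F m u) :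
    ContMDiff (𝓡 m) 𝓘(ℝ) ∞ (truncation l u) := fun x ↦
  ContMDiffAt.inv₀ ((contMDiff_const.add (contMDiff_const.mul (hu.contMDiff_inner hu))) x)
    (zero_lt_one.trans_le (one_le_one_add_mul_inner hl u x)).ne'

theorem mvfderiv_truncation (hcov : IsMetricConnection ℝ m F cov) {l : ℝ} (hl : 0 ≤ l)
    {u : ∀ x, V x} (hu : IsSmoothSection F m u) (x : M) (X : TangentSpace (𝓡 m) x) :
    mvfderiv (𝓡 m) (truncation l u) x X =
      -(2 * l * truncation l u x ^ 2) * inner ℝ (cov u x X) (u x) := by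
  have hpos := (zero_lt_one.trans_le (one_le_one_add_mul_inner hl u x)).ne'
  have h1 : HasDerivAt (fun t : ℝ ↦ (1 + l * t)⁻¹)
      (-(l) / (1 + l * inner ℝ (u x) (u x)) ^ 2) (inner ℝ (u x) (u x)) := by
    have := (((hasDerivAt_id (inner ℝ (u x) (u x) : ℝ)).const_mul l).const_add 1).inv hpos
    simpa using! this
  have h2 := mvfderiv_comp_of_hasDerivAt
    ((hu.contMDiff_inner hu).contMDiffAt.mdifferentiableAt (by simp)) h1
  have h3 : mvfderiv (𝓡 m) (truncation l u) x X = -(l) / (1 + l * inner ℝ (u x) (u x)) ^ 2 *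
      mvfderiv (𝓡 m) (fun y ↦ (inner ℝ (u y) (u y) : ℝ)) x X := DFunLike.congr_fun h2 X
  rw [h3, hcov.metric u u hu hu, real_inner_comm (cov u x X) (u x), truncation]
  field_simp
  ring

/-- The estimate for `∇ (θ u / (1 + λ |u|²)) - v`. -/
theorem homNormSq_cov_truncation_sub_le (hcov : IsMetricConnection ℝ m F cov) {l : ℝ} (hl : 0 < l)
    {u : ∀ x, V x} (hu : IsSmoothSection F m u) {θ : M → ℝ} (hθ : ContMDiff (𝓡 m) 𝓘(ℝ) ∞ θ)
    (x : M) (v : TangentSpace (𝓡 m) x →L[ℝ] V x) :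
    homNormSq (cov (fun y ↦ (θ y * truncation l u y) • u y) x - v) ≤
      l⁻¹ * homNormSq (mvfderiv (𝓡 m) θ x) + 6 * (θ x ^ 2 * homNormSq (cov u x - v)) +
      (4 * (θ x * truncation l u x - 1) ^ 2 + 32 * θ x ^ 2 *
        (l * ‖u x‖ ^ 2 * truncation l u x ^ 2) ^ 2) * homNormSq v := by
  have hf := contMDiff_truncation hl.le hu
  have hfx : truncation l u x = (1 + l * ‖u x‖ ^ 2)⁻¹ := by
    rw [truncation, real_inner_self_eq_norm_sq]
  set f := truncation l u
  set t := l * ‖u x‖ ^ 2 with ht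
  have ht0 : 0 ≤ t := by positivity
  have hf0 : 0 ≤ f x := by rw [hfx]; positivity
  have hf1 : f x ≤ 1 := by rw [hfx]; exact inv_le_one_of_one_le₀ (by linarith)
  -- This is `4t ≤ (1 + t)²`. It bounds `|f u|²` by `1/(4λ)`, which tames `dθ ⊗ f u`, and it also
  -- bounds the derivative of the truncation factor.
  have hft : t * f x ^ 2 ≤ 1 / 4 := by
    rw [hfx, inv_pow, ← div_eq_mul_inv, div_le_div_iff₀ (by positivity) (by norm_num)]
    nlinarith [sq_nonneg (1 - t)]
  have hft0 : 0 ≤ t * f x ^ 2 := by positivity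
  -- the derivative of the truncation factor
  set L : TangentSpace (𝓡 m) x →L[ℝ] ℝ := (innerSL ℝ (u x)).comp (cov u x) with hL
  have hLX : ∀ X, L X = inner ℝ (cov u x X) (u x) := fun X ↦ by
    rw [hL, ContinuousLinearMap.comp_apply, innerSL_apply_apply, real_inner_comm]
  -- The Leibniz rule gives `f dθ ⊗ u + θ f ∇u + θ df ⊗ u`; the middle term is split by `∇u = (∇u -
  -- v) + v`.
  have hdec : cov (fun y ↦ (θ y * f y) • u y) x - v =
      f x • (mvfderiv (𝓡 m) θ x).smulRight (u x) + (θ x * f x) • (cov u x - v) +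
      ((θ x * f x - 1) • v + (θ x * (-(2 * l * f x ^ 2))) • L.smulRight (u x)) := by
    have h1 : mvfderiv (𝓡 m) (fun y ↦ θ y * f y) x =
        θ x • mvfderiv (𝓡 m) f x + f x • mvfderiv (𝓡 m) θ x :=
      mvfderiv_mul (hθ.contMDiffAt.mdifferentiableAt (by simp))
        (hf.contMDiffAt.mdifferentiableAt (by simp))
    have hθf : ContMDiff (𝓡 m) 𝓘(ℝ) ∞ fun y ↦ θ y * f y := hθ.mul hf
    rw [cov_smul hu hθf]
    have h2 : ∀ X, mvfderiv (𝓡 m) (fun y ↦ θ y * f y) x X =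
        θ x * (-(2 * l * f x ^ 2) * L X) + f x * mvfderiv (𝓡 m) θ x X := fun X ↦ by
      rw [h1, hLX, ← mvfderiv_truncation hcov hl.le hu x X]
      rfl
    refine ContinuousLinearMap.ext fun X ↦ ?_
    have h3 : ((θ x * f x) • cov u x + (mvfderiv (𝓡 m) (fun y ↦ θ y * f y) x).smulRight (u x) - v) X
        = (θ x * f x) • cov u x X + (mvfderiv (𝓡 m) (fun y ↦ θ y * f y) x X) • u x - v X := rfl
    have h4 : (f x • (mvfderiv (𝓡 m) θ x).smulRight (u x) + (θ x * f x) • (cov u x - v) +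
      ((θ x * f x - 1) • v + (θ x * (-(2 * l * f x ^ 2))) • L.smulRight (u x))) X =
      f x • mvfderiv (𝓡 m) θ x X • u x + (θ x * f x) • (cov u x X - v X) +
      ((θ x * f x - 1) • v X + (θ x * (-(2 * l * f x ^ 2))) • L X • u x) := rfl
    refine h3.trans (Eq.trans ?_ h4.symm)
    rw [h2]
    module
  rw [hdec]
  refine (homNormSq_add_add_add_le _ _ _ _).trans ?_
  rw [homNormSq_smul, homNormSq_smul, homNormSq_smul, homNormSq_smul, homNormSq_smulRight]
  have e1 : 4 * (f x ^ 2 * (homNormSq (mvfderiv (𝓡 m) θ x) * ‖u x‖ ^ 2)) ≤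
      l⁻¹ * homNormSq (mvfderiv (𝓡 m) θ x) := by
    have h := homNormSq_nonneg (mvfderiv (𝓡 m) θ x)
    have h5 : 4 * (f x ^ 2 * ‖u x‖ ^ 2) ≤ l⁻¹ := by
      rw [← one_div, le_div_iff₀ hl]
      calc _ = 4 * (t * f x ^ 2) := by rw [ht]; ring
        _ ≤ 1 := by linarith
    calc _ = 4 * (f x ^ 2 * ‖u x‖ ^ 2) * homNormSq (mvfderiv (𝓡 m) θ x) := by ring
      _ ≤ _ := mul_le_mul_of_nonneg_right h5 h
  have hN := homNormSq_nonneg (cov u x - v)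
  have hv := homNormSq_nonneg v
  have e2 : 4 * ((θ x * f x) ^ 2 * homNormSq (cov u x - v)) ≤
      4 * (θ x ^ 2 * homNormSq (cov u x - v)) := by
    have : (θ x * f x) ^ 2 ≤ θ x ^ 2 := by
      rw [mul_pow]
      exact mul_le_of_le_one_right (sq_nonneg _) (pow_le_one₀ hf0 hf1)
    gcongr
  -- `∇u` is compared with `v` once more, since only `∇u - v` is small and only `v` is a fixed
  -- function suited to dominated convergence.
  have e3 : homNormSq (L.smulRight (u x)) ≤ (‖u x‖ ^ 2) ^ 2 *
      (2 * homNormSq (cov u x - v) + 2 * homNormSq v) := by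
    refine (homNormSq_smulRight_inner_le (cov u x) (u x) L hLX).trans ?_
    have h := homNormSq_add_le (cov u x - v) v
    rw [sub_add_cancel] at h
    gcongr
  -- By `t f² ≤ 1/4` the coefficient `32 (t f²)²` of `|∇u - v|²` is at most `2`, which with the `4`
  -- of `e2` makes the `6` of the statement. In front of `|v|²` the factor is kept, as it tends to
  -- zero with `λ`.
  have e4 : 4 * ((θ x * (-(2 * l * f x ^ 2))) ^ 2 * homNormSq (L.smulRight (u x))) ≤
      2 * (θ x ^ 2 * homNormSq (cov u x - v)) +
        32 * θ x ^ 2 * (t * f x ^ 2) ^ 2 * homNormSq v := by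
    calc _ ≤ 4 * ((θ x * (-(2 * l * f x ^ 2))) ^ 2 * ((‖u x‖ ^ 2) ^ 2 *
          (2 * homNormSq (cov u x - v) + 2 * homNormSq v))) := by gcongr
      _ = 32 * (t * f x ^ 2) ^ 2 * (θ x ^ 2 * homNormSq (cov u x - v)) +
          32 * θ x ^ 2 * (t * f x ^ 2) ^ 2 * homNormSq v := by rw [ht]; ring
      _ ≤ _ := by
        have h6 : (t * f x ^ 2) ^ 2 ≤ (1 / 4) ^ 2 := by gcongr
        have h7 : 0 ≤ θ x ^ 2 * homNormSq (cov u x - v) := by positivity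
        gcongr
        linarith
  linarith

theorem norm_truncation_sub_sq_le {l : ℝ} (hl : 0 ≤ l) (u : ∀ x, V x) (θ : M → ℝ) (x : M)
    (s : V x) :
    ‖(θ x * truncation l u x) • u x - s‖ ^ 2 ≤
      2 * (θ x ^ 2 * ‖u x - s‖ ^ 2) + 2 * (θ x * truncation l u x - 1) ^ 2 * ‖s‖ ^ 2 := by
  have h1 : (θ x * truncation l u x) • u x - s =
      (θ x * truncation l u x) • (u x - s) + (θ x * truncation l u x - 1) • s := by module
  have h0 := one_le_one_add_mul_inner hl u x
  have hf0 : 0 ≤ truncation l u x := inv_nonneg.2 (by linarith)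
  have hf1 : truncation l u x ≤ 1 := inv_le_one_of_one_le₀ h0
  rw [h1]
  refine (norm_add_sq_le_two_mul _ _).trans ?_
  rw [norm_smul, norm_smul, mul_pow, mul_pow, Real.norm_eq_abs, Real.norm_eq_abs, sq_abs, sq_abs,
    ← mul_assoc 2 ((_ - 1 : ℝ) ^ 2)]
  have hsq : (θ x * truncation l u x) ^ 2 ≤ θ x ^ 2 := by
    rw [mul_pow]
    exact mul_le_of_le_one_right (sq_nonneg _) (pow_le_one₀ hf0 hf1)
  gcongr 2 * (?_ * _) + _

end Truncation

/-! ### Density of test sections among weak solutions. -/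

section Density

variable {m : ℕ} {M : Type*} [TopologicalSpace M] [T2Space M] [SecondCountableTopology M]
  [ChartedSpace (EuclideanSpace ℝ (Fin m)) M] [IsManifold (𝓡 m) ∞ M]
  [RiemannianBundle (fun x : M ↦ TangentSpace (𝓡 m) x)]
  [IsContMDiffRiemannianBundle (𝓡 m) ∞ (EuclideanSpace ℝ (Fin m))
    (fun x : M ↦ TangentSpace (𝓡 m) x)]
  [MeasurableSpace M] [BorelSpace M]
  {F : Type*} [NormedAddCommGroup F] [NormedSpace ℝ F] [FiniteDimensional ℝ F]
  {V : M → Type*} [TopologicalSpace (TotalSpace F V)]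
  [∀ x, NormedAddCommGroup (V x)] [∀ x, InnerProductSpace ℝ (V x)]
  [FiberBundle F V] [VectorBundle ℝ F V] [ContMDiffVectorBundle ∞ F V (𝓡 m)]
  [IsContMDiffRiemannianBundle (𝓡 m) ∞ F V]
  {cov : CovariantDerivative (𝓡 m) F V}

/-- Positive numbers `λ_j → 0` such that `k_j / λ_j → 0`, for given `k_j → 0`. -/
theorem exists_seq_pos_tendsto_zero_mul {k : ℕ → ℝ≥0∞} (hk : Tendsto k atTop (𝓝 0)) :
    ∃ l : ℕ → ℝ, (∀ j, 0 < l j) ∧ Tendsto l atTop (𝓝 0) ∧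
      Tendsto (fun j ↦ ENNReal.ofReal (l j)⁻¹ * k j) atTop (𝓝 0) := by
  have h1 : Tendsto (fun j ↦ (k j).toReal) atTop (𝓝 0) := by
    simpa [Function.comp_def] using (ENNReal.tendsto_toReal ENNReal.zero_ne_top).comp hk
  have h2 : ∀ j, 0 < (k j).toReal + 1 / ((j : ℝ) + 1) := fun j ↦
    add_pos_of_nonneg_of_pos ENNReal.toReal_nonneg (by positivity)
  have h3 : Tendsto (fun j ↦ √((k j).toReal + 1 / ((j : ℝ) + 1))) atTop (𝓝 0) := by
    have := (Real.continuous_sqrt.tendsto _).comp (h1.add tendsto_one_div_add_atTop_nhds_zero_nat)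
    simpa [Function.comp_def] using this
  -- From `k j ≤ (l j)²` follows `k j / l j ≤ l j`; the summand `1 / (j + 1)` guarantees positivity.
  -- If `k j = ⊤`, then `toReal` is `0`, but this happens for finitely many `j` only.
  refine ⟨fun j ↦ √((k j).toReal + 1 / ((j : ℝ) + 1)), fun j ↦ Real.sqrt_pos.2 (h2 j), h3, ?_⟩
  have h4 : Tendsto (fun j ↦ ENNReal.ofReal √((k j).toReal + 1 / ((j : ℝ) + 1))) atTop (𝓝 0) := by
    simpa using ENNReal.tendsto_ofReal h3
  refine tendsto_of_tendsto_of_tendsto_of_le_of_le' tendsto_const_nhds h4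
    (Eventually.of_forall fun _ ↦ zero_le) ?_
  filter_upwards [hk.eventually_lt_const ENNReal.zero_lt_top] with j hj
  rw [← ENNReal.ofReal_toReal hj.ne, ← ENNReal.ofReal_mul (by positivity),
    ENNReal.ofReal_toReal hj.ne]
  refine ENNReal.ofReal_le_ofReal ?_
  have h5 := Real.sqrt_pos.2 (h2 j)
  rw [inv_mul_le_iff₀ h5, Real.mul_self_sqrt (h2 j).le]
  exact le_add_of_nonneg_right (by positivity)

/-- The approximants are `θ_j u_j / (1 + λ_j |u_j|²)`. Truncating the smooth `u_j` rather than `s`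
keeps them test sections and avoids a chain rule for weak derivatives. -/
theorem HasWeakCovariantDerivative.isApproximable {s : ∀ x, V x}
    {v : ∀ x : M, TangentSpace (𝓡 m) x →L[ℝ] V x} (h : HasWeakCovariantDerivative cov s v)
    (hcov : IsMetricConnection ℝ m F cov) {θ : ℕ → M → ℝ}
    (hθ : ∀ j, ContMDiff (𝓡 m) 𝓘(ℝ) ∞ (θ j)) (hθc : ∀ j, HasCompactSupport (θ j))
    (hθ1 : ∀ j x, |θ j x| ≤ 1)
    (hθ_lim : ∀ᵐ x ∂(riemannianMeasure m M), Tendsto (fun j ↦ θ j x) atTop (𝓝 1))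
    (hdθ : Tendsto (fun j ↦ ∫⁻ x, ENNReal.ofReal (homNormSq (mvfderiv (𝓡 m) (θ j) x))
        ∂(riemannianMeasure m M)) atTop (𝓝 0)) :
    IsApproximable cov s v := by
  set μ := riemannianMeasure m M with hμ
  have hpos : ∀ n : ℕ, (0 : ℝ≥0∞) < 2⁻¹ ^ n := fun n ↦ ENNReal.pow_pos (by simp) n
  have hpow : Tendsto (fun n : ℕ ↦ (2⁻¹ : ℝ≥0∞) ^ n) atTop (𝓝 0) :=
    ENNReal.tendsto_pow_atTop_nhds_zero_of_lt_one (by simp)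
  -- `u j` is close to `s` only on the support of `θ j`, with summable errors `2⁻ʲ`.
  choose u hu hus huv using fun j ↦
    h.exists_isTestSection_lintegral_le hcov (hθc j).isCompact (hpos j)
  obtain ⟨l, hl, hl0, hlk⟩ := exists_seq_pos_tendsto_zero_mul hdθ
  set f : ℕ → M → ℝ := fun j ↦ truncation (l j) (u j) with hf
  have hfs : ∀ j, ContMDiff (𝓡 m) 𝓘(ℝ) ∞ (f j) := fun j ↦ contMDiff_truncation (hl j).le (hu j).1
  have hf0 : ∀ j x, 0 ≤ f j x := fun j x ↦ by
    have := one_le_one_add_mul_inner (hl j).le (u j) x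
    exact inv_nonneg.2 (by linarith)
  have hf1 : ∀ j x, f j x ≤ 1 := fun j x ↦
    inv_le_one_of_one_le₀ (one_le_one_add_mul_inner (hl j).le (u j) x)
  have hum : ∀ j, HasMeasurableCoeffs m F μ (fun x ↦ u j x - s x) := fun j ↦
    (hu j).1.hasMeasurableCoeffs.sub h.hasMeasurableCoeffs
  have hcum : ∀ j, HasMeasurableFormCoeffs m F μ (fun x ↦ cov (u j) x - v x) := fun j ↦
    (isSmoothSection_cov hcov.smooth (hu j).1).hasMeasurableFormCoeffs.sub
      h.hasMeasurableFormCoeffs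
  -- pointwise convergence
  have hKm : ∀ j, MeasurableSet (tsupport (θ j)) := fun j ↦ (isClosed_tsupport _).measurableSet
  have hae := ae_tendsto_zero_of_lintegral_le (μ := μ)
    (f := fun j ↦ (tsupport (θ j)).indicator fun x ↦ ‖u j x - s x‖ₑ ^ 2)
    (fun j ↦ (hum j).aemeasurable_enorm_sq.indicator (hKm j))
    fun j ↦ by rw [lintegral_indicator (hKm j)]; exact hus j
  have hlim : ∀ᵐ x ∂μ, Tendsto (fun j ↦ θ j x) atTop (𝓝 1) ∧
      Tendsto (fun j ↦ l j * ‖u j x‖ ^ 2) atTop (𝓝 0) := by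
    filter_upwards [hae, hθ_lim] with x hx hθx
    refine ⟨hθx, ?_⟩
    have h1 : Tendsto (fun j ↦ ‖u j x - s x‖ₑ ^ 2) atTop (𝓝 0) := by
      refine hx.congr' ?_
      -- As `θ j x → 1`, almost every `x` eventually lies in the supports, so there `u j x → s x`
      -- and `l j * ‖u j x‖ ^ 2 → 0`.
      filter_upwards [hθx.eventually_const_lt zero_lt_one] with j hj
      rw [Set.indicator_of_mem]
      exact subset_tsupport _ hj.ne'
    have h2 := tendsto_norm_zero_of_enorm_sq h1
    have h3 : Tendsto (fun j ↦ u j x) atTop (𝓝 (s x)) := tendsto_iff_norm_sub_tendsto_zero.2 h2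
    simpa using hl0.mul (h3.norm.pow 2)
  have hfeq : ∀ j x, f j x = (1 + l j * ‖u j x‖ ^ 2)⁻¹ := fun j x ↦ by
    simp only [hf, truncation, real_inner_self_eq_norm_sq]
  have hflim : ∀ᵐ x ∂μ, Tendsto (fun j ↦ θ j x * f j x - 1) atTop (𝓝 0) := by
    filter_upwards [hlim] with x hx
    simp_rw [hfeq]
    have h1 := hx.1.mul ((hx.2.const_add 1).inv₀ (by norm_num))
    simpa using h1.sub_const 1
  have hθf : ∀ j x, (θ j x * f j x - 1) ^ 2 ≤ 4 := fun j x ↦ by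
    have h1 : |θ j x * f j x| ≤ 1 := by
      rw [abs_mul, abs_of_nonneg (hf0 j x)]
      exact mul_le_one₀ (hθ1 j x) (hf0 j x) (hf1 j x)
    rw [abs_le] at h1
    nlinarith
  have hum' : ∀ j, AEMeasurable (fun x ↦ ‖u j x‖ ^ 2) μ := fun j ↦ by
    simp_rw [← real_inner_self_eq_norm_sq]
    exact ((hu j).1.contMDiff_inner (hu j).1).continuous.aemeasurable
  -- The factor `θ_j²` confines the approximation errors to the set where `u j` approximates `s`.
  have hind : ∀ j (g : M → ℝ≥0∞), ∫⁻ x, ENNReal.ofReal (θ j x ^ 2) * g x ∂μ ≤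
      ∫⁻ x in tsupport (θ j), g x ∂μ := fun j g ↦ by
    rw [← lintegral_indicator (hKm j)]
    refine lintegral_mono fun x ↦ ?_
    by_cases hx : x ∈ tsupport (θ j)
    · rw [Set.indicator_of_mem hx]
      refine mul_le_of_le_one_left' ?_
      rw [ENNReal.ofReal_le_one, ← sq_abs]
      exact pow_le_one₀ (abs_nonneg _) (hθ1 j x)
    · simp [image_eq_zero_of_notMem_tsupport hx]
  refine ⟨fun j x ↦ (θ j x * f j x) • u j x, fun j ↦ (hu j).smul ((hθ j).mul (hfs j)), ?_, ?_⟩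
  · set c : ℕ → M → ℝ := fun j x ↦ 2 * (θ j x * f j x - 1) ^ 2 with hc
    have hcm : ∀ j, AEMeasurable (c j) μ := fun j ↦
      (((((hθ j).mul (hfs j)).continuous.sub continuous_const).pow 2).const_mul 2).aemeasurable
    have hsm : AEMeasurable (fun x ↦ ‖s x‖ ^ 2) μ := by
      simp_rw [← real_inner_self_eq_norm_sq]
      exact h.hasMeasurableCoeffs.aemeasurable_inner h.hasMeasurableCoeffs
    have hlt : ∫⁻ x, ENNReal.ofReal (‖s x‖ ^ 2) ∂μ < ⊤ := by
      simp_rw [ENNReal.ofReal_pow (norm_nonneg _), ofReal_norm]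
      exact h.normSqL2_lt_top
    have h1 := tendsto_lintegral_ofReal_mul_zero (B := 8) hcm (fun j x ↦ by
      have := hθf j x
      simp only [hc]
      linarith) (by
        filter_upwards [hflim] with x hx
        simpa using (hx.pow 2).const_mul 2) hsm (fun x ↦ sq_nonneg _) hlt
    have h2 := (ENNReal.Tendsto.const_mul (a := 2) hpow (by simp)).add h1
    rw [mul_zero, add_zero] at h2
    refine tendsto_of_tendsto_of_tendsto_of_le_of_le tendsto_const_nhds h2 (fun _ ↦ zero_le)
      fun j ↦ ?_
    refine le_trans ?_ (add_le_add (mul_le_mul_right ((hind j _).trans (hus j)) _) le_rfl)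
    have hm3 : AEMeasurable (fun x ↦ ENNReal.ofReal (c j x * ‖s x‖ ^ 2)) μ :=
      ((hcm j).mul hsm).ennreal_ofReal
    rw [← lintegral_const_mul' _ _ (by simp), ← lintegral_add_right' _ hm3]
    refine lintegral_mono fun x ↦ ?_
    beta_reduce
    have h3 := ENNReal.ofReal_le_ofReal
      (norm_truncation_sub_sq_le (hl j).le (u j) (θ j) x (s x))
    rw [ENNReal.ofReal_pow (norm_nonneg _), ofReal_norm, ENNReal.ofReal_add (by positivity)
      (by positivity), ENNReal.ofReal_mul (by norm_num), ENNReal.ofReal_mul (by positivity),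
      ENNReal.ofReal_pow (norm_nonneg (_ - _)), ofReal_norm] at h3
    simpa using h3
  · set c : ℕ → M → ℝ := fun j x ↦ 4 * (θ j x * f j x - 1) ^ 2 + 32 * θ j x ^ 2 *
      (l j * ‖u j x‖ ^ 2 * f j x ^ 2) ^ 2 with hc
    have hcm : ∀ j, AEMeasurable (c j) μ := fun j ↦
      ((((((hθ j).mul (hfs j)).continuous.sub continuous_const).pow 2).const_mul 4).aemeasurable).add
        ((((hθ j).continuous.pow 2).const_mul 32).aemeasurable.mul
          ((((hum' j).const_mul (l j)).mul ((hfs j).continuous.pow 2).aemeasurable).pow_const 2))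
    -- `18 = 4 · 4 + 32 · (1/4)²`.
    have hcB : ∀ j x, c j x ≤ 18 := fun j x ↦ by
      have h1 := hθf j x
      have h2 : l j * ‖u j x‖ ^ 2 * f j x ^ 2 ≤ 1 / 4 := by
        have := hl j
        rw [hfeq, inv_pow, ← div_eq_mul_inv, div_le_div_iff₀ (by positivity) (by norm_num)]
        nlinarith [sq_nonneg (1 - l j * ‖u j x‖ ^ 2)]
      have h3 : 0 ≤ l j * ‖u j x‖ ^ 2 * f j x ^ 2 := by
        have := hl j
        positivity
      have h4 : (l j * ‖u j x‖ ^ 2 * f j x ^ 2) ^ 2 ≤ (1 / 4) ^ 2 := by gcongr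
      have h5 : θ j x ^ 2 ≤ 1 := by
        rw [← sq_abs]
        exact pow_le_one₀ (abs_nonneg _) (hθ1 j x)
      have h6 : θ j x ^ 2 * (l j * ‖u j x‖ ^ 2 * f j x ^ 2) ^ 2 ≤ 1 * (1 / 4) ^ 2 := by gcongr
      simp only [hc]
      linarith
    have hc0 : ∀ᵐ x ∂μ, Tendsto (fun j ↦ c j x) atTop (𝓝 0) := by
      filter_upwards [hlim, hflim] with x hx hx'
      have h1 : Tendsto (fun j ↦ f j x) atTop (𝓝 1) := by
        simp_rw [hfeq]
        simpa using (hx.2.const_add 1).inv₀ (by norm_num)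
      simpa using ((hx'.pow 2).const_mul 4).add
        (((hx.1.pow 2).const_mul 32).mul ((hx.2.mul (h1.pow 2)).pow 2))
    have hvm := h.hasMeasurableFormCoeffs.aemeasurable_homNormSq
    have h1 := tendsto_lintegral_ofReal_mul_zero hcm hcB hc0 hvm (fun x ↦ homNormSq_nonneg _)
      h.formNormSqL2_lt_top
    -- The three contributions: `‖dθ_j‖²/λ_j` by the choice of `λ_j`, the approximation error `6 ·
    -- 2⁻ʲ`, and dominated convergence for the coefficient of `|v|²`.
    have h2 := hlk.add ((ENNReal.Tendsto.const_mul (a := 6) hpow (by simp)).add h1)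
    rw [mul_zero, add_zero, add_zero] at h2
    refine tendsto_of_tendsto_of_tendsto_of_le_of_le tendsto_const_nhds h2 (fun _ ↦ zero_le)
      fun j ↦ ?_
    refine le_trans ?_ (add_le_add le_rfl
      (add_le_add (mul_le_mul_right ((hind j _).trans (huv j)) _) le_rfl))
    have hm3 : AEMeasurable (fun x ↦ ENNReal.ofReal (c j x * homNormSq (v x))) μ :=
      ((hcm j).mul hvm).ennreal_ofReal
    have hm2 : AEMeasurable (fun x ↦ 6 * (ENNReal.ofReal (θ j x ^ 2) *
        ENNReal.ofReal (homNormSq (cov (u j) x - v x)))) μ :=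
      (((hθ j).continuous.pow 2).aemeasurable.ennreal_ofReal.mul
        (hcum j).aemeasurable_homNormSq.ennreal_ofReal).const_mul 6
    have hm4 : AEMeasurable (fun x ↦ 6 * (ENNReal.ofReal (θ j x ^ 2) *
        ENNReal.ofReal (homNormSq (cov (u j) x - v x))) +
          ENNReal.ofReal (c j x * homNormSq (v x))) μ := hm2.add hm3
    rw [← lintegral_const_mul' _ _ ENNReal.ofReal_ne_top, ← lintegral_const_mul' _ _ (by simp),
      ← lintegral_add_right' _ hm3, ← lintegral_add_right' _ hm4]
    refine lintegral_mono fun x ↦ ?_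
    have h3 := ENNReal.ofReal_le_ofReal (homNormSq_cov_truncation_sub_le hcov (hl j) (hu j).1 (hθ j)
      x (v x))
    have n1 := homNormSq_nonneg (mvfderiv (𝓡 m) (θ j) x)
    have n2 := homNormSq_nonneg (cov (u j) x - v x)
    have n3 := homNormSq_nonneg (v x)
    have n4 := (inv_pos.2 (hl j)).le
    rw [ENNReal.ofReal_add (by positivity) (by positivity), ENNReal.ofReal_add (by positivity)
      (by positivity), ENNReal.ofReal_mul n4, ENNReal.ofReal_mul (by norm_num : (0 : ℝ) ≤ 6),
      ENNReal.ofReal_mul (sq_nonneg (θ j x)), add_assoc] at h3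
    simpa using h3

end Density

/-! ### Limits of test sections are weak solutions. -/

section SquareIntegrable

variable {α : Type*} [MeasurableSpace α] {μ : Measure α}

theorem lintegral_enorm_le_of_abs_le_sqrt_mul_sqrt {f a b : α → ℝ} (ha : AEMeasurable a μ)
    (hb : AEMeasurable b μ) (ha0 : ∀ x, 0 ≤ a x) (hb0 : ∀ x, 0 ≤ b x)
    (hf : ∀ x, |f x| ≤ √(a x) * √(b x)) :
    ∫⁻ x, ‖f x‖ₑ ∂μ ≤ (∫⁻ x, ENNReal.ofReal (a x) ∂μ) ^ (1 / 2 : ℝ) *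
      (∫⁻ x, ENNReal.ofReal (b x) ∂μ) ^ (1 / 2 : ℝ) := by
  have key : ∀ {c : α → ℝ}, (∀ x, 0 ≤ c x) →
      ∀ x, ENNReal.ofReal √(c x) ^ (2 : ℝ) = ENNReal.ofReal (c x) := fun hc x ↦ by
    rw [ENNReal.rpow_two, ← ENNReal.ofReal_pow (Real.sqrt_nonneg _), Real.sq_sqrt (hc x)]
  have h1 := ENNReal.lintegral_mul_le_Lp_mul_Lq μ Real.HolderConjugate.two_two
    ha.sqrt.ennreal_ofReal hb.sqrt.ennreal_ofReal
  simp only [key ha0, key hb0] at h1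
  refine (lintegral_mono fun x ↦ ?_).trans h1
  rw [Pi.mul_apply, ← ENNReal.ofReal_mul (Real.sqrt_nonneg _), ← ofReal_norm, Real.norm_eq_abs]
  exact ENNReal.ofReal_le_ofReal (hf x)

theorem integrable_of_abs_le_sqrt_mul_sqrt {f a b : α → ℝ} (hfm : AEMeasurable f μ)
    (ha : AEMeasurable a μ) (hb : AEMeasurable b μ) (ha0 : ∀ x, 0 ≤ a x) (hb0 : ∀ x, 0 ≤ b x)
    (hf : ∀ x, |f x| ≤ √(a x) * √(b x)) (ha1 : ∫⁻ x, ENNReal.ofReal (a x) ∂μ < ⊤)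
    (hb1 : ∫⁻ x, ENNReal.ofReal (b x) ∂μ < ⊤) : Integrable f μ :=
  ⟨hfm.aestronglyMeasurable, (lintegral_enorm_le_of_abs_le_sqrt_mul_sqrt ha hb ha0 hb0 hf).trans_lt
    (ENNReal.mul_lt_top (ENNReal.rpow_lt_top_of_nonneg (by norm_num) ha1.ne)
      (ENNReal.rpow_lt_top_of_nonneg (by norm_num) hb1.ne))⟩

theorem tendsto_lintegral_enorm_of_abs_le_sqrt_mul_sqrt {f a : ℕ → α → ℝ} {b : α → ℝ}
    (ha : ∀ i, AEMeasurable (a i) μ) (hb : AEMeasurable b μ) (ha0 : ∀ i x, 0 ≤ a i x)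
    (hb0 : ∀ x, 0 ≤ b x) (hf : ∀ i x, |f i x| ≤ √(a i x) * √(b x))
    (ha1 : Tendsto (fun i ↦ ∫⁻ x, ENNReal.ofReal (a i x) ∂μ) atTop (𝓝 0))
    (hb1 : ∫⁻ x, ENNReal.ofReal (b x) ∂μ < ⊤) :
    Tendsto (fun i ↦ ∫⁻ x, ‖f i x‖ₑ ∂μ) atTop (𝓝 0) := by
  have h1 : Tendsto (fun i ↦ (∫⁻ x, ENNReal.ofReal (a i x) ∂μ) ^ (1 / 2 : ℝ) *
      (∫⁻ x, ENNReal.ofReal (b x) ∂μ) ^ (1 / 2 : ℝ)) atTop (𝓝 0) := by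
    have h2 := ENNReal.Tendsto.mul_const (ha1.ennrpow_const (1 / 2 : ℝ))
      (b := (∫⁻ x, ENNReal.ofReal (b x) ∂μ) ^ (1 / 2 : ℝ))
      (Or.inr (ENNReal.rpow_lt_top_of_nonneg (by norm_num) hb1.ne).ne)
    simpa using h2
  exact tendsto_of_tendsto_of_tendsto_of_le_of_le tendsto_const_nhds h1 (fun _ ↦ zero_le)
    fun i ↦ lintegral_enorm_le_of_abs_le_sqrt_mul_sqrt (ha i) hb (ha0 i) hb0 (hf i)

end SquareIntegrable

section LocallyFinite

variable {m : ℕ} {M : Type*} [TopologicalSpace M] [T2Space M] [SecondCountableTopology M]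
  [ChartedSpace (EuclideanSpace ℝ (Fin m)) M] [IsManifold (𝓡 m) ∞ M]
  [RiemannianBundle (fun x : M ↦ TangentSpace (𝓡 m) x)]
  [IsContMDiffRiemannianBundle (𝓡 m) ∞ (EuclideanSpace ℝ (Fin m))
    (fun x : M ↦ TangentSpace (𝓡 m) x)]
  [MeasurableSpace M] [BorelSpace M]

variable (m M) in
-- The density is bounded on a compact neighbourhood inside a chart domain. Test sections and test
-- forms are therefore in `L²`.
theorem isLocallyFiniteMeasure_riemannianMeasure :
    IsLocallyFiniteMeasure (riemannianMeasure m M) := by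
  refine ⟨fun x₀ ↦ ?_⟩
  have := ChartedSpace.locallyCompactSpace (EuclideanSpace ℝ (Fin m)) M
  set e := chartAt (EuclideanSpace ℝ (Fin m)) x₀
  obtain ⟨K, hK, hKs, hKc⟩ := local_compact_nhds
    (e.open_source.mem_nhds (mem_chart_source (EuclideanSpace ℝ (Fin m)) x₀))
  refine ⟨K, hK, ?_⟩
  have hKm : MeasurableSet K := hKc.isClosed.measurableSet
  obtain ⟨C, hC⟩ := hKc.exists_bound_of_continuousOn
    ((contMDiffOn_chartDensity (m := m) x₀).continuousOn.mono hKs)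
  have h1 : coordMeasure m x₀ K < ⊤ := by
    rw [coordMeasure, Measure.map_apply_of_aemeasurable (aemeasurable_chartAt_symm x₀) hKm,
      Measure.restrict_apply' e.open_target.measurableSet]
    refine (isCompact_image_chartAt hKc hKs).measure_lt_top.trans_le' (measure_mono ?_)
    rintro y ⟨hy, hyT⟩
    exact ⟨_, hy, e.right_inv hyT⟩
  rw [← lintegral_indicator_one hKm, lintegral_riemannianMeasure_eq (x₀ := x₀) fun x hx ↦
    Set.indicator_of_notMem (fun h ↦ hx (hKs h)) _]
  refine lt_of_le_of_lt (lintegral_mono (g := K.indicator fun _ ↦ ENNReal.ofReal C) fun x ↦ ?_) ?_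
  · by_cases hx : x ∈ K
    · simp only [Set.indicator_of_mem hx, Pi.one_apply, mul_one]
      exact ENNReal.ofReal_le_ofReal ((le_abs_self _).trans (hC x hx))
    · simp [hx]
  · rw [lintegral_indicator_const hKm]
    exact ENNReal.mul_lt_top ENNReal.ofReal_lt_top h1

theorem lintegral_riemannianMeasure_lt_top {f : M → ℝ} (hf : Continuous f)
    {K : Set M} (hK : IsCompact K) (hfK : ∀ x ∉ K, f x = 0) :
    ∫⁻ x, ENNReal.ofReal (f x) ∂(riemannianMeasure m M) < ⊤ := by
  have := isLocallyFiniteMeasure_riemannianMeasure m M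
  exact (hf.integrable_of_hasCompactSupport
    (HasCompactSupport.intro hK hfK)).lintegral_lt_top

variable {F : Type*} [NormedAddCommGroup F] [NormedSpace ℝ F] [FiniteDimensional ℝ F]
  {V : M → Type*} [TopologicalSpace (TotalSpace F V)]
  [∀ x, NormedAddCommGroup (V x)] [∀ x, InnerProductSpace ℝ (V x)]
  [FiberBundle F V] [VectorBundle ℝ F V] [ContMDiffVectorBundle ∞ F V (𝓡 m)]
  [IsContMDiffRiemannianBundle (𝓡 m) ∞ F V]

theorem MetricSobolev.IsTestSection.lintegral_norm_sq_lt_top {ψ : ∀ x, V x}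
    (hψ : IsTestSection F m ψ) :
    ∫⁻ x, ENNReal.ofReal (‖ψ x‖ ^ 2) ∂(riemannianMeasure m M) < ⊤ := by
  simp_rw [← real_inner_self_eq_norm_sq]
  refine lintegral_riemannianMeasure_lt_top (hψ.1.contMDiff_inner hψ.1).continuous hψ.2
    fun x hx ↦ ?_
  have : ψ x = 0 := by
    by_contra h
    exact hx (subset_closure h)
  simp [this]

omit [MeasurableSpace M] [BorelSpace M] in
theorem MetricSobolev.IsSmoothSection.continuous_homNormSq
    {φ : ∀ x : M, TangentSpace (𝓡 m) x →L[ℝ] V x}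
    (hφ : IsSmoothSection (EuclideanSpace ℝ (Fin m) →L[ℝ] F) m φ) :
    Continuous fun x ↦ homNormSq (φ x) := by
  refine continuous_iff_continuousAt.2 fun x₀ ↦ ?_
  obtain ⟨Y, hY, hb⟩ := exists_orthonormal_frame (m := m) (F := EuclideanSpace ℝ (Fin m))
    (V := fun x : M ↦ TangentSpace (𝓡 m) x) x₀
  have h1 : Continuous fun x ↦ ∑ i, inner ℝ (φ x (Y i x)) (φ x (Y i x)) :=
    continuous_finset_sum _ fun i _ ↦
      ((hφ.apply (hY i).1).contMDiff_inner (hφ.apply (hY i).1)).continuous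
  refine h1.continuousAt.congr ?_
  filter_upwards [hb] with x hx
  obtain ⟨b, hb⟩ := hx
  rw [homNormSq_eq_sum b]
  refine Finset.sum_congr rfl fun a _ ↦ ?_
  rw [hb, real_inner_self_eq_norm_sq]

theorem MetricSobolev.IsTestForm.formNormSqL2_lt_top
    {φ : ∀ x : M, TangentSpace (𝓡 m) x →L[ℝ] V x} (hφ : IsTestForm m F φ) :
    formNormSqL2 m φ < ⊤ := by
  refine lintegral_riemannianMeasure_lt_top hφ.1.continuous_homNormSq hφ.2 fun x hx ↦ ?_
  have : φ x = 0 := by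
    by_contra h
    exact hx (subset_closure h)
  simp [this]

theorem HasMeasurableCoeffs.aemeasurable_norm_sq {s : ∀ x, V x} {μ : Measure M}
    (hs : HasMeasurableCoeffs m F μ s) : AEMeasurable (fun x ↦ ‖s x‖ ^ 2) μ := by
  simp_rw [← real_inner_self_eq_norm_sq]
  exact hs.aemeasurable_inner hs

theorem lintegral_ofReal_norm_sq (s : ∀ x, V x) :
    ∫⁻ x, ENNReal.ofReal (‖s x‖ ^ 2) ∂(riemannianMeasure m M) = normSqL2 m s := by
  simp_rw [ENNReal.ofReal_pow (norm_nonneg _), ofReal_norm]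
  rfl

theorem abs_inner_le_sqrt_mul_sqrt {W : Type*} [NormedAddCommGroup W] [InnerProductSpace ℝ W]
    (v w : W) : |inner ℝ v w| ≤ √(‖v‖ ^ 2) * √(‖w‖ ^ 2) := by
  rw [Real.sqrt_sq (norm_nonneg _), Real.sqrt_sq (norm_nonneg _)]
  exact abs_real_inner_le_norm _ _

theorem integrable_inner_isTestSection {s ψ : ∀ x, V x} (hs : normSqL2 m s < ⊤)
    (hsm : HasMeasurableCoeffs m F (riemannianMeasure m M) s) (hψ : IsTestSection F m ψ) :
    Integrable (fun x ↦ inner ℝ (s x) (ψ x)) (riemannianMeasure m M) :=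
  integrable_of_abs_le_sqrt_mul_sqrt (hsm _ hψ.1) hsm.aemeasurable_norm_sq
    hψ.1.hasMeasurableCoeffs.aemeasurable_norm_sq (fun _ ↦ sq_nonneg _) (fun _ ↦ sq_nonneg _)
    (fun _ ↦ abs_inner_le_sqrt_mul_sqrt _ _) (by rwa [lintegral_ofReal_norm_sq])
    hψ.lintegral_norm_sq_lt_top

theorem integrable_homInner_isTestForm {v φ : ∀ x : M, TangentSpace (𝓡 m) x →L[ℝ] V x}
    (hv : formNormSqL2 m v < ⊤)
    (hvm : HasMeasurableFormCoeffs m F (riemannianMeasure m M) v) (hφ : IsTestForm m F φ) :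
    Integrable (fun x ↦ homInner ℝ (v x) (φ x)) (riemannianMeasure m M) :=
  integrable_of_abs_le_sqrt_mul_sqrt (hvm.aemeasurable_homInner hφ.1.hasMeasurableFormCoeffs)
    hvm.aemeasurable_homNormSq hφ.1.hasMeasurableFormCoeffs.aemeasurable_homNormSq
    (fun _ ↦ homNormSq_nonneg _) (fun _ ↦ homNormSq_nonneg _) (fun _ ↦ abs_homInner_le _ _) hv
    hφ.formNormSqL2_lt_top

theorem homInner_sub_left {T : Type*} [NormedAddCommGroup T] [InnerProductSpace ℝ T]
    [FiniteDimensional ℝ T] {W : Type*} [NormedAddCommGroup W] [InnerProductSpace ℝ W]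
    (A B C : T →L[ℝ] W) : homInner ℝ (A - B) C = homInner ℝ A C - homInner ℝ B C := by
  simp [homInner, inner_sub_left]

variable {cov : CovariantDerivative (𝓡 m) F V}

/-- A pair in the closure of the connection is a weak solution of `∇ s = w`. -/
theorem IsApproximable.hasWeakCovariantDerivative {s : ∀ x, V x}
    {w : ∀ x : M, TangentSpace (𝓡 m) x →L[ℝ] V x} (h : IsApproximable cov s w)
    (hcov : CovariantDerivative.ContMDiffCovariantDerivative cov ∞)
    (hs : normSqL2 m s < ⊤) (hsm : HasMeasurableCoeffs m F (riemannianMeasure m M) s)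
    (hw : formNormSqL2 m w < ⊤) (hwm : HasMeasurableFormCoeffs m F (riemannianMeasure m M) w) :
    HasWeakCovariantDerivative cov s w := by
  refine ⟨hs, hsm, hw, hwm, fun φ ψ hφψ ↦ ?_⟩
  obtain ⟨hφ, hψ, heq⟩ := hφψ
  obtain ⟨u, hu, hus, huw⟩ := h
  have hc := fun i ↦ isTestForm_cov hcov (hu i)
  have h1 : Tendsto (fun i ↦ ∫ x, inner ℝ (u i x) (ψ x) ∂(riemannianMeasure m M)) atTop
      (𝓝 (∫ x, inner ℝ (s x) (ψ x) ∂(riemannianMeasure m M))) := by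
    refine tendsto_integral_of_L1 _ (hsm _ hψ.1).aestronglyMeasurable (Eventually.of_forall fun i ↦
      integrable_inner_isTestSection ?_ (hu i).1.hasMeasurableCoeffs hψ) ?_
    · rw [← lintegral_ofReal_norm_sq]
      exact (hu i).lintegral_norm_sq_lt_top
    · simp_rw [← inner_sub_left]
      refine tendsto_lintegral_enorm_of_abs_le_sqrt_mul_sqrt
        (fun i ↦ ((hu i).1.hasMeasurableCoeffs.sub hsm).aemeasurable_norm_sq)
        hψ.1.hasMeasurableCoeffs.aemeasurable_norm_sq (fun _ _ ↦ sq_nonneg _) (fun _ ↦ sq_nonneg _)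
        (fun _ _ ↦ abs_inner_le_sqrt_mul_sqrt _ _) ?_ hψ.lintegral_norm_sq_lt_top
      simp_rw [lintegral_ofReal_norm_sq]
      exact hus
  have h2 : Tendsto (fun i ↦ ∫ x, homInner ℝ (cov (u i) x) (φ x) ∂(riemannianMeasure m M)) atTop
      (𝓝 (∫ x, homInner ℝ (w x) (φ x) ∂(riemannianMeasure m M))) := by
    refine tendsto_integral_of_L1 _
      (hwm.aemeasurable_homInner hφ.1.hasMeasurableFormCoeffs).aestronglyMeasurable
      (Eventually.of_forall fun i ↦ integrable_homInner_isTestForm (hc i).formNormSqL2_lt_top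
        (hc i).1.hasMeasurableFormCoeffs hφ) ?_
    simp_rw [← homInner_sub_left]
    exact tendsto_lintegral_enorm_of_abs_le_sqrt_mul_sqrt
      (fun i ↦ ((hc i).1.hasMeasurableFormCoeffs.sub hwm).aemeasurable_homNormSq)
      hφ.1.hasMeasurableFormCoeffs.aemeasurable_homNormSq (fun _ _ ↦ homNormSq_nonneg _)
      (fun _ ↦ homNormSq_nonneg _) (fun _ _ ↦ abs_homInner_le _ _) huw hφ.formNormSqL2_lt_top
  -- The adjoint identity holds for each test section `u i`, and both of its sides converge.
  refine tendsto_nhds_unique h1 (h2.congr fun i ↦ ?_)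
  exact (heq _ (hu i)).symm

end LocallyFinite

/-! ### Reduction of the real or Hermitian case to real inner products. -/

section RealPart

variable {𝕂 : Type*} [RCLike 𝕂] {W : Type*} [NormedAddCommGroup W] [InnerProductSpace 𝕂 W]
  [InnerProductSpace ℝ W]

/-- The imaginary part of `⟨v, w⟩` is `-Re ⟨v, I w⟩`. If the scalars are real, `I = 0` and the
second term disappears. -/
theorem inner_eq_sub_mul_I (hre : ∀ v w : W, inner ℝ v w = RCLike.re (inner 𝕂 v w)) (v w : W) :
    inner 𝕂 v w = ((inner ℝ v w : ℝ) : 𝕂) -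
      ((inner ℝ v ((RCLike.I : 𝕂) • w) : ℝ) : 𝕂) * RCLike.I := by
  rw [hre, hre, inner_smul_right, RCLike.I_mul_re]
  simp [RCLike.re_add_im]

theorem inner_I_smul_right_eq_neg (hre : ∀ v w : W, inner ℝ v w = RCLike.re (inner 𝕂 v w))
    (v w : W) : inner ℝ v ((RCLike.I : 𝕂) • w) = - inner ℝ ((RCLike.I : 𝕂) • v) w := by
  rw [hre, hre, inner_smul_right, inner_smul_left]
  simp

variable [IsScalarTower ℝ 𝕂 W] {T : Type*} [NormedAddCommGroup T] [InnerProductSpace ℝ T]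
  [FiniteDimensional ℝ T]

theorem homInner_eq_sub_mul_I (hre : ∀ v w : W, inner ℝ v w = RCLike.re (inner 𝕂 v w))
    (A B : T →L[ℝ] W) :
    homInner 𝕂 A B = ((homInner ℝ A B : ℝ) : 𝕂) -
      ((homInner ℝ A ((RCLike.I : 𝕂) • B) : ℝ) : 𝕂) * RCLike.I := by
  simp only [homInner, inner_eq_sub_mul_I hre, Finset.sum_sub_distrib, Finset.sum_mul,
    RCLike.ofReal_sum]
  rfl

theorem homInner_I_smul_right_eq_neg (hre : ∀ v w : W, inner ℝ v w = RCLike.re (inner 𝕂 v w))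
    (A B : T →L[ℝ] W) :
    homInner ℝ A ((RCLike.I : 𝕂) • B) = - homInner ℝ ((RCLike.I : 𝕂) • A) B := by
  rw [homInner, homInner, ← Finset.sum_neg_distrib]
  exact Finset.sum_congr rfl fun i _ ↦ inner_I_smul_right_eq_neg hre _ _

end RealPart

section Smooth

variable {𝕂 : Type*} [RCLike 𝕂] {m : ℕ} {M : Type*} [TopologicalSpace M]
  [ChartedSpace (EuclideanSpace ℝ (Fin m)) M]
  {F : Type*} [NormedAddCommGroup F] [NormedSpace 𝕂 F] [NormedSpace ℝ F] [IsScalarTower ℝ 𝕂 F]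
  {V : M → Type*} [TopologicalSpace (TotalSpace F V)]
  [∀ x, NormedAddCommGroup (V x)] [∀ x, NormedSpace 𝕂 (V x)]
  [∀ x, NormedSpace ℝ (V x)] [∀ x, IsScalarTower ℝ 𝕂 (V x)]
  [FiberBundle F V] [VectorBundle 𝕂 F V] [VectorBundle ℝ F V]

theorem contMDiffAt_const_smul_section (c : 𝕂) {s : ∀ x, V x} {x₀ : M}
    (hs : ContMDiffAt (𝓡 m) ((𝓡 m).prod 𝓘(ℝ, F)) ∞ (fun x ↦ TotalSpace.mk' F x (s x)) x₀) :
    ContMDiffAt (𝓡 m) ((𝓡 m).prod 𝓘(ℝ, F)) ∞ (fun x ↦ TotalSpace.mk' F x (c • s x)) x₀ := by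
  rw [Bundle.contMDiffAt_section] at hs ⊢
  have h1 := ((c • ContinuousLinearMap.id ℝ F).contMDiff.contMDiffAt (n := ∞)).comp x₀ hs
  refine h1.congr_of_eventuallyEq ?_
  filter_upwards [(trivializationAt F V x₀).open_baseSet.mem_nhds
    (mem_baseSet_trivializationAt F V x₀)] with y hy
  exact ((trivializationAt F V x₀).linear 𝕂 hy).map_smul c (s y)

theorem MetricSobolev.IsSmoothSection.const_smul (c : 𝕂) {s : ∀ x, V x}
    (hs : IsSmoothSection F m s) :
    IsSmoothSection F m (fun x ↦ c • s x) :=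
  fun x ↦ contMDiffAt_const_smul_section c (hs x)

theorem MetricSobolev.IsTestSection.const_smul [T2Space M] (c : 𝕂) {s : ∀ x, V x}
    (hs : IsTestSection F m s) :
    IsTestSection F m (fun x ↦ c • s x) :=
  (hs.1.const_smul c).isTestSection hs.2 fun x hx ↦ by
    have : s x = 0 := by
      by_contra h
      exact hx (subset_closure h)
    simp [this]

variable [IsManifold (𝓡 m) ∞ M] [ContMDiffVectorBundle ∞ F V (𝓡 m)]

theorem MetricSobolev.IsTestForm.const_smul [RiemannianBundle (fun x : M ↦ TangentSpace (𝓡 m) x)]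
    [T2Space M] (c : 𝕂) {φ : ∀ x : M, TangentSpace (𝓡 m) x →L[ℝ] V x}
    (hφ : IsTestForm m F φ) : IsTestForm m F (fun x ↦ c • φ x) := by
  refine IsSmoothSection.isTestSection (fun x₀ ↦ ?_) hφ.2 fun x hx ↦ ?_
  · refine contMDiffAt_hom_of_apply_symm (F₁ := EuclideanSpace ℝ (Fin m))
      (E₁ := fun x : M ↦ TangentSpace (𝓡 m) x) (F₂ := F) (E₂ := V) _ x₀ fun v ↦ ?_
    exact contMDiffAt_const_smul_section c (ContMDiffAt.clm_bundle_apply (F₁ := EuclideanSpace ℝ (Fin m)) (F₂ := F)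
      (E₁ := fun x : M ↦ TangentSpace (𝓡 m) x) (E₂ := V) (b := fun x ↦ x) (hφ.1 x₀)
      (contMDiffAt_trivializationAt_symm x₀ v))
  · have : φ x = 0 := by
      by_contra h
      exact hx (subset_closure h)
    simp [this]

end Smooth

section RealMetric

variable {𝕂 : Type*} [RCLike 𝕂] {m : ℕ} {M : Type*} [TopologicalSpace M]
  [ChartedSpace (EuclideanSpace ℝ (Fin m)) M]
  [IsManifold (𝓡 m) ∞ M]
  {F : Type*} [NormedAddCommGroup F] [NormedSpace ℝ F] [FiniteDimensional ℝ F]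
  {V : M → Type*} [TopologicalSpace (TotalSpace F V)]
  [∀ x, NormedAddCommGroup (V x)] [∀ x, InnerProductSpace 𝕂 (V x)]
  [∀ x, InnerProductSpace ℝ (V x)]
  [FiberBundle F V] [VectorBundle ℝ F V] [ContMDiffVectorBundle ∞ F V (𝓡 m)]

/-- The metric is a section of `Hom(V, Hom(V, ℝ))`; two applications of the criterion for
homomorphisms leave the coefficients `Re h(e.symm v, e.symm w)`, which are smooth by assumption. -/
theorem MetricSobolev.IsSmoothMetric.isContMDiffRiemannianBundle
    (h : IsSmoothMetric 𝕂 m F (V := V))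
    (hre : ∀ x (v w : V x), inner ℝ v w = RCLike.re (inner 𝕂 v w)) :
    IsContMDiffRiemannianBundle (𝓡 m) ∞ F V := by
  refine ⟨fun x ↦ innerSL ℝ, fun x₀ ↦ ?_, fun x v w ↦ rfl⟩
  refine contMDiffAt_hom_of_apply_symm (F₁ := F) (E₁ := V) (F₂ := F →L[ℝ] ℝ)
    (E₂ := fun x ↦ V x →L[ℝ] Bundle.Trivial M ℝ x) _ x₀ fun v ↦ ?_
  refine contMDiffAt_hom_of_apply_symm (F₁ := F) (E₁ := V) (F₂ := ℝ)
    (E₂ := Bundle.Trivial M ℝ) _ x₀ fun w ↦ ?_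
  rw [Bundle.contMDiffAt_section]
  have h1 := (h (trivializationAt F V x₀) v w).contMDiffAt
    ((trivializationAt F V x₀).open_baseSet.mem_nhds (mem_baseSet_trivializationAt F V x₀))
  have h2 := ((RCLike.reCLM (K := 𝕂)).contMDiff.contMDiffAt (n := ∞)).comp x₀ h1
  refine h2.congr_of_eventuallyEq (Eventually.of_forall fun x ↦ ?_)
  exact hre x _ _

variable [RiemannianBundle (fun x : M ↦ TangentSpace (𝓡 m) x)]
  [MeasurableSpace M]
  [NormedSpace 𝕂 F] [IsScalarTower ℝ 𝕂 F] [∀ x, IsScalarTower ℝ 𝕂 (V x)]  [VectorBundle 𝕂 F V]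
  [IsContMDiffRiemannianBundle (𝓡 m) ∞ F V] {cov : CovariantDerivative (𝓡 m) F V}

omit [RiemannianBundle (fun x : M ↦ TangentSpace (𝓡 m) x)] [MeasurableSpace M]
  [∀ x, IsScalarTower ℝ 𝕂 (V x)] [IsManifold (𝓡 m) ∞ M] [FiniteDimensional ℝ F]
  [ContMDiffVectorBundle ∞ F V (𝓡 m)] in
theorem contMDiff_inner_of_re [∀ x, IsScalarTower ℝ 𝕂 (V x)]
    (hre : ∀ x (v w : V x), inner ℝ v w = RCLike.re (inner 𝕂 v w))
    {s t : ∀ x, V x} (hs : IsSmoothSection F m s) (ht : IsSmoothSection F m t) :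
    ContMDiff (𝓡 m) 𝓘(ℝ, 𝕂) ∞ (fun x ↦ (inner 𝕂 (s x) (t x) : 𝕂)) := by
  simp_rw [inner_eq_sub_mul_I (hre _)]
  have h1 := (RCLike.ofRealCLM (K := 𝕂)).contMDiff (n := ∞) |>.comp (hs.contMDiff_inner ht)
  have h2 := (RCLike.ofRealCLM (K := 𝕂)).contMDiff (n := ∞) |>.comp
    (hs.contMDiff_inner (ht.const_smul (RCLike.I : 𝕂)))
  have h3 := ((ContinuousLinearMap.mul ℝ 𝕂).flip RCLike.I).contMDiff (n := ∞) |>.comp h2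
  exact h1.sub h3

theorem mvfderiv_re {f : M → 𝕂} {x : M} (hf : MDifferentiableAt (𝓡 m) 𝓘(ℝ, 𝕂) f x)
    (X : TangentSpace (𝓡 m) x) :
    mvfderiv (𝓡 m) (fun y ↦ RCLike.re (f y)) x X = RCLike.re (mvfderiv (𝓡 m) f x X) := by
  have h := mfderiv_comp_apply (I := 𝓡 m) (I' := 𝓘(ℝ, 𝕂)) (I'' := 𝓘(ℝ)) x
    (show MDifferentiableAt 𝓘(ℝ, 𝕂) 𝓘(ℝ) (RCLike.reCLM (K := 𝕂)) (f x) from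
      (RCLike.reCLM (K := 𝕂)).differentiableAt.mdifferentiableAt) hf X
  have h1 : mfderiv 𝓘(ℝ, 𝕂) 𝓘(ℝ) (RCLike.reCLM (K := 𝕂)) (f x) = RCLike.reCLM (K := 𝕂) :=
    mfderiv_eq_fderiv.trans (RCLike.reCLM (K := 𝕂)).fderiv
  rw [h1] at h
  exact h

theorem MetricSobolev.IsMetricConnection.real (hcov : IsMetricConnection 𝕂 m F cov)
    (hre : ∀ x (v w : V x), inner ℝ v w = RCLike.re (inner 𝕂 v w)) :
    IsMetricConnection ℝ m F cov where
  smooth := hcov.smooth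
  smul c s hs x X := by
    have h1 := hcov.smul (c : 𝕂) s hs x X
    simp only [RCLike.real_smul_eq_coe_smul (K := 𝕂)]
    exact h1
  metric s t hs ht x X := by
    simp_rw [hre]
    rw [mvfderiv_re ((contMDiff_inner_of_re hre hs ht).mdifferentiable (by simp) x), hcov.metric s t hs ht, map_add]

variable [T2Space M] [SecondCountableTopology M] [BorelSpace M] [IsContMDiffRiemannianBundle (𝓡 m) ∞ (EuclideanSpace ℝ (Fin m))
    (fun x : M ↦ TangentSpace (𝓡 m) x)]

theorem integral_inner_eq_sub_mul_I
    (hre : ∀ x (v w : V x), inner ℝ v w = RCLike.re (inner 𝕂 v w)) {s ψ : ∀ x, V x}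
    (hs : normSqL2 m s < ⊤)
    (hsm : HasMeasurableCoeffs m F (riemannianMeasure m M) s) (hψ : IsTestSection F m ψ) :
    ∫ x, (inner 𝕂 (s x) (ψ x) : 𝕂) ∂(riemannianMeasure m M) =
      ((∫ x, inner ℝ (s x) (ψ x) ∂(riemannianMeasure m M) : ℝ) : 𝕂) -
      ((∫ x, inner ℝ (s x) ((RCLike.I : 𝕂) • ψ x) ∂(riemannianMeasure m M) : ℝ) : 𝕂) * RCLike.I := by
  simp_rw [inner_eq_sub_mul_I (hre _)]
  rw [integral_sub (integrable_inner_isTestSection hs hsm hψ).ofReal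
    ((integrable_inner_isTestSection hs hsm (hψ.const_smul RCLike.I)).ofReal.mul_const _),
    integral_mul_const, integral_ofReal, integral_ofReal]

theorem integral_homInner_eq_sub_mul_I
    (hre : ∀ x (v w : V x), inner ℝ v w = RCLike.re (inner 𝕂 v w))
    {v φ : ∀ x : M, TangentSpace (𝓡 m) x →L[ℝ] V x} (hv : formNormSqL2 m v < ⊤)
    (hvm : HasMeasurableFormCoeffs m F (riemannianMeasure m M) v) (hφ : IsTestForm m F φ) :
    ∫ x, (homInner 𝕂 (v x) (φ x) : 𝕂) ∂(riemannianMeasure m M) =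
      ((∫ x, homInner ℝ (v x) (φ x) ∂(riemannianMeasure m M) : ℝ) : 𝕂) -
      ((∫ x, homInner ℝ (v x) ((RCLike.I : 𝕂) • φ x) ∂(riemannianMeasure m M) : ℝ) : 𝕂) *
        RCLike.I := by
  simp_rw [homInner_eq_sub_mul_I (hre _)]
  rw [integral_sub (integrable_homInner_isTestForm hv hvm hφ).ofReal
    ((integrable_homInner_isTestForm hv hvm (hφ.const_smul RCLike.I)).ofReal.mul_const _),
    integral_mul_const, integral_ofReal, integral_ofReal]

variable {φ : ∀ x : M, TangentSpace (𝓡 m) x →L[ℝ] V x} {ψ : ∀ x, V x}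

/-- Multiplication by `I` is skew for both real inner products and commutes with `∇`, so it can be
moved onto the test section `u`. -/
theorem MetricSobolev.IsFormalAdjoint.I_smul (h : IsFormalAdjoint ℝ m F cov φ ψ)
    (hcov : IsMetricConnection 𝕂 m F cov)
    (hre : ∀ x (v w : V x), inner ℝ v w = RCLike.re (inner 𝕂 v w)) :
    IsFormalAdjoint ℝ m F cov (fun x ↦ (RCLike.I : 𝕂) • φ x) (fun x ↦ (RCLike.I : 𝕂) • ψ x) := by
  refine ⟨h.1.const_smul _, h.2.1.const_smul _, fun u hu ↦ ?_⟩
  simp_rw [inner_I_smul_right_eq_neg (hre _), homInner_I_smul_right_eq_neg (hre _), integral_neg]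
  rw [h.2.2 _ (hu.const_smul (RCLike.I : 𝕂))]
  congr 2
  ext x
  congr 1
  ext X
  exact hcov.smul _ u hu.1 x X

/-- The real identity for `(φ, ψ)` is the real part of the claim, and the real identity for `(I φ, I
ψ)` is its imaginary part. -/
theorem MetricSobolev.IsFormalAdjoint.of_real (h : IsFormalAdjoint ℝ m F cov φ ψ)
    (hcov : IsMetricConnection 𝕂 m F cov)
    (hre : ∀ x (v w : V x), inner ℝ v w = RCLike.re (inner 𝕂 v w)) :
    IsFormalAdjoint 𝕂 m F cov φ ψ := by
  refine ⟨h.1, h.2.1, fun u hu ↦ ?_⟩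
  have hc := isTestForm_cov hcov.smooth hu
  rw [integral_inner_eq_sub_mul_I hre (by
      rw [← lintegral_ofReal_norm_sq]
      exact hu.lintegral_norm_sq_lt_top) hu.1.hasMeasurableCoeffs h.2.1,
    integral_homInner_eq_sub_mul_I hre hc.formNormSqL2_lt_top hc.1.hasMeasurableFormCoeffs h.1,
    h.2.2 u hu, (h.I_smul hcov hre).2.2 u hu]

theorem re_ofReal_sub_ofReal_mul_I (a b : ℝ) :
    RCLike.re ((a : 𝕂) - (b : 𝕂) * RCLike.I) = a := by
  simp

theorem MetricSobolev.IsFormalAdjoint.to_real (h : IsFormalAdjoint 𝕂 m F cov φ ψ)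
    (hcov : IsMetricConnection 𝕂 m F cov)
    (hre : ∀ x (v w : V x), inner ℝ v w = RCLike.re (inner 𝕂 v w)) :
    IsFormalAdjoint ℝ m F cov φ ψ := by
  refine ⟨h.1, h.2.1, fun u hu ↦ ?_⟩
  have hc := isTestForm_cov hcov.smooth hu
  have h1 := congrArg RCLike.re (h.2.2 u hu)
  rwa [integral_inner_eq_sub_mul_I hre (by
      rw [← lintegral_ofReal_norm_sq]
      exact hu.lintegral_norm_sq_lt_top) hu.1.hasMeasurableCoeffs h.2.1,
    integral_homInner_eq_sub_mul_I hre hc.formNormSqL2_lt_top hc.1.hasMeasurableFormCoeffs h.1,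
    re_ofReal_sub_ofReal_mul_I, re_ofReal_sub_ofReal_mul_I] at h1

/-- Being a distributional solution of `∇ s = v` does not depend on the scalars. -/
theorem hasWeakCovariantDerivative_iff_isMaxExtension (hcov : IsMetricConnection 𝕂 m F cov)
    (hre : ∀ x (v w : V x), inner ℝ v w = RCLike.re (inner 𝕂 v w)) {s : ∀ x, V x}
    {v : ∀ x : M, TangentSpace (𝓡 m) x →L[ℝ] V x} (hs : IsL2Section m F s) (hv : IsL2Form m F v) :
    HasWeakCovariantDerivative cov s v ↔ IsMaxExtension 𝕂 m F cov s v := by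
  have hsm : HasMeasurableCoeffs m F (riemannianMeasure m M) s := hs.1.hasMeasurableCoeffs
  have hvm : HasMeasurableFormCoeffs m F (riemannianMeasure m M) v :=
    hv.1.hasMeasurableFormCoeffs
  refine ⟨fun h ↦ ⟨hs, hv, fun φ ψ h' ↦ ?_⟩, fun h ↦ ⟨hs.2, hsm, hv.2, hvm, fun φ ψ h' ↦ ?_⟩⟩
  · have hr := h'.to_real hcov hre
    rw [integral_inner_eq_sub_mul_I hre hs.2 hsm h'.2.1,
      integral_homInner_eq_sub_mul_I hre hv.2 hvm h'.1, h.integral_eq _ _ hr,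
      h.integral_eq _ _ (hr.I_smul hcov hre)]
  · have h1 := congrArg RCLike.re (h.2.2 φ ψ (h'.of_real hcov hre))
    rwa [integral_inner_eq_sub_mul_I hre hs.2 hsm h'.2.1,
      integral_homInner_eq_sub_mul_I hre hv.2 hvm h'.1, re_ofReal_sub_ofReal_mul_I,
      re_ofReal_sub_ofReal_mul_I] at h1

/-- `W_0^{1,2} = W^{1,2}`, for metrics that are the real part of a real or Hermitian metric. -/
theorem W12Zero_eq_W12_of_re (hcov : IsMetricConnection 𝕂 m F cov)
    (hre : ∀ x (v w : V x), inner ℝ v w = RCLike.re (inner 𝕂 v w)) {φ : ℕ → M → ℝ}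
    (hφ_lim : ∀ x, Tendsto (fun j ↦ φ j x) atTop (𝓝 1))
    {η : ℕ → ∀ x : M, TangentSpace (𝓡 m) x →L[ℝ] ℝ}
    (hη : ∀ j, IsMinExteriorDerivative m (φ j) (η j))
    (hη_lim : Tendsto (fun j ↦ formNormSqL2 m (V := Bundle.Trivial M ℝ) (η j)) atTop (𝓝 0)) :
    W12Zero m F cov = W12 𝕂 m F cov := by
  have hreal := hcov.real hre
  refine Set.Subset.antisymm ?_ ?_
  · rintro s ⟨w, hs, hw, h⟩
    have h1 : IsApproximable cov s w := h
    exact ⟨w, (hasWeakCovariantDerivative_iff_isMaxExtension hcov hre hs hw).1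
      (h1.hasWeakCovariantDerivative hcov.smooth hs.2 hs.1.hasMeasurableCoeffs hw.2
        hw.1.hasMeasurableFormCoeffs)⟩
  · rintro s ⟨v, h⟩
    obtain ⟨θ, hθ, hθc, hθ1, hθ_lim, hdθ⟩ := exists_smooth_cutoffs hφ_lim hη hη_lim
    exact ⟨v, h.1, h.2.1, ((hasWeakCovariantDerivative_iff_isMaxExtension hcov hre h.1 h.2.1).2
      h).isApproximable hreal hθ hθc hθ1 hθ_lim hdθ⟩

end RealMetric

theorem mainTheorem9 {m : ℕ}
    -- the (possibly incomplete) Riemannian manifold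
    {M : Type*} [TopologicalSpace M] [T2Space M] [SecondCountableTopology M]
    [ChartedSpace (EuclideanSpace ℝ (Fin m)) M] [IsManifold (𝓡 m) ∞ M]
    [RiemannianBundle (fun x : M ↦ TangentSpace (𝓡 m) x)]
    [IsContMDiffRiemannianBundle (𝓡 m) ∞ (EuclideanSpace ℝ (Fin m))
      (fun x : M ↦ TangentSpace (𝓡 m) x)]
    [MeasurableSpace M] [BorelSpace M]
    -- the cut-off functions and their differentials
    (φ : ℕ → M → ℝ)
    (hφ_lip : ∀ j, IsLipschitz m (φ j))
    (hφ_supp : ∀ j, HasCompactSupport (φ j))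
    (hφ_bound : ∀ j x, 0 ≤ φ j x ∧ φ j x ≤ 1)
    (hφ_lim : ∀ x, Tendsto (fun j ↦ φ j x) atTop (𝓝 1))
    (η : ℕ → ∀ x : M, TangentSpace (𝓡 m) x →L[ℝ] ℝ)
    (hη : ∀ j, IsMinExteriorDerivative m (φ j) (η j))
    (hη_lim : Tendsto (fun j ↦ formNormSqL2 m (V := Bundle.Trivial M ℝ) (η j)) atTop (𝓝 0))
    -- the real or complex vector bundle
    {𝕂 : Type*} [RCLike 𝕂]
    {F : Type*} [NormedAddCommGroup F] [NormedSpace 𝕂 F] [FiniteDimensional 𝕂 F]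
    [NormedSpace ℝ F] [IsScalarTower ℝ 𝕂 F]
    {V : M → Type*} [TopologicalSpace (TotalSpace F V)]
    [∀ x, NormedAddCommGroup (V x)] [∀ x, InnerProductSpace 𝕂 (V x)]
    [∀ x, NormedSpace ℝ (V x)] [∀ x, IsScalarTower ℝ 𝕂 (V x)]
    [FiberBundle F V] [VectorBundle 𝕂 F V] [VectorBundle ℝ F V]
    [ContMDiffVectorBundle ∞ F V (𝓡 m)]
    -- its metric and the metric connection
    (h_metric : IsSmoothMetric 𝕂 m F (V := V))
    (cov : CovariantDerivative (𝓡 m) F V)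
    (hcov : IsMetricConnection 𝕂 m F cov) :
    W12Zero m F cov = W12 𝕂 m F cov := by
  -- The given real normed structure is kept and only the inner product `Re h` is added, so that the
  -- sets in the statement do not change.
  let _ : ∀ x, InnerProductSpace ℝ (V x) := fun x ↦
    { (inferInstance : NormedSpace ℝ (V x)) with
      inner v w := RCLike.re (inner 𝕂 v w)
      norm_sq_eq_re_inner v := norm_sq_eq_re_inner (𝕜 := 𝕂) v
      conj_inner_symm v w := inner_re_symm (𝕜 := 𝕂) w v
      add_left v w z := by simp [inner_add_left]
      smul_left v w r := by
        rw [RCLike.real_smul_eq_coe_smul (K := 𝕂), inner_smul_left, RCLike.conj_ofReal,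
          RCLike.re_ofReal_mul]
        rfl }
  have : FiniteDimensional ℝ F := FiniteDimensional.trans ℝ 𝕂 F
  have hre : ∀ x (v w : V x), inner ℝ v w = RCLike.re (inner 𝕂 v w) := fun _ _ _ ↦ rfl
  have := h_metric.isContMDiffRiemannianBundle hre
  exact W12Zero_eq_W12_of_re hcov hre hφ_lim hη hη_lim
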